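/- Let $k$ be a field of characteristic $0$ and let $(\mathfrak g,\delta)$ be a finite dimensional Lie bialgebra over $k$ with a Lie subbialgebra $\mathfrak h\subset\mathfrak g$. Let $Z\in\wedge^3(\mathfrak g)^{\mathfrak g}$, and let $(e_i)$, $(\varepsilon^i)$ be dual bases of $\mathfrak h$, $\mathfrak h^*$. *Conventions.* For a finite dimensional Lie bialgebra $\mathfrak a$, $U(\mathfrak a)^*$ is the function ring $k[[A]]$ of its formal Poisson–Lie group $A$: the product is dual to the coproduct $\Delta$ of $U(\mathfrak a)$, and $\{f,g\}_A=(f\otimes g)\circ\delta_U$, where $\delta_U:U(\mathfrak a)\to U(\mathfrak a)^{\otimes 2}$ extends $\delta$ by $\delta_U(xy)=\Delta(x)\delta_U(y)+\delta_U(x)\Delta(y)$. Moreover $(\mathbf L_af)(x)=-f(ax)$ and $(\mathbf R_af)(x)=f(xa)$, i.e. $(\mathbf L_af)(x)=\frac{d}{d\varepsilon}|_{\varepsilon=0}f(e^{-\varepsilon a}x)$ and $(\mathbf R_af)(x)=\frac{d}{d\varepsilon}|_{\varepsilon=0}f(xe^{\varepsilon a})$. On the double $\mathfrak d(\mathfrak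 a)=\mathfrak a\oplus\mathfrak a^*$, with projection $v\mapsto v_{\mathfrak a}$ to $\mathfrak a$ along $\mathfrak a^*$, the left dressing action is $(\mathrm{dress}^L_vf)(x)=-(\mathbf R_{(\mathrm{Ad}(x^{-1})v)_{\mathfrak a}}f)(x)$. It is used for $\mathfrak a=\mathfrak h^*$ and $v\in\mathfrak h=(\mathfrak h^*)^*\subset\mathfrak d(\mathfrak h^*)$. Let $H^*$ and $G$ be Poisson–Lie groups with Lie bialgebras $\mathfrak h^*$ and $\mathfrak g$, of one of two kinds. *Formal:* $\mathcal O_{H^*}=U(\mathfrak h^*)^*$, $\mathcal O_G=U(\mathfrak g)^*$, and $\mathcal O_{H^*}\otimes\mathcal O_G$ means the completed tensor product $(U(\mathfrak h^*)\otimes U(\mathfrak g))^*$. *Algebraic:* $\mathcal O_{H^*}\subset U(\mathfrak h^*)^*$ and $\mathcal O_G\subset U(\mathfrak g)^*$ are Hopf subalgebras stable under the Poisson brackets; whenever $\mathrm{dress}^L$ is used, the matrix coefficients of the adjoint action of $H^*$ on $\mathfrak d(\mathfrak h^*)$ are assumed to lie in $\mathcal O_{H^*}$. For $\rho=\sum_\alpha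 a_\alpha\otimes b_\alpha\otimes\ell_\alpha\in\wedge^2(\mathfrak g)\otimes\mathcal O_{H^*}$ put $\mathrm d^L\rho=-\sum_{\alpha,i}a_\alpha\otimes b_\alpha\otimes e_i\otimes\mathbf L_{\varepsilon^i}(\ell_\alpha)$ and $\mathrm{CYB}(\rho)=[\rho^{1,2},\rho^{1,3}]+[\rho^{1,2},\rho^{2,3}]+[\rho^{1,3},\rho^{2,3}]$, and let $\mathrm{Alt}$ be the sum of the three cyclic permutations of a tensor in $\mathfrak g^{\otimes3}$. Then $\rho$ is a *PL dynamical $r$-matrix for $(H^*,\mathfrak g,Z)$* if $Z\in\wedge^3(\mathfrak g)^{\mathfrak g}$, the total antisymmetrization of $(\delta\otimes\mathrm{id}^{\otimes2})(Z)$ is $0$, $\mathrm{dress}^L_u(\rho)+[u\otimes1+1\otimes u,\rho]=0$ for all $u\in\mathfrak h$, and $\mathrm{CYB}(\rho)+\mathrm{Alt}(\mathrm d^L\rho)+\mathrm{Alt}((\delta\otimes\mathrm{id})(\rho))=Z$. **Proposition.** (1) For every $\rho=\sum_\alpha a_\alpha\otimes b_\alpha\otimes\ell_\alpha\in\wedge^2(\mathfrak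 g)\otimes\mathcal O_{H^*}$ there is a unique bilinear bracket on $\mathcal O_{H^*}\otimes\mathcal O_G$, antisymmetric and satisfying the Leibniz identity with respect to each variable, such that for all $f,f_1,f_2\in\mathcal O_{H^*}$ and $g,g_1,g_2\in\mathcal O_G$ $$\{f_1\otimes1,f_2\otimes1\}=-\{f_1,f_2\}_{H^*}\otimes1,\qquad \{f\otimes1,1\otimes g\}=\sum_i\mathbf L_{\varepsilon^i}(f)\otimes\mathbf L_{e_i}(g),$$ $$\{1\otimes g_1,1\otimes g_2\}=1\otimes\{g_1,g_2\}_G+\sum_\alpha\ell_\alpha\otimes\mathbf L_{a_\alpha}(g_1)\mathbf L_{b_\alpha}(g_2).$$ (2) If $\rho$ is a PL dynamical $r$-matrix for $(H^*,\mathfrak g,Z)$, then for all $\phi_1,\phi_2,\phi_3\in\mathcal O_{H^*}\otimes\mathcal O_G$ $$\{\{\phi_1,\phi_2\},\phi_3\}+\{\{\phi_2,\phi_3\},\phi_1\}+\{\{\phi_3,\phi_1\},\phi_2\}=m\big((\mathrm{id}\otimes\mathbf R)^{\otimes3}(Z)(\phi_1\otimes\phi_2\otimes\phi_3)\big),$$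 where $m$ is the product. Moreover this structure carries two commuting Poisson actions: the action of $(\mathfrak h,-\delta_{|\mathfrak h})$ by $\mathrm{dress}^L\otimes\mathrm{id}+\mathrm{id}\otimes\mathbf L$, and the action of $(\mathfrak g,\delta)$ by $\mathrm{id}\otimes\mathbf R$. Here a Poisson action of a Lie algebra $\mathfrak a$ with cobracket $\delta_{\mathfrak a}$ is a Lie algebra morphism $\theta$ from $\mathfrak a$ to the derivations such that $\theta_a\{\phi,\psi\}=\{\theta_a\phi,\psi\}+\{\phi,\theta_a\psi\}+\sum\theta_{a^{(1)}}(\phi)\theta_{a^{(2)}}(\psi)$ for $\delta_{\mathfrak a}(a)=\sum a^{(1)}\otimes a^{(2)}$. -/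

import Mathlib

open scoped TensorProduct

set_option linter.unusedSectionVars false

noncomputable section

namespace PLGroup

/-- The cyclic permutation `a ⊗ b ⊗ c ↦ b ⊗ c ⊗ a` of `V ⊗ V ⊗ V`. -/
def cyc (k V : Type*) [CommRing k] [AddCommGroup V] [Module k V] :
    V ⊗[k] (V ⊗[k] V) →ₗ[k] V ⊗[k] (V ⊗[k] V) :=
  (TensorProduct.assoc k V V V).toLinearMap ∘ₗ (TensorProduct.comm k V (V ⊗[k] V)).toLinearMap

@[simp] theorem cyc_tmul {k V : Type*} [CommRing k] [AddCommGroup V] [Module k V] (a b c : V) :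
    cyc k V (a ⊗ₜ (b ⊗ₜ c)) = b ⊗ₜ (c ⊗ₜ a) := rfl

/-- The sum of the three cyclic permutations of a tensor in `V ⊗ V ⊗ V`. -/
def cycAlt (k V : Type*) [CommRing k] [AddCommGroup V] [Module k V] :
    V ⊗[k] (V ⊗[k] V) →ₗ[k] V ⊗[k] (V ⊗[k] V) :=
  LinearMap.id + cyc k V + cyc k V ∘ₗ cyc k V

@[simp] theorem cycAlt_tmul {k V : Type*} [CommRing k] [AddCommGroup V] [Module k V] (a b c : V) :
    cycAlt k V (a ⊗ₜ (b ⊗ₜ c)) = a ⊗ₜ (b ⊗ₜ c) + b ⊗ₜ (c ⊗ₜ a) + c ⊗ₜ (a ⊗ₜ b) := rfl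

/-- A Lie bialgebra structure on the Lie algebra `a`: an antisymmetric cobracket `δ`, written
`cobr`, with `(δ ⊗ id) (δ x) + cyclic permutations = 0` and
`δ [x, y] = [x ⊗ 1 + 1 ⊗ x, δ y] + [δ x, y ⊗ 1 + 1 ⊗ y]`
(the bracket `⁅x, t⁆` of `x : a` with `t : a ⊗ a` is `[x ⊗ 1 + 1 ⊗ x, t]`). -/
class LieBialgebra (k a : Type*) [Field k] [LieRing a] [LieAlgebra k a] where
  cobr : a →ₗ[k] a ⊗[k] a
  antisymm : ∀ x, TensorProduct.comm k a a (cobr x) = -cobr x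
  coJacobi : ∀ x, cycAlt k a (TensorProduct.assoc k a a a (cobr.rTensor a (cobr x))) = 0
  cocycle : ∀ x y, cobr ⁅x, y⁆ = ⁅x, cobr y⁆ - ⁅y, cobr x⁆

/-- The cobracket of a Lie bialgebra. -/
abbrev cobr (k a : Type*) [Field k] [LieRing a] [LieAlgebra k a] [LieBialgebra k a] :
    a →ₗ[k] a ⊗[k] a :=
  LieBialgebra.cobr

/-! ### The dual Lie bialgebra -/

section Dual

/-- The dual space `a^*` of a Lie bialgebra `a`, as a Lie (bi)algebra. -/
def DualLie (k a : Type*) [Field k] [LieRing a] [LieAlgebra k a] [LieBialgebra k a] : Type _ :=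
  Module.Dual k a

variable (k : Type*) [Field k] {a : Type*} [LieRing a] [LieAlgebra k a] [LieBialgebra k a]

instance : AddCommGroup (DualLie k a) := inferInstanceAs (AddCommGroup (Module.Dual k a))
instance : Module k (DualLie k a) := inferInstanceAs (Module k (Module.Dual k a))

/-- The identity map from `Module.Dual k a` to `DualLie k a`. -/
def DualLie.of : Module.Dual k a ≃ₗ[k] DualLie k a := LinearEquiv.refl k _

/-- The contraction `(ξ ⊗ id) t` of the first factor of a tensor. -/
def contr (ξ : Module.Dual k a) : a ⊗[k] a →ₗ[k] a :=
  (TensorProduct.lid k a).toLinearMap ∘ₗ ξ.rTensor a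

@[simp] theorem contr_tmul (ξ : Module.Dual k a) (x y : a) : contr k ξ (x ⊗ₜ y) = ξ x • y := by
  simp [contr]

/-- The bracket of `a^*`: `[ξ, η] (x) = (ξ ⊗ η) (δ x)`. -/
def dualBracket (ξ η : Module.Dual k a) : Module.Dual k a :=
  TensorProduct.dualDistrib k a a (ξ ⊗ₜ η) ∘ₗ cobr k a

theorem dualBracket_eq (ξ η : Module.Dual k a) (x : a) :
    dualBracket k ξ η x = η (contr k ξ (cobr k a x)) := by
  simp only [dualBracket, LinearMap.comp_apply]
  induction cobr k a x using TensorProduct.induction_on with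
  | zero => simp
  | tmul u v => simp
  | add s t hs ht => simp only [map_add, hs, ht]

theorem dualBracket_swap (ξ η : Module.Dual k a) (x : a) :
    dualBracket k ξ η x = -dualBracket k η ξ x := by
  have h : ∀ t, TensorProduct.dualDistrib k a a (ξ ⊗ₜ η) (TensorProduct.comm k a a t) =
      TensorProduct.dualDistrib k a a (η ⊗ₜ ξ) t := by
    intro t
    induction t using TensorProduct.induction_on with
    | zero => simp
    | tmul u v => simp [mul_comm]
    | add s t hs ht => simp only [map_add, hs, ht]
  have h2 := h (cobr k a x)
  rw [LieBialgebra.antisymm] at h2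
  simp only [map_neg] at h2
  simp only [dualBracket, LinearMap.comp_apply, ← h2, neg_neg]


/-- The evaluation of a tensor in `a ⊗ a ⊗ a` on three linear forms. -/
def eval3 (ξ η ζ : Module.Dual k a) : a ⊗[k] (a ⊗[k] a) →ₗ[k] k :=
  TensorProduct.dualDistrib k a (a ⊗[k] a) (ξ ⊗ₜ TensorProduct.dualDistrib k a a (η ⊗ₜ ζ))

theorem eval3_cyc (ξ η ζ : Module.Dual k a) (t : a ⊗[k] (a ⊗[k] a)) :
    eval3 k ξ η ζ (cyc k a t) = eval3 k ζ ξ η t := by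
  have : eval3 k ξ η ζ ∘ₗ cyc k a = eval3 k ζ ξ η := by
    ext u v w
    simp [eval3]
    ring
  exact congr($this t)

theorem dualBracket_dualBracket (ξ η ζ : Module.Dual k a) (x : a) :
    dualBracket k (dualBracket k ξ η) ζ x =
      eval3 k ξ η ζ (TensorProduct.assoc k a a a ((cobr k a).rTensor a (cobr k a x))) := by
  have h1 : ∀ t u, TensorProduct.dualDistrib k a a (ξ ⊗ₜ η) t * ζ u =
      eval3 k ξ η ζ (TensorProduct.assoc k a a a (t ⊗ₜ u)) := by
    intro t u
    induction t using TensorProduct.induction_on with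
    | zero => simp
    | tmul v w => simp [eval3, mul_assoc]
    | add s t hs ht => simp only [map_add, add_mul, TensorProduct.add_tmul, hs, ht]
  conv_lhs => rw [dualBracket]
  simp only [LinearMap.comp_apply]
  induction cobr k a x using TensorProduct.induction_on with
  | zero => simp
  | tmul u v => simp [← h1, dualBracket]
  | add s t hs ht => simp only [map_add, hs, ht]

theorem dualBracket_jacobi (ξ η ζ : Module.Dual k a) (x : a) :
    dualBracket k (dualBracket k ξ η) ζ x + dualBracket k (dualBracket k η ζ) ξ x +
      dualBracket k (dualBracket k ζ ξ) η x = 0 := by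
  have h := congrArg (eval3 k ξ η ζ) (LieBialgebra.coJacobi (k := k) x)
  simp only [cycAlt, LinearMap.add_apply, LinearMap.comp_apply, map_add, eval3_cyc,
    LinearMap.id_apply, map_zero] at h
  rw [dualBracket_dualBracket, dualBracket_dualBracket, dualBracket_dualBracket]
  linear_combination h

instance : Bracket (DualLie k a) (DualLie k a) :=
  ⟨fun ξ η => DualLie.of k (dualBracket k ((DualLie.of k).symm ξ) ((DualLie.of k).symm η))⟩

theorem DualLie.lie_def (ξ η : DualLie k a) :
    ⁅ξ, η⁆ = DualLie.of k (dualBracket k ((DualLie.of k).symm ξ) ((DualLie.of k).symm η)) := rfl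

theorem dualBracket_self [CharZero k] (ξ : Module.Dual k a) : dualBracket k ξ ξ = 0 := by
  ext x
  have := dualBracket_swap k ξ ξ x
  simpa [self_eq_neg] using this

instance [CharZero k] : LieRing (DualLie k a) where
  add_lie ξ η ζ := by simp [DualLie.lie_def, dualBracket, TensorProduct.add_tmul, LinearMap.add_comp]
  lie_add ξ η ζ := by simp [DualLie.lie_def, dualBracket, TensorProduct.tmul_add, LinearMap.add_comp]
  lie_self ξ := by simp [DualLie.lie_def, dualBracket_self]
  leibniz_lie ξ η ζ := by
    apply (DualLie.of k).symm.injective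
    ext x
    simp only [DualLie.lie_def, LinearEquiv.symm_apply_apply, map_add, LinearMap.add_apply]
    set ξ' := (DualLie.of k).symm ξ
    set η' := (DualLie.of k).symm η
    set ζ' := (DualLie.of k).symm ζ
    have h := dualBracket_jacobi k ξ' η' ζ' x
    have e : dualBracket k ζ' ξ' = - dualBracket k ξ' ζ' := by
      ext y; simpa using dualBracket_swap k ζ' ξ' y
    have e' : dualBracket k (dualBracket k ζ' ξ') η' x = dualBracket k η' (dualBracket k ξ' ζ') x := by
      rw [dualBracket_swap, e]
      simp [dualBracket_eq]
    rw [dualBracket_swap k ξ' (dualBracket k η' ζ'), ← e']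
    linear_combination -h

instance [CharZero k] : LieAlgebra k (DualLie k a) where
  lie_smul c ξ η := by
    simp [DualLie.lie_def, dualBracket, LinearMap.smul_comp]


variable [FiniteDimensional k a]

instance : FiniteDimensional k (DualLie k a) :=
  inferInstanceAs (FiniteDimensional k (Module.Dual k a))

/-- The pairing of `a^* ⊗ a^*` with `a ⊗ a`. -/
def pair2 : DualLie k a ⊗[k] DualLie k a ≃ₗ[k] Module.Dual k (a ⊗[k] a) :=
  (TensorProduct.congr (DualLie.of k).symm (DualLie.of k).symm).trans
    (TensorProduct.dualDistribEquiv k a a)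

@[simp] theorem pair2_tmul (ξ η : DualLie k a) (x y : a) :
    pair2 k (ξ ⊗ₜ η) (x ⊗ₜ y) = (DualLie.of k).symm ξ x * (DualLie.of k).symm η y := by
  simp [pair2, TensorProduct.dualDistribEquiv, TensorProduct.dualDistribEquivOfBasis]

/-- The cobracket of `a^*`, dual to the bracket of `a`: `(δ ξ) (x ⊗ y) = ξ ([x, y])`. -/
def dualCobr : DualLie k a →ₗ[k] DualLie k a ⊗[k] DualLie k a :=
  (pair2 k).symm.toLinearMap ∘ₗ
    LinearMap.lcomp k k (LieModule.toModuleHom k a a : a ⊗[k] a →ₗ[k] a) ∘ₗ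
      (DualLie.of k).symm.toLinearMap

theorem pair2_dualCobr (ξ : DualLie k a) (x y : a) :
    pair2 k (dualCobr k ξ) (x ⊗ₜ y) = (DualLie.of k).symm ξ ⁅x, y⁆ := by
  simp [dualCobr]

/-- The pairing of `a^* ⊗ a^* ⊗ a^*` with `a ⊗ a ⊗ a`. -/
def pair3 : DualLie k a ⊗[k] (DualLie k a ⊗[k] DualLie k a) ≃ₗ[k]
    Module.Dual k (a ⊗[k] (a ⊗[k] a)) :=
  (TensorProduct.congr (DualLie.of k).symm (pair2 k)).trans
    (TensorProduct.dualDistribEquiv k a (a ⊗[k] a))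

theorem pair3_tmul (ξ : DualLie k a) (s : DualLie k a ⊗[k] DualLie k a) (x : a)
    (t : a ⊗[k] a) :
    pair3 k (ξ ⊗ₜ s) (x ⊗ₜ t) = (DualLie.of k).symm ξ x * pair2 k s t := by
  simp [pair3, TensorProduct.dualDistribEquiv, TensorProduct.dualDistribEquivOfBasis]

theorem pair3_cyc (t : DualLie k a ⊗[k] (DualLie k a ⊗[k] DualLie k a)) (x y z : a) :
    pair3 k (cyc k _ t) (x ⊗ₜ (y ⊗ₜ z)) = pair3 k t (z ⊗ₜ (x ⊗ₜ y)) := by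
  induction t using TensorProduct.induction_on with
  | zero => simp
  | add s t hs ht => simp only [map_add, LinearMap.add_apply, hs, ht]
  | tmul ξ t =>
    induction t using TensorProduct.induction_on with
    | zero => simp
    | add s t hs ht => simp only [map_add, LinearMap.add_apply, hs, ht, TensorProduct.tmul_add]
    | tmul η ζ =>
      simp [pair3_tmul]
      ring

theorem pair3_assoc (s : DualLie k a ⊗[k] DualLie k a) (ζ : DualLie k a) (x y z : a) :
    pair3 k (TensorProduct.assoc k _ _ _ (s ⊗ₜ ζ)) (x ⊗ₜ (y ⊗ₜ z)) =
      pair2 k s (x ⊗ₜ y) * (DualLie.of k).symm ζ z := by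
  induction s using TensorProduct.induction_on with
  | zero => simp
  | add s t hs ht =>
    simp only [TensorProduct.add_tmul, map_add, LinearMap.add_apply, hs, ht, add_mul]
  | tmul ξ η => simp [pair3_tmul, mul_assoc]

theorem pair2_comm (s : DualLie k a ⊗[k] DualLie k a) (x y : a) :
    pair2 k (TensorProduct.comm k _ _ s) (x ⊗ₜ y) = pair2 k s (y ⊗ₜ x) := by
  induction s using TensorProduct.induction_on with
  | zero => simp
  | add s t hs ht => simp only [map_add, LinearMap.add_apply, hs, ht]
  | tmul ξ η => simp [mul_comm]

theorem pair3_dualCobr (ξ : DualLie k a) (x y z : a) :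
    pair3 k (TensorProduct.assoc k _ _ _ ((dualCobr k).rTensor _ (dualCobr k ξ)))
      (x ⊗ₜ (y ⊗ₜ z)) = (DualLie.of k).symm ξ ⁅⁅x, y⁆, z⁆ := by
  rw [← pair2_dualCobr]
  induction dualCobr k ξ using TensorProduct.induction_on with
  | zero => simp
  | add s t hs ht => simp only [map_add, LinearMap.add_apply, hs, ht]
  | tmul η ζ => simp [pair3_assoc, pair2_dualCobr]

theorem pair2_lie [CharZero k] (ξ : DualLie k a) (s : DualLie k a ⊗[k] DualLie k a) (x y : a) :
    pair2 k ⁅ξ, s⁆ (x ⊗ₜ y) =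
      pair2 k s (contr k ((DualLie.of k).symm ξ) (cobr k a x) ⊗ₜ y) +
      pair2 k s (x ⊗ₜ contr k ((DualLie.of k).symm ξ) (cobr k a y)) := by
  induction s using TensorProduct.induction_on with
  | zero => simp
  | add s t hs ht => simp only [lie_add, map_add, LinearMap.add_apply, hs, ht]; ring
  | tmul η ζ => simp [DualLie.lie_def, dualBracket_eq]

theorem contr_cobr_lie (ξ : Module.Dual k a) (x y : a) (η : Module.Dual k a) :
    dualBracket k ξ η ⁅x, y⁆ =
      η ⁅x, contr k ξ (cobr k a y)⁆ - η ⁅y, contr k ξ (cobr k a x)⁆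
      - ξ ⁅x, contr k η (cobr k a y)⁆ + ξ ⁅y, contr k η (cobr k a x)⁆ := by
  have key : ∀ (x : a) (t : a ⊗[k] a),
      TensorProduct.dualDistrib k a a (ξ ⊗ₜ η) ⁅x, t⁆ =
        η ⁅x, contr k ξ t⁆ + ξ ⁅x, contr k η (TensorProduct.comm k a a t)⁆ := by
    intro x t
    induction t using TensorProduct.induction_on with
    | zero => simp
    | add s t hs ht => simp only [map_add, lie_add, hs, ht]; ring
    | tmul u v => simp; ring
  simp only [dualBracket, LinearMap.comp_apply]
  rw [LieBialgebra.cocycle, map_sub, key, key, LieBialgebra.antisymm, LieBialgebra.antisymm]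
  simp only [map_neg, lie_neg, cobr]
  ring

instance [CharZero k] : LieBialgebra k (DualLie k a) where
  cobr := dualCobr k
  antisymm ξ := by
    apply (pair2 k).injective
    ext x y
    change pair2 k (TensorProduct.comm k _ _ (dualCobr k ξ)) (x ⊗ₜ y) =
      pair2 k (-dualCobr k ξ) (x ⊗ₜ y)
    rw [pair2_comm, map_neg, LinearMap.neg_apply, pair2_dualCobr, pair2_dualCobr, ← map_neg,
      lie_skew]
  coJacobi ξ := by
    apply (pair3 k).injective
    ext x y z
    change pair3 k (cycAlt k _ (TensorProduct.assoc k _ _ _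
      ((dualCobr k).rTensor _ (dualCobr k ξ)))) (x ⊗ₜ (y ⊗ₜ z)) = pair3 k 0 (x ⊗ₜ (y ⊗ₜ z))
    rw [cycAlt, LinearMap.add_apply, LinearMap.add_apply, LinearMap.comp_apply, map_add, map_add,
      LinearMap.add_apply, LinearMap.add_apply, pair3_cyc, pair3_cyc, pair3_cyc, LinearMap.id_apply,
      pair3_dualCobr, pair3_dualCobr, pair3_dualCobr, map_zero, LinearMap.zero_apply]
    have h : ⁅⁅x, y⁆, z⁆ + ⁅⁅z, x⁆, y⁆ + ⁅⁅y, z⁆, x⁆ = 0 := by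
      have h1 := lie_jacobi x y z
      have h2 : ⁅⁅x, y⁆, z⁆ = -⁅z, ⁅x, y⁆⁆ := (lie_skew _ _).symm
      have h3 : ⁅⁅z, x⁆, y⁆ = -⁅y, ⁅z, x⁆⁆ := (lie_skew _ _).symm
      have h4 : ⁅⁅y, z⁆, x⁆ = -⁅x, ⁅y, z⁆⁆ := (lie_skew _ _).symm
      rw [h2, h3, h4, ← neg_eq_zero, ← h1]
      abel
    have h' := congrArg ((DualLie.of k).symm ξ) h
    simpa only [map_add, map_zero] using h'
  cocycle ξ η := by
    apply (pair2 k).injective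
    ext x y
    simp only [TensorProduct.AlgebraTensorModule.curry_apply, TensorProduct.curry_apply,
      LinearMap.restrictScalars_apply, map_sub, LinearMap.sub_apply, pair2_lie, pair2_dualCobr]
    have h : ∀ (ζ : Module.Dual k a) u, ζ ⁅u, y⁆ = -ζ ⁅y, u⁆ := by
      intro ζ u
      rw [← map_neg, lie_skew]
    rw [DualLie.lie_def, LinearEquiv.symm_apply_apply, contr_cobr_lie, h, h]
    ring

end Dual

/-! ### The enveloping algebra and its coproduct -/

section Enveloping

attribute [local instance 100] LieRing.ofAssociativeRing

variable (k : Type*) [Field k] (a : Type*) [LieRing a] [LieAlgebra k a]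

/-- The enveloping algebra `U(a)`. -/
abbrev U : Type _ := UniversalEnvelopingAlgebra k a

variable {a}

/-- The canonical map `a → U(a)`. -/
def inU : a →ₗ[k] U k a := (UniversalEnvelopingAlgebra.ι k : a →ₗ⁅k⁆ U k a)

theorem inU_lie (x y : a) : inU k ⁅x, y⁆ = inU k x * inU k y - inU k y * inU k x := by
  simp only [inU, LieHom.coe_toLinearMap, LieHom.map_lie, LieRing.of_associative_ring_bracket]

/-- The universal property of `U(a)`. -/
def liftU {A : Type*} [Ring A] [Algebra k A] (f : a →ₗ[k] A)
    (hf : ∀ x y, f ⁅x, y⁆ = f x * f y - f y * f x) : U k a →ₐ[k] A :=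
  UniversalEnvelopingAlgebra.lift k { toLinearMap := f, map_lie' := fun {x y} => hf x y }

@[simp] theorem liftU_inU {A : Type*} [Ring A] [Algebra k A] (f : a →ₗ[k] A)
    (hf : ∀ x y, f ⁅x, y⁆ = f x * f y - f y * f x) (x : a) : liftU k f hf (inU k x) = f x :=
  UniversalEnvelopingAlgebra.lift_ι_apply k _ x

theorem homU_ext {A : Type*} [Ring A] [Algebra k A] {F G : U k a →ₐ[k] A}
    (h : ∀ x, F (inU k x) = G (inU k x)) : F = G := by
  apply UniversalEnvelopingAlgebra.hom_ext
  ext x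
  exact h x

variable (a)

/-- The coproduct of `U(a)`, with `x ↦ x ⊗ 1 + 1 ⊗ x` for `x : a`. -/
def comulHom : U k a →ₐ[k] U k a ⊗[k] U k a :=
  liftU k ((TensorProduct.mk k _ _).flip 1 ∘ₗ inU k + TensorProduct.mk k _ _ 1 ∘ₗ inU k) (by
    intro x y
    simp only [LinearMap.add_apply, LinearMap.comp_apply, LinearMap.flip_apply,
      TensorProduct.mk_apply, inU_lie, mul_add, add_mul, Algebra.TensorProduct.tmul_mul_tmul,
      mul_one, one_mul, TensorProduct.sub_tmul, TensorProduct.tmul_sub]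
    abel)

/-- The counit of `U(a)`, with `x ↦ 0` for `x : a`. -/
def counitHom : U k a →ₐ[k] k := liftU k 0 (by simp)

variable {a} in
@[simp] theorem comulHom_inU (x : a) :
    comulHom k a (inU k x) = inU k x ⊗ₜ 1 + 1 ⊗ₜ inU k x := by
  rw [comulHom, liftU_inU]
  rfl

variable {a} in
@[simp] theorem counitHom_inU (x : a) : counitHom k a (inU k x) = 0 := by
  rw [counitHom, liftU_inU]
  rfl

instance : Bialgebra k (U k a) :=
  .ofAlgHom (comulHom k a) (counitHom k a)
    (by
      apply homU_ext
      intro x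
      simp [Algebra.TensorProduct.one_def, TensorProduct.add_tmul, TensorProduct.tmul_add]
      abel)
    (by
      apply homU_ext
      intro x
      simp)
    (by
      apply homU_ext
      intro x
      simp)

variable {a} in
theorem comul_inU (x : a) :
    Coalgebra.comul (R := k) (inU k x) = inU k x ⊗ₜ[k] 1 + 1 ⊗ₜ[k] inU k x :=
  comulHom_inU k x

variable {a} in
theorem counit_inU (x : a) : Coalgebra.counit (R := k) (inU k x) = 0 := counitHom_inU k x

instance : Coalgebra.IsCocomm k (U k a) where
  comm_comp_comul := by
    have h : (Algebra.TensorProduct.comm k (U k a) (U k a)).toAlgHom.comp (comulHom k a) =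
        comulHom k a := by
      apply homU_ext
      intro x
      simp
      abel
    exact congr(($h).toLinearMap)

/-- The antipode of `U(a)`: the antiautomorphism with `x ↦ -x` for `x : a`. -/
def antipode : U k a →ₗ[k] U k a :=
  (MulOpposite.opLinearEquiv k).symm.toLinearMap ∘ₗ
    (liftU k (A := (U k a)ᵐᵒᵖ) (-((MulOpposite.opLinearEquiv k).toLinearMap ∘ₗ inU k)) (by
      intro x y
      simp [inU_lie, ← MulOpposite.op_mul])).toLinearMap

variable {a} in
theorem antipode_inU (x : a) : antipode k a (inU k x) = -inU k x := by
  simp [antipode]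

theorem antipode_one : antipode k a 1 = 1 := by
  simp [antipode]

theorem antipode_mul (x y : U k a) : antipode k a (x * y) = antipode k a y * antipode k a x := by
  simp [antipode]

variable [LieBialgebra k a]

/-- The cobracket of `a` with values in `U(a) ⊗ U(a)`. -/
def cobrU : a →ₗ[k] U k a ⊗[k] U k a :=
  TensorProduct.map (inU k) (inU k) ∘ₗ cobr k a

variable {a} in
theorem cobrU_lie (x y : a) :
    cobrU k a ⁅x, y⁆ =
      (comulHom k a (inU k x) * cobrU k a y - cobrU k a y * comulHom k a (inU k x)) -
      (comulHom k a (inU k y) * cobrU k a x - cobrU k a x * comulHom k a (inU k y)) := by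
  have key : ∀ (x : a) (t : a ⊗[k] a), TensorProduct.map (inU k) (inU k) ⁅x, t⁆ =
      comulHom k a (inU k x) * TensorProduct.map (inU k) (inU k) t -
        TensorProduct.map (inU k) (inU k) t * comulHom k a (inU k x) := by
    intro x t
    induction t using TensorProduct.induction_on with
    | zero => simp
    | add s t hs ht => simp only [lie_add, map_add, hs, ht, mul_add, add_mul]; abel
    | tmul u v =>
      simp only [TensorProduct.LieModule.lie_tmul_right, map_add, TensorProduct.map_tmul, inU_lie,
        comulHom_inU, mul_add, add_mul, Algebra.TensorProduct.tmul_mul_tmul, one_mul, mul_one,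
        TensorProduct.sub_tmul, TensorProduct.tmul_sub]
      abel
  simp only [cobrU, LinearMap.comp_apply, cobr]
  rw [LieBialgebra.cocycle, map_sub, key, key]

/-- The algebra morphism `x ↦ Δ x + ε (δ x)` from `U(a)` to the dual numbers over
`U(a) ⊗ U(a)` that extends the cobracket of `a`. -/
def comulDeform : U k a →ₐ[k] TrivSqZeroExt (U k a ⊗[k] U k a) (U k a ⊗[k] U k a) :=
  liftU k
    ((TrivSqZeroExt.inlAlgHom k (U k a ⊗[k] U k a) (U k a ⊗[k] U k a)).toLinearMap ∘ₗ
        (comulHom k a).toLinearMap ∘ₗ inU k +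
      (TrivSqZeroExt.inrHom (U k a ⊗[k] U k a) (U k a ⊗[k] U k a)).restrictScalars k ∘ₗ
        cobrU k a) (by
    intro x y
    apply TrivSqZeroExt.ext
    · simp [inU_lie]
    · simp [cobrU_lie]
      abel)

/-- The extension `δ : U(a) → U(a) ⊗ U(a)` of the cobracket, characterized by
`δ (x y) = Δ x · δ y + δ x · Δ y`. -/
def deltaU : U k a →ₗ[k] U k a ⊗[k] U k a :=
  (TrivSqZeroExt.sndHom (U k a ⊗[k] U k a) (U k a ⊗[k] U k a)).restrictScalars k ∘ₗ
    (comulDeform k a).toLinearMap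

variable {a} in
theorem deltaU_inU (x : a) : deltaU k a (inU k x) = cobrU k a x := by
  simp [deltaU, comulDeform]

theorem comulDeform_fst (x : U k a) : (comulDeform k a x).fst = Coalgebra.comul (R := k) x := by
  have h : (TrivSqZeroExt.fstHom k (U k a ⊗[k] U k a) (U k a ⊗[k] U k a)).comp
      (comulDeform k a) = comulHom k a := by
    apply homU_ext
    intro x
    simp [comulDeform]
  exact congr($h x)

theorem deltaU_mul (x y : U k a) :
    deltaU k a (x * y) = Coalgebra.comul (R := k) x * deltaU k a y +
      deltaU k a x * Coalgebra.comul (R := k) y := by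
  simp [deltaU, ← comulDeform_fst]

end Enveloping

/-! ### The algebra dual to a cocommutative coalgebra -/

section DualAlg

variable (k : Type*) [Field k] (C : Type*) [AddCommGroup C] [Module k C] [Coalgebra k C]
  [Coalgebra.IsCocomm k C]

/-- The commutative algebra `C^*` dual to a cocommutative coalgebra `C`, with the convolution
product `(f f') (x) = ∑ f(x₁) f'(x₂)` for `Δ x = ∑ x₁ ⊗ x₂`. -/
def DualAlg : Type _ := WithConv (C →ₗ[k] k)

instance : CommRing (DualAlg k C) := inferInstanceAs (CommRing (WithConv (C →ₗ[k] k)))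

instance : Algebra k (DualAlg k C) := inferInstanceAs (Algebra k (WithConv (C →ₗ[k] k)))

/-- The identification of the linear forms on `C` with the elements of `C^*`. -/
def toDualAlg : (C →ₗ[k] k) ≃ₗ[k] DualAlg k C where
  toFun := WithConv.toConv
  invFun := WithConv.ofConv
  left_inv _ := rfl
  right_inv _ := rfl
  map_add' _ _ := rfl
  map_smul' _ _ := rfl

variable {k C}

instance : CoeFun (DualAlg k C) (fun _ => C → k) := ⟨fun f => (toDualAlg k C).symm f⟩

theorem DualAlg.coe_def (f : DualAlg k C) (x : C) : f x = (toDualAlg k C).symm f x := rfl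

@[ext] theorem DualAlg.ext {f f' : DualAlg k C} (h : ∀ x, f x = f' x) : f = f' :=
  (toDualAlg k C).symm.injective (LinearMap.ext h)

@[simp] theorem toDualAlg_apply (f : C →ₗ[k] k) (x : C) : (toDualAlg k C f) x = f x := rfl

@[simp] theorem DualAlg.add_apply (f f' : DualAlg k C) (x : C) : (f + f') x = f x + f' x := rfl

@[simp] theorem DualAlg.neg_apply (f : DualAlg k C) (x : C) : (-f) x = -f x := rfl

@[simp] theorem DualAlg.smul_apply (c : k) (f : DualAlg k C) (x : C) :
    (c • f) x = c * f x := rfl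

theorem DualAlg.mul_apply (f f' : DualAlg k C) (x : C) :
    (f * f') x = LinearMap.mul' k k (TensorProduct.map ((toDualAlg k C).symm f)
      ((toDualAlg k C).symm f') (Coalgebra.comul (R := k) x)) := rfl

theorem DualAlg.one_apply (x : C) : (1 : DualAlg k C) x = Coalgebra.counit (R := k) x := rfl

theorem DualAlg.sum_apply {n : Type*} (s : Finset n) (f : n → DualAlg k C) (x : C) :
    (∑ i ∈ s, f i) x = ∑ i ∈ s, f i x := by
  simp [DualAlg.coe_def]

variable {D : Type*} [AddCommGroup D] [Module k D] [Coalgebra k D] [Coalgebra.IsCocomm k D]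

/-- The transpose `f ↦ f ∘ T` of a linear map. -/
def transpose (T : C →ₗ[k] D) : DualAlg k D →ₗ[k] DualAlg k C :=
  (toDualAlg k C).toLinearMap ∘ₗ LinearMap.lcomp k k T ∘ₗ (toDualAlg k D).symm.toLinearMap

@[simp] theorem transpose_apply (T : C →ₗ[k] D) (f : DualAlg k D) (x : C) :
    transpose T f x = f (T x) := rfl

variable (k C D) in
/-- `transpose` as a linear map. -/
def transposeHom : (C →ₗ[k] D) →ₗ[k] DualAlg k D →ₗ[k] DualAlg k C where
  toFun := transpose
  map_add' S T := by ext f x; simp [DualAlg.coe_def, transpose]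
  map_smul' c T := by ext f x; simp [DualAlg.coe_def, transpose]

@[simp] theorem transposeHom_apply (T : C →ₗ[k] D) (f : DualAlg k D) (x : C) :
    transposeHom k C D T f x = f (T x) := rfl

/-- The transpose of a coalgebra morphism, as an algebra morphism. -/
def pullback (T : C →ₗc[k] D) : DualAlg k D →ₐ[k] DualAlg k C :=
  AlgHom.ofLinearMap (transpose T.toLinearMap)
    (by ext x; simp [DualAlg.one_apply])
    (fun f f' => WithConv.ext (LinearMap.convMul_comp_coalgHom_distrib (R := k) (A := k)
      (WithConv.toConv ((toDualAlg k D).symm f)) (WithConv.toConv ((toDualAlg k D).symm f')) T))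

@[simp] theorem pullback_apply (T : C →ₗc[k] D) (f : DualAlg k D) (x : C) :
    pullback T f x = f (T x) := rfl

end DualAlg

/-! ### Functions on the formal group, translations, Poisson bracket, dressing actions -/

section Functions

variable (k : Type*) [Field k] (a : Type*) [LieRing a] [LieAlgebra k a]

/-- The function algebra `k[[A]] = U(a)^*` of the formal group `A` of `a`, with the product dual
to the coproduct of `U(a)`. -/
abbrev Fun : Type _ := DualAlg k (U k a)

/-- `x ↦ -a x` on `U(a)`. -/
def leftT : a →ₗ[k] U k a →ₗ[k] U k a := -(LinearMap.mul k (U k a) ∘ₗ inU k)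

/-- `x ↦ x a` on `U(a)`. -/
def rightT : a →ₗ[k] U k a →ₗ[k] U k a := (LinearMap.mul k (U k a)).flip ∘ₗ inU k

/-- Infinitesimal left translations: `(L_a f) (x) = d/dε f (exp (-ε a) x)`. -/
def leftTr : a →ₗ[k] Module.End k (Fun k a) := transposeHom k _ _ ∘ₗ leftT k a

/-- Infinitesimal right translations: `(R_a f) (x) = d/dε f (x exp (ε a))`. -/
def rightTr : a →ₗ[k] Module.End k (Fun k a) := transposeHom k _ _ ∘ₗ rightT k a

variable {a} in
theorem leftTr_apply (u : a) (f : Fun k a) (x : U k a) :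
    leftTr k a u f x = -f (inU k u * x) := by
  simp [leftTr, leftT, DualAlg.coe_def, transposeHom, transpose]

variable {a} in
theorem rightTr_apply (u : a) (f : Fun k a) (x : U k a) :
    rightTr k a u f x = f (x * inU k u) := by
  simp [rightTr, rightT, DualAlg.coe_def, transposeHom, transpose]

variable [LieBialgebra k a]

/-- The Poisson bracket `{f, g} = (f ⊗ g) ∘ δ` of the formal Poisson-Lie group with Lie
bialgebra `a`. -/
def plBracket : Fun k a →ₗ[k] Fun k a →ₗ[k] Fun k a :=
  LinearMap.mk₂ k
    (fun f g => toDualAlg k (U k a)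
      (LinearMap.mul' k k ∘ₗ TensorProduct.map ((toDualAlg k _).symm f) ((toDualAlg k _).symm g) ∘ₗ deltaU k a))
    (fun f f' g => by ext x; simp [TensorProduct.map_add_left, LinearMap.comp_add, LinearMap.add_comp])
    (fun c f g => by ext x; simp [TensorProduct.map_smul_left, LinearMap.comp_smul, LinearMap.smul_comp])
    (fun f g g' => by ext x; simp [TensorProduct.map_add_right, LinearMap.comp_add, LinearMap.add_comp])
    (fun c f g => by ext x; simp [TensorProduct.map_smul_right, LinearMap.comp_smul, LinearMap.smul_comp])

/-- The adjoint action of `a` on its double `d(a) = a ⊕ a^*`: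
`[x, (y, ξ)] = ([x, y] + (ξ ⊗ id) (δ x), -ξ ∘ ad x)`. It is determined by `[x, y]` being the
bracket of `a` for `x, y : a`, and by the invariance of the canonical pairing on `a ⊕ a^*`, for
which `a` and `a^*` are isotropic subalgebras. -/
def adDouble : a →ₗ[k] Module.End k (a × Module.Dual k a) :=
  LinearMap.mk₂ k
    (fun x p => (⁅x, p.1⁆ + contr k p.2 (cobr k a x), -(p.2 ∘ₗ (LieModule.toEnd k a a x))))
    (fun x y p => by
      ext z
      · simp; abel
      · simp; ring)
    (fun c x p => by
      ext z <;> simp)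
    (fun x p q => by
      ext z
      · simp [contr, LinearMap.rTensor_add]; abel
      · simp; ring)
    (fun c x p => by
      ext z <;> simp [contr, LinearMap.rTensor_smul])

theorem adDouble_lie (x y : a) :
    adDouble k a ⁅x, y⁆ = adDouble k a x * adDouble k a y - adDouble k a y * adDouble k a x := by
  have key : ∀ (ξ : Module.Dual k a) (x : a) (t : a ⊗[k] a), contr k ξ ⁅x, t⁆ =
      ⁅x, contr k ξ t⁆ + contr k (ξ ∘ₗ (LieModule.toEnd k a a x)) t := by
    intro ξ x t
    induction t using TensorProduct.induction_on with
    | zero => simp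
    | add s t hs ht => simp only [lie_add, map_add, hs, ht]; abel
    | tmul u v => simp; abel
  have hneg : ∀ (ξ : Module.Dual k a) t, contr k (-ξ) t = -contr k ξ t := by
    intro ξ t
    simp [contr, LinearMap.rTensor_neg]
  apply LinearMap.ext
  rintro ⟨z, ξ⟩
  apply Prod.ext
  · simp only [adDouble, LinearMap.mk₂_apply, LinearMap.sub_apply, Module.End.mul_apply,
      Prod.fst_sub, hneg, lie_add, cobr]
    rw [LieBialgebra.cocycle, map_sub, key, key, lie_lie]
    abel
  · ext w
    simp [adDouble]

/-- The action of `U(a)` on `d(a)` that extends the adjoint action of `a`. -/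
def actDouble : U k a →ₐ[k] Module.End k (a × Module.Dual k a) :=
  liftU k (A := Module.End k (a × Module.Dual k a)) (adDouble k a) (adDouble_lie k a)

/-- The matrix coefficient `x ↦ ⟨φ, Ad (x) v⟩` of the adjoint action of the group on `d(a)`. -/
def adCoeff (v : a × Module.Dual k a) (φ : Module.Dual k (a × Module.Dual k a)) : Fun k a :=
  toDualAlg k (U k a) (φ ∘ₗ LinearMap.applyₗ v ∘ₗ (actDouble k a).toLinearMap)

/-- The map `x ↦ - ∑ x₁ · (S(x₂) v)_a` from `U(a)` to `U(a)`, where `v : d(a)`, where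
`Δ x = ∑ x₁ ⊗ x₂`, and where `w ↦ w_a` is the projection of `d(a)` on `a` along `a^*`. -/
def dressT (v : a × Module.Dual k a) : U k a →ₗ[k] U k a :=
  -(LinearMap.mul' k (U k a) ∘ₗ
    TensorProduct.map LinearMap.id
      (inU k ∘ₗ LinearMap.fst k a (Module.Dual k a) ∘ₗ LinearMap.applyₗ v ∘ₗ
        (actDouble k a).toLinearMap ∘ₗ antipode k a) ∘ₗ
    Coalgebra.comul)

/-- `dressT` as a linear map. -/
def dressTHom : (a × Module.Dual k a) →ₗ[k] U k a →ₗ[k] U k a where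
  toFun := dressT k a
  map_add' v w := by
    ext x
    simp [dressT, LinearMap.comp_add, TensorProduct.map_add_right, LinearMap.add_comp]
    abel
  map_smul' c v := by
    ext x
    simp [dressT, LinearMap.comp_smul, TensorProduct.map_smul_right, LinearMap.smul_comp]

/-- The left dressing action of `d(a)`:
`(dress_v f) (x) = - (R_{(Ad(x⁻¹) v)_a} f) (x)`. -/
def dress : (a × Module.Dual k a) →ₗ[k] Module.End k (Fun k a) :=
  transposeHom k _ _ ∘ₗ dressTHom k a

end Functions

/-! ### Function rings of Poisson-Lie groups -/

section FunctionRings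

variable (k : Type*) [Field k] (a : Type*) [LieRing a] [LieAlgebra k a] [LieBialgebra k a]

/-- A ring of functions on the formal Poisson-Lie group of `a` that is stable under inversion,
infinitesimal translations, and the Poisson bracket. -/
structure FunctionRing where
  carrier : Subalgebra k (Fun k a)
  antipode_mem : ∀ f ∈ carrier, transpose (antipode k a) f ∈ carrier
  left_mem : ∀ u, ∀ f ∈ carrier, leftTr k a u f ∈ carrier
  right_mem : ∀ u, ∀ f ∈ carrier, rightTr k a u f ∈ carrier
  bracket_mem : ∀ f ∈ carrier, ∀ g ∈ carrier, plBracket k a f g ∈ carrier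

/-- The function ring `U(a)^*` of the formal Poisson-Lie group of `a`. -/
def FunctionRing.formal : FunctionRing k a where
  carrier := ⊤
  antipode_mem _ _ := trivial
  left_mem _ _ _ := trivial
  right_mem _ _ _ := trivial
  bracket_mem _ _ _ _ := trivial

/-- The evaluation of functions at `x : U(a)`. -/
def evalAt (x : U k a) : Fun k a →ₗ[k] k :=
  LinearMap.applyₗ x ∘ₗ (toDualAlg k (U k a)).symm.toLinearMap

@[simp] theorem evalAt_apply (x : U k a) (f : Fun k a) : evalAt k a x f = f x := rfl

/-- The function ring of an algebraic Poisson-Lie group with Lie bialgebra `a`: a Hopf subalgebra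
of `U(a)^*` (the coproduct of `f` is `(x, y) ↦ f (x y)`) that is stable under the Poisson
bracket. -/
structure HopfFunctionRing where
  carrier : Subalgebra k (Fun k a)
  comul_mem : ∀ f ∈ carrier, ∃ t : carrier ⊗[k] carrier, ∀ x y : U k a, f (x * y) =
    LinearMap.mul' k k (TensorProduct.map (evalAt k a x ∘ₗ carrier.val.toLinearMap)
      (evalAt k a y ∘ₗ carrier.val.toLinearMap) t)
  antipode_mem : ∀ f ∈ carrier, transpose (antipode k a) f ∈ carrier
  bracket_mem : ∀ f ∈ carrier, ∀ g ∈ carrier, plBracket k a f g ∈ carrier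

variable {k a}

theorem HopfFunctionRing.exists_left (O : HopfFunctionRing k a) {f : Fun k a}
    (hf : f ∈ O.carrier) (x : U k a) : ∃ g ∈ O.carrier, ∀ y, g y = f (x * y) := by
  obtain ⟨t, ht⟩ := O.comul_mem f hf
  refine ⟨(TensorProduct.lid k _ (TensorProduct.map
    (evalAt k a x ∘ₗ O.carrier.val.toLinearMap) LinearMap.id t) : O.carrier), Subtype.prop _, ?_⟩
  intro y
  rw [ht]
  have h : (evalAt k a y ∘ₗ O.carrier.val.toLinearMap) ∘ₗ (TensorProduct.lid k _).toLinearMap ∘ₗ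
      TensorProduct.map (evalAt k a x ∘ₗ O.carrier.val.toLinearMap) LinearMap.id =
      LinearMap.mul' k k ∘ₗ TensorProduct.map (evalAt k a x ∘ₗ O.carrier.val.toLinearMap)
        (evalAt k a y ∘ₗ O.carrier.val.toLinearMap) :=
    TensorProduct.ext' fun u v => by simp
  exact congr($h t)

theorem HopfFunctionRing.exists_right (O : HopfFunctionRing k a) {f : Fun k a}
    (hf : f ∈ O.carrier) (y : U k a) : ∃ g ∈ O.carrier, ∀ x, g x = f (x * y) := by
  obtain ⟨t, ht⟩ := O.comul_mem f hf
  refine ⟨(TensorProduct.rid k _ (TensorProduct.map LinearMap.id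
    (evalAt k a y ∘ₗ O.carrier.val.toLinearMap) t) : O.carrier), Subtype.prop _, ?_⟩
  intro x
  rw [ht]
  have h : (evalAt k a x ∘ₗ O.carrier.val.toLinearMap) ∘ₗ (TensorProduct.rid k _).toLinearMap ∘ₗ
      TensorProduct.map LinearMap.id (evalAt k a y ∘ₗ O.carrier.val.toLinearMap) =
      LinearMap.mul' k k ∘ₗ TensorProduct.map (evalAt k a x ∘ₗ O.carrier.val.toLinearMap)
        (evalAt k a y ∘ₗ O.carrier.val.toLinearMap) :=
    TensorProduct.ext' fun u v => by simp [mul_comm]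
  exact congr($h t)

/-- An algebraic function ring is stable under infinitesimal translations. -/
def HopfFunctionRing.toFunctionRing (O : HopfFunctionRing k a) : FunctionRing k a where
  carrier := O.carrier
  antipode_mem := O.antipode_mem
  left_mem u f hf := by
    obtain ⟨g, hg, h⟩ := O.exists_left hf (inU k u)
    have : leftTr k a u f = -g := by
      ext x
      rw [leftTr_apply, ← h]
      rfl
    rw [this]
    exact neg_mem hg
  right_mem u f hf := by
    obtain ⟨g, hg, h⟩ := O.exists_right hf (inU k u)
    have : rightTr k a u f = g := by
      ext x
      rw [rightTr_apply, ← h]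
    rw [this]
    exact hg
  bracket_mem := O.bracket_mem

namespace FunctionRing

variable (O : FunctionRing k a)

/-- Infinitesimal left translations of the elements of `O`. -/
def left : a →ₗ[k] Module.End k O.carrier where
  toFun u := (leftTr k a u).restrict (p := O.carrier.toSubmodule) (q := O.carrier.toSubmodule)
    (O.left_mem u)
  map_add' u v := by ext f; simp
  map_smul' c u := by ext f; simp

/-- Infinitesimal right translations of the elements of `O`. -/
def right : a →ₗ[k] Module.End k O.carrier where
  toFun u := (rightTr k a u).restrict (p := O.carrier.toSubmodule) (q := O.carrier.toSubmodule)
    (O.right_mem u)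
  map_add' u v := by ext f; simp
  map_smul' c u := by ext f; simp

/-- The Poisson bracket of `O`. -/
def bracket : O.carrier →ₗ[k] O.carrier →ₗ[k] O.carrier :=
  LinearMap.mk₂ k (fun f g => ⟨plBracket k a f g, O.bracket_mem f f.2 g g.2⟩)
    (fun f f' g => by ext; simp) (fun c f g => by ext; simp)
    (fun f f' g => by ext; simp) (fun c f g => by ext; simp)

/-- The adjoint action of `a` on `d(a)` extends to the group whose function ring is `O`. -/
def AdjointExtends : Prop :=
  ∀ v φ, adCoeff k a v φ ∈ O.carrier

theorem formal_adjointExtends : (FunctionRing.formal k a).AdjointExtends := fun _ _ => trivial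

theorem dress_eq [FiniteDimensional k a] (v : a × Module.Dual k a) (f : Fun k a) :
    dress k a v f = -∑ i, rightTr k a (Module.finBasis k a i) f *
      transpose (antipode k a)
        (adCoeff k a v ((Module.finBasis k a).coord i ∘ₗ LinearMap.fst k a (Module.Dual k a))) := by
  ext x
  have key : ∀ t : U k a ⊗[k] U k a,
      f (LinearMap.mul' k (U k a) (TensorProduct.map LinearMap.id
        (inU k ∘ₗ LinearMap.fst k a (Module.Dual k a) ∘ₗ LinearMap.applyₗ v ∘ₗ
          (actDouble k a).toLinearMap ∘ₗ antipode k a) t)) =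
      ∑ i, LinearMap.mul' k k (TensorProduct.map
        ((toDualAlg k (U k a)).symm (rightTr k a (Module.finBasis k a i) f))
        ((toDualAlg k (U k a)).symm (transpose (antipode k a) (adCoeff k a v
          ((Module.finBasis k a).coord i ∘ₗ LinearMap.fst k a (Module.Dual k a))))) t) := by
    intro t
    induction t using TensorProduct.induction_on with
    | zero => simp
    | add s t hs ht => simp only [map_add, hs, ht, Finset.sum_add_distrib]
    | tmul y z =>
      simp only [TensorProduct.map_tmul, LinearMap.mul'_apply, LinearMap.id_apply,
        LinearMap.comp_apply, LinearMap.fst_apply]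
      conv_lhs => rw [← (Module.finBasis k a).sum_repr
        (LinearMap.applyₗ v ((actDouble k a).toLinearMap (antipode k a z))).1]
      simp only [map_sum, map_smul, Finset.mul_sum, mul_smul_comm, smul_eq_mul]
      refine Finset.sum_congr rfl fun i _ => ?_
      rw [mul_comm, rightTr_apply]
      rfl
  have h := key (Coalgebra.comul (R := k) x)
  have h1 : dress k a v f x = -f (LinearMap.mul' k (U k a) (TensorProduct.map LinearMap.id
        (inU k ∘ₗ LinearMap.fst k a (Module.Dual k a) ∘ₗ LinearMap.applyₗ v ∘ₗ
          (actDouble k a).toLinearMap ∘ₗ antipode k a) (Coalgebra.comul (R := k) x))) := by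
    rw [← map_neg]
    rfl
  rw [h1, h, DualAlg.neg_apply, DualAlg.sum_apply]
  rfl

theorem dress_mem [FiniteDimensional k a] (hO : O.AdjointExtends) (v : a × Module.Dual k a)
    (f : Fun k a) (hf : f ∈ O.carrier) : dress k a v f ∈ O.carrier := by
  rw [dress_eq]
  exact neg_mem (sum_mem fun i _ => mul_mem (O.right_mem _ _ hf) (O.antipode_mem _ (hO _ _)))

/-- The left dressing action of `d(a)` on `O`. -/
def dressing [FiniteDimensional k a] (hO : O.AdjointExtends) :
    (a × Module.Dual k a) →ₗ[k] Module.End k O.carrier where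
  toFun v := (dress k a v).restrict (p := O.carrier.toSubmodule) (q := O.carrier.toSubmodule)
    (O.dress_mem hO v)
  map_add' u v := by ext f; simp
  map_smul' c u := by ext f; simp

end FunctionRing

end FunctionRings

/-! ### Dynamical r-matrices -/

section Tensors

variable (k : Type*) [Field k] (g : Type*) [LieRing g] [LieAlgebra k g]

/-- The bracket as a linear map `g ⊗ g → g`. -/
def brk : g ⊗[k] g →ₗ[k] g := (LieModule.toModuleHom k g g : g ⊗[k] g →ₗ[k] g)

/-- `(a ⊗ b) ⊗ (a' ⊗ b') ↦ [a, a'] ⊗ b ⊗ b' + a ⊗ [b, a'] ⊗ b' + a ⊗ a' ⊗ [b, b']`. -/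
def cybMap : (g ⊗[k] g) ⊗[k] (g ⊗[k] g) →ₗ[k] g ⊗[k] (g ⊗[k] g) :=
  (brk k g).rTensor (g ⊗[k] g) ∘ₗ (TensorProduct.tensorTensorTensorComm k g g g g).toLinearMap +
  ((brk k g).rTensor g ∘ₗ (TensorProduct.assoc k g g g).symm.toLinearMap).lTensor g ∘ₗ
    (TensorProduct.assoc k g g (g ⊗[k] g)).toLinearMap +
  (TensorProduct.assoc k g g g).toLinearMap ∘ₗ (brk k g).lTensor (g ⊗[k] g) ∘ₗ
    (TensorProduct.tensorTensorTensorComm k g g g g).toLinearMap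

theorem cybMap_tmul (a b a' b' : g) : cybMap k g ((a ⊗ₜ b) ⊗ₜ (a' ⊗ₜ b')) =
    ⁅a, a'⁆ ⊗ₜ (b ⊗ₜ b') + a ⊗ₜ (⁅b, a'⁆ ⊗ₜ b') + a ⊗ₜ (a' ⊗ₜ ⁅b, b'⁆) := by
  simp [cybMap, brk]

/-- `CYB(ρ) = [ρ¹², ρ¹³] + [ρ¹², ρ²³] + [ρ¹³, ρ²³]` for `ρ : g ⊗ g ⊗ A`, where `A` is a
commutative algebra. -/
def cyb {A : Type*} [CommRing A] [Algebra k A] (ρ : (g ⊗[k] g) ⊗[k] A) :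
    (g ⊗[k] (g ⊗[k] g)) ⊗[k] A :=
  TensorProduct.map (cybMap k g) (LinearMap.mul' k A)
    (TensorProduct.tensorTensorTensorComm k (g ⊗[k] g) A (g ⊗[k] g) A (ρ ⊗ₜ ρ))

/-- `∧³(g)^g`: the `g`-invariant totally antisymmetric tensors in `g ⊗ g ⊗ g`. -/
def IsInvariantTrivector (Z : g ⊗[k] (g ⊗[k] g)) : Prop :=
  TensorProduct.leftComm k g g g Z = -Z ∧
  (TensorProduct.comm k g g).toLinearMap.lTensor g Z = -Z ∧
  ∀ x : g, ⁅x, Z⁆ = 0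

/-- `∧²(g) ⊗ A`: the elements of `g ⊗ g ⊗ A` that are antisymmetric in the first two factors. -/
def IsBivector {A : Type*} [CommRing A] [Algebra k A] (ρ : (g ⊗[k] g) ⊗[k] A) : Prop :=
  (TensorProduct.comm k g g).toLinearMap.rTensor A ρ = -ρ

/-- The vanishing of the total antisymmetrization of a tensor in `g ⊗ g ⊗ g ⊗ g`
(expressed by pairing with linear forms). -/
def Alt4Zero (t : (g ⊗[k] g) ⊗[k] (g ⊗[k] g)) : Prop :=
  ∀ ξ : Fin 4 → Module.Dual k g,
    ∑ σ : Equiv.Perm (Fin 4), (Equiv.Perm.sign σ : ℤ) •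
      TensorProduct.dualDistrib k (g ⊗[k] g) (g ⊗[k] g)
        (TensorProduct.dualDistrib k g g (ξ (σ 0) ⊗ₜ ξ (σ 1)) ⊗ₜ
          TensorProduct.dualDistrib k g g (ξ (σ 2) ⊗ₜ ξ (σ 3))) t = 0

end Tensors

section Dynamical

variable {k : Type*} [Field k] [CharZero k]
variable {g : Type*} [LieRing g] [LieAlgebra k g] [LieBialgebra k g]
variable {h : Type*} [LieRing h] [LieAlgebra k h] [LieBialgebra k h] [FiniteDimensional k h]

/-- The element `(0, u)` of the double `h^* ⊕ h` of `h^*`, where `h` is identified with the dual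
of `h^*`. -/
def toDouble : h →ₗ[k] DualLie k h × Module.Dual k (DualLie k h) :=
  LinearMap.inr k _ _ ∘ₗ (DualLie.of k).symm.toLinearMap.dualMap ∘ₗ Module.Dual.eval k h

theorem toDouble_apply (u : h) (ξ : DualLie k h) :
    (toDouble (k := k) u).2 ξ = (DualLie.of k).symm ξ u := rfl

/-- The dressing action of `h` on the function ring of `H^*`. -/
def dressH (O : FunctionRing k (DualLie k h)) (hO : O.AdjointExtends) :
    h →ₗ[k] Module.End k O.carrier :=
  O.dressing hO ∘ₗ toDouble

variable {n : Type*} [Fintype n]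

/-- `d^L ρ = - ∑ a ⊗ b ⊗ e_i ⊗ L_{ε^i} ℓ` for `ρ = ∑ a ⊗ b ⊗ ℓ`, where `(e_i)`, `(ε^i)` are dual
bases of `h`, `h^*`, and `ι : h → g` is the inclusion. -/
def dLeft (O : FunctionRing k (DualLie k h)) (ι : h →ₗ⁅k⁆ g) (b : Module.Basis n k h) :
    (g ⊗[k] g) ⊗[k] O.carrier →ₗ[k] (g ⊗[k] (g ⊗[k] g)) ⊗[k] O.carrier :=
  -∑ i, TensorProduct.map
    ((TensorProduct.assoc k g g g).toLinearMap ∘ₗ (TensorProduct.mk k (g ⊗[k] g) g).flip (ι (b i)))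
    (O.left (DualLie.of k (b.coord i)))

/-- `ρ : ∧²(g) ⊗ O` is a Poisson-Lie dynamical r-matrix for `(H^*, g, Z)`, where `O` is the
function ring of `H^*`. -/
structure IsPLDynamicalRMatrix (O : FunctionRing k (DualLie k h)) (hO : O.AdjointExtends)
    (ι : h →ₗ⁅k⁆ g) (b : Module.Basis n k h) (Z : g ⊗[k] (g ⊗[k] g))
    (ρ : (g ⊗[k] g) ⊗[k] O.carrier) : Prop where
  invariant : IsInvariantTrivector k g Z
  alt_cobr : Alt4Zero k g ((cobr k g).rTensor (g ⊗[k] g) Z)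
  bivector : IsBivector k g (A := O.carrier) ρ
  /-- `dress_u(ρ) + [u ⊗ 1 + 1 ⊗ u, ρ] = 0` -/
  equivariant : ∀ u : h, (dressH O hO u).lTensor (g ⊗[k] g) ρ +
    (LieModule.toEnd k g (g ⊗[k] g) (ι u)).rTensor O.carrier ρ = 0
  /-- `CYB(ρ) + Alt(d^L ρ) + Alt((δ ⊗ id) ρ) = Z` -/
  dynamical : cyb k g (A := O.carrier) ρ + (cycAlt k g).rTensor O.carrier (dLeft O ι b ρ) +
    (cycAlt k g ∘ₗ (TensorProduct.assoc k g g g).toLinearMap ∘ₗ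
      (cobr k g).rTensor g).rTensor O.carrier ρ = Z ⊗ₜ 1

/-! ### Brackets on the functions on `H^* × G` -/

variable {B : Type*} [CommRing B] [Algebra k B]

/-- `br` is antisymmetric and satisfies the Leibniz identity with respect to each variable. -/
def IsAntisymmBiderivation (br : B →ₗ[k] B →ₗ[k] B) : Prop :=
  (∀ φ ψ, br φ ψ = -br ψ φ) ∧
  (∀ φ ψ χ, br φ (ψ * χ) = br φ ψ * χ + ψ * br φ χ) ∧
  (∀ φ ψ χ, br (φ * ψ) χ = br φ χ * ψ + φ * br ψ χ)

/-- The linear map `a ⊗ b ⊗ ℓ ↦ ℓ · L_a(g₁) L_b(g₂)` from `g ⊗ g ⊗ O_{H^*}` to `B`, where `B` is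
an algebra that contains `O_{H^*}` and `O_G` through `i` and `j`. -/
def rhoTerm (OH : FunctionRing k (DualLie k h)) (OG : FunctionRing k g)
    (i : OH.carrier →ₐ[k] B) (j : OG.carrier →ₐ[k] B) (g₁ g₂ : OG.carrier) :
    (g ⊗[k] g) ⊗[k] OH.carrier →ₗ[k] B :=
  LinearMap.mul' k B ∘ₗ TensorProduct.map
    (j.toLinearMap ∘ₗ LinearMap.mul' k OG.carrier ∘ₗ
      TensorProduct.map (OG.left.flip g₁) (OG.left.flip g₂))
    i.toLinearMap

/-- The bracket `br` on `B`, an algebra that contains `O_{H^*}` and `O_G` through `i` and `j`, is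
an antisymmetric biderivation given on `O_{H^*}` and `O_G` by the formulas
`{f₁, f₂} = -{f₁, f₂}_{H^*}`, `{f, γ} = ∑ L_{ε^i}(f) L_{e_i}(γ)`,
`{γ₁, γ₂} = {γ₁, γ₂}_G + ∑ ℓ L_a(γ₁) L_b(γ₂)` for `ρ = ∑ a ⊗ b ⊗ ℓ`. -/
structure IsDynamicalBracket (OH : FunctionRing k (DualLie k h)) (OG : FunctionRing k g)
    (i : OH.carrier →ₐ[k] B) (j : OG.carrier →ₐ[k] B) (ι : h →ₗ⁅k⁆ g) (b : Module.Basis n k h)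
    (ρ : (g ⊗[k] g) ⊗[k] OH.carrier) (br : B →ₗ[k] B →ₗ[k] B) : Prop where
  biderivation : IsAntisymmBiderivation br
  base : ∀ f₁ f₂, br (i f₁) (i f₂) = -i (OH.bracket f₁ f₂)
  mixed : ∀ f γ, br (i f) (j γ) =
    ∑ m, i (OH.left (DualLie.of k (b.coord m)) f) * j (OG.left (ι (b m)) γ)
  fiber : ∀ γ₁ γ₂, br (j γ₁) (j γ₂) = j (OG.bracket γ₁ γ₂) + rhoTerm OH OG i j γ₁ γ₂ ρ

/-- `θ` is a Poisson action on `(B, br)` of the Lie algebra `a` with the cobracket `δ`: a Lie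
algebra morphism to the derivations of `B` with
`θ_x {f, f'} = {θ_x f, f'} + {f, θ_x f'} + ∑ θ_{x₁}(f) θ_{x₂}(f')` for `δ x = ∑ x₁ ⊗ x₂`. -/
structure IsPoissonAction {a : Type*} [LieRing a] [LieAlgebra k a] (δ : a →ₗ[k] a ⊗[k] a)
    (θ : a →ₗ[k] Module.End k B) (br : B →ₗ[k] B →ₗ[k] B) : Prop where
  leibniz : ∀ x f f', θ x (f * f') = θ x f * f' + f * θ x f'
  lie : ∀ x y f, θ ⁅x, y⁆ f = θ x (θ y f) - θ y (θ x f)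
  poisson : ∀ x f f', θ x (br f f') = br (θ x f) f' + br f (θ x f') +
    LinearMap.mul' k B (TensorProduct.map (θ.flip f) (θ.flip f') (δ x))

/-- `m (θ^{⊗ 3} (Z) (φ₁ ⊗ φ₂ ⊗ φ₃))`, where `m` is the product of `B`. -/
def triAction (θ : g →ₗ[k] Module.End k B) (φ₁ φ₂ φ₃ : B) : g ⊗[k] (g ⊗[k] g) →ₗ[k] B :=
  LinearMap.mul' k B ∘ₗ TensorProduct.map (θ.flip φ₁)
    (LinearMap.mul' k B ∘ₗ TensorProduct.map (θ.flip φ₂) (θ.flip φ₃))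

/-- The bracket `br` is quasi-Poisson: its Jacobiator is the action of `Z` through `θG`; and
`θH`, `θG` are commuting Poisson actions of `(h, -δ)` and of `(g, δ)`. -/
structure IsQuasiPoisson (Z : g ⊗[k] (g ⊗[k] g)) (θH : h →ₗ[k] Module.End k B)
    (θG : g →ₗ[k] Module.End k B) (br : B →ₗ[k] B →ₗ[k] B) : Prop where
  jacobiator : ∀ φ₁ φ₂ φ₃, br (br φ₁ φ₂) φ₃ + br (br φ₂ φ₃) φ₁ + br (br φ₃ φ₁) φ₂ =
    triAction θG φ₁ φ₂ φ₃ Z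
  actionH : IsPoissonAction (-cobr k h) θH br
  actionG : IsPoissonAction (cobr k g) θG br
  commute : ∀ u x φ, θH u (θG x φ) = θG x (θH u φ)

/-! ### The formal case -/

variable (k h g) in
/-- The function algebra `k[[H^* × G]] = (U(h^*) ⊗ U(g))^*`, which is the completed tensor product
of `k[[H^*]]` and `k[[G]]`. -/
abbrev FormalFun : Type _ := DualAlg k (U k (DualLie k h) ⊗[k] U k g)

variable (k h g) in
/-- `f ↦ f ⊗ 1` from `k[[H^*]]` to `k[[H^* × G]]`. -/
def formalLeft : (FunctionRing.formal k (DualLie k h)).carrier →ₐ[k] FormalFun k g h :=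
  (pullback ((Coalgebra.TensorProduct.rid k k (U k (DualLie k h))).toCoalgHom.comp
    (Coalgebra.TensorProduct.map (CoalgHom.id k (U k (DualLie k h)))
      (Coalgebra.counitCoalgHom k (U k g))))).comp (Subalgebra.val _)

theorem formalLeft_apply (f : (FunctionRing.formal k (DualLie k h)).carrier)
    (x : U k (DualLie k h)) (y : U k g) :
    formalLeft k g h f (x ⊗ₜ y) = f.1 x * Coalgebra.counit (R := k) y := by
  simp [formalLeft, pullback, mul_comm]

variable (k h g) in
/-- `γ ↦ 1 ⊗ γ` from `k[[G]]` to `k[[H^* × G]]`. -/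
def formalRight : (FunctionRing.formal k g).carrier →ₐ[k] FormalFun k g h :=
  (pullback ((Coalgebra.TensorProduct.lid k (U k g)).toCoalgHom.comp
    (Coalgebra.TensorProduct.map (Coalgebra.counitCoalgHom k (U k (DualLie k h)))
      (CoalgHom.id k (U k g))))).comp (Subalgebra.val _)

theorem formalRight_apply (γ : (FunctionRing.formal k g).carrier)
    (x : U k (DualLie k h)) (y : U k g) :
    formalRight k g h γ (x ⊗ₜ y) = Coalgebra.counit (R := k) x * γ.1 y := by
  simp [formalRight, pullback]

/-- The action `dress ⊗ id + id ⊗ L` of `h` on `k[[H^* × G]]`. -/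
def formalActH (ι : h →ₗ⁅k⁆ g) : h →ₗ[k] Module.End k (FormalFun k g h) :=
  transposeHom k _ _ ∘ₗ
    (LinearMap.rTensorHom (U k g) ∘ₗ dressTHom k (DualLie k h) ∘ₗ toDouble +
      LinearMap.lTensorHom (U k (DualLie k h)) ∘ₗ leftT k g ∘ₗ (ι : h →ₗ[k] g))

variable (k h g) in
/-- The action `id ⊗ R` of `g` on `k[[H^* × G]]`. -/
def formalActG : g →ₗ[k] Module.End k (FormalFun k g h) :=
  transposeHom k _ _ ∘ₗ LinearMap.lTensorHom (U k (DualLie k h)) ∘ₗ rightT k g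

/-! ### The algebraic case -/

/-- The action `dress ⊗ id + id ⊗ L` of `h` on `O_{H^*} ⊗ O_G`. -/
def algActH (OH : FunctionRing k (DualLie k h)) (hOH : OH.AdjointExtends) (OG : FunctionRing k g)
    (ι : h →ₗ⁅k⁆ g) : h →ₗ[k] Module.End k (OH.carrier ⊗[k] OG.carrier) :=
  LinearMap.rTensorHom OG.carrier ∘ₗ dressH OH hOH +
    LinearMap.lTensorHom OH.carrier ∘ₗ OG.left ∘ₗ (ι : h →ₗ[k] g)

/-- The action `id ⊗ R` of `g` on `O_{H^*} ⊗ O_G`. -/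
def algActG (OH : FunctionRing k (DualLie k h)) (OG : FunctionRing k g) :
    g →ₗ[k] Module.End k (OH.carrier ⊗[k] OG.carrier) :=
  LinearMap.lTensorHom OH.carrier ∘ₗ OG.right

end Dynamical

end PLGroup

end

open scoped TensorProduct

set_option linter.unusedSectionVars false

noncomputable section

namespace PLGroup

/-! ### Translations and the Poisson bracket on the formal group -/

section Functions

variable {k : Type*} [Field k] {a : Type*} [LieRing a] [LieAlgebra k a]

/-! The bracket is $-\{,\}_{H^*}+\sum_i\mathbf L_{\varepsilon^i}\wedge\mathbf
L_{e_i}+\{,\}_G+\sum\ell_\alpha\,\mathbf L_{a_\alpha}\otimes\mathbf L_{b_\alpha}$, a sum of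
biderivations. A map that is a derivation in each variable is fixed by its values on functions of
$H^*$ and functions of $G$ (`DerivDetermined`), so uniqueness, antisymmetry, the Jacobiator and the
Poisson action identities are all checked on these generators.

The Jacobiator has four cases. On three functions of $H^*$ it vanishes by the Jacobi identity of
$H^*$. On two functions of $H^*$ and one of $G$ (`jacobi_base_base_fiber`) it vanishes because the
cobracket of $\mathfrak h^*$ is dual to the bracket of $\mathfrak h\subset\mathfrak g$. On one
function of $H^*$ and two of $G$ (`jacobi_base_fiber_fiber`) the terms free of $\rho$ cancel since
$\delta$ restricts to $\mathfrak h$, and the others are the equivariance of $\rho$ under dressing.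
On three functions of $G$ (`jacobi_fiber`) the dynamical equation gives $-Z$ acting by left
translations, which for an invariant trivector is $Z$ acting by right translations
(`triAction_leftTr`).

The facts about a single Poisson–Lie group come from one principle, `eq_zero_of_leftTr`: to prove an
identity between functions, let its defect depend on all its arguments, check that it vanishes at
the unit, and check that a left translation sends a defect to a combination of defects. This gives
$\{f,g\}=\sum_i\mathrm{dress}_{e^i}(f)\,\mathbf L_{e_i}(g)$ (`plBracket_eq_dress`), the fact that
dressing is a Lie algebra action (`dualDress_lie`), and the Jacobi identity. Since dressing fields
and translations are derivations, the Leibniz rule and the Poisson property of dressing follow from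
the first formula.

In the algebraic case $\mathcal O_{H^*}$ and $\mathcal O_G$ generate the tensor product, so
`DerivDetermined` is immediate. In the formal case they do not, and no continuity of derivations is
available. A Hadamard lemma (`exists_hadamard`) writes
$\varphi=f\otimes1+\sum_i(1\otimes\xi_i)\,T_i\varphi$ with $\xi_i$ vanishing at the unit of $G$. A
derivation killing both factors thus sends $\varphi$ into every power of the ideal generated by such
functions, and these powers intersect in zero (`derivDetermined_formal`). The lemma rests on the
spanning of $U(\mathfrak g)$ by powers $v^m$, $v\in\mathfrak g$, and on operators diagonal on these
powers, both available in characteristic $0$. -/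

theorem U_induction {p : U k a → Prop} (h1 : p 1)
    (hadd : ∀ x y, p x → p y → p (x + y)) (hsmul : ∀ (c : k) x, p x → p (c • x))
    (hmul : ∀ (v : a) (x : U k a), p x → p (inU k v * x)) (x : U k a) : p x := by
  let S : Submodule k (U k a) :=
    { carrier := {x | p x}
      add_mem' := fun {x y} hx hy => hadd x y hx hy
      zero_mem' := by simpa using hsmul 0 1 h1
      smul_mem' := fun c x hx => hsmul c x hx }
  -- The subspace `S` need not be closed under products, but its left multipliers form a subalgebra,
  -- which contains the image of `a`.
  let T : Subalgebra k (U k a) :=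
    { carrier := {x | ∀ y ∈ S, x * y ∈ S}
      mul_mem' := fun {x y} hx hy z hz => by rw [mul_assoc]; exact hx _ (hy _ hz)
      add_mem' := fun {x y} hx hy z hz => by rw [add_mul]; exact S.add_mem (hx _ hz) (hy _ hz)
      algebraMap_mem' := fun c z hz => by
        rw [← Algebra.smul_def]; exact S.smul_mem c hz }
  have hT : ∀ v : a, inU k v ∈ T := fun v y hy => hmul v y hy
  -- By the universal property, the map from `U(a)` to `T` followed by the inclusion is the
  -- identity, so `T` is all of `U(a)`.
  let F : U k a →ₐ[k] T := liftU k (A := T)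
    ((inU k).codRestrict (Subalgebra.toSubmodule T) hT) (by
      intro x y
      apply Subtype.ext
      exact inU_lie k x y)
  have hF : T.val.comp F = AlgHom.id k _ := by
    apply homU_ext
    intro v
    simp only [F, AlgHom.comp_apply, liftU_inU]
    rfl
  have hx : x ∈ T := by
    have := congr($hF x)
    rw [AlgHom.comp_apply, AlgHom.id_apply] at this
    rw [← this]
    exact (F x).2
  have h := hx 1 h1
  rwa [mul_one] at h

/-- A family of functions that vanish at the unit, whose span is stable under the infinitesimal
left translations, is zero. -/
theorem eq_zero_of_leftTr {I : Type*} (F : I → Fun k a) (h1 : ∀ i, F i 1 = 0)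
    (hL : ∀ v i, leftTr k a v (F i) ∈ Submodule.span k (Set.range F)) (i : I) : F i = 0 := by
  have hL' : ∀ v, ∀ f ∈ Submodule.span k (Set.range F),
      leftTr k a v f ∈ Submodule.span k (Set.range F) := by
    intro v f hf
    induction hf using Submodule.span_induction with
    | mem f hf => obtain ⟨i, rfl⟩ := hf; exact hL v i
    | zero => simp
    | add f g _ _ hf hg => rw [map_add]; exact add_mem hf hg
    | smul c f _ hf => rw [map_smul]; exact Submodule.smul_mem _ c hf
  have h1' : ∀ f ∈ Submodule.span k (Set.range F), f 1 = 0 := by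
    intro f hf
    induction hf using Submodule.span_induction with
    | mem f hf => obtain ⟨i, rfl⟩ := hf; exact h1 i
    | zero => rfl
    | add f g _ _ hf hg => rw [DualAlg.add_apply, hf, hg, add_zero]
    | smul c f _ hf => rw [DualAlg.smul_apply, hf, mul_zero]
  -- The induction on `x` runs over the whole span at once: the value of `f` at `v x` is, up to
  -- sign, the value at `x` of another element of the span.
  have key : ∀ x : U k a, ∀ f ∈ Submodule.span k (Set.range F), f x = 0 := by
    intro x
    induction x using U_induction with
    | h1 => exact h1'
    | hadd x y hx hy => intro f hf; simp only [DualAlg.coe_def, map_add] at *; simp [hx f hf, hy f hf]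
    | hsmul c x hx => intro f hf; simp only [DualAlg.coe_def, map_smul] at *; simp [hx f hf]
    | hmul v x hx =>
      intro f hf
      have := hx _ (hL' v f hf)
      rwa [leftTr_apply, neg_eq_zero] at this
  ext x
  exact key x _ (Submodule.subset_span ⟨i, rfl⟩)

theorem Fun.mul_apply_one (f g : Fun k a) : (f * g) 1 = f 1 * g 1 := by
  rw [DualAlg.mul_apply, Bialgebra.comul_one, Algebra.TensorProduct.one_def]
  rfl

theorem leftTr_mul (v : a) (f g : Fun k a) :
    leftTr k a v (f * g) = leftTr k a v f * g + f * leftTr k a v g := by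
  ext x
  rw [leftTr_apply, DualAlg.mul_apply, Bialgebra.comul_mul, comul_inU, DualAlg.add_apply,
    DualAlg.mul_apply, DualAlg.mul_apply]
  induction Coalgebra.comul (R := k) x using TensorProduct.induction_on with
  | zero => simp
  | add s t hs ht => simp only [mul_add, map_add, neg_add_rev, hs, ht]; ring
  | tmul y z =>
    simp only [add_mul, Algebra.TensorProduct.tmul_mul_tmul, one_mul, map_add,
      TensorProduct.map_tmul, LinearMap.mul'_apply, ← DualAlg.coe_def, leftTr_apply]
    ring

theorem rightTr_mul (v : a) (f g : Fun k a) :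
    rightTr k a v (f * g) = rightTr k a v f * g + f * rightTr k a v g := by
  ext x
  rw [rightTr_apply, DualAlg.mul_apply, Bialgebra.comul_mul, comul_inU, DualAlg.add_apply,
    DualAlg.mul_apply, DualAlg.mul_apply]
  induction Coalgebra.comul (R := k) x using TensorProduct.induction_on with
  | zero => simp
  | add s t hs ht => simp only [add_mul, map_add, hs, ht]; ring
  | tmul y z =>
    simp only [mul_add, Algebra.TensorProduct.tmul_mul_tmul, mul_one, map_add,
      TensorProduct.map_tmul, LinearMap.mul'_apply, ← DualAlg.coe_def, rightTr_apply]

theorem leftTr_rightTr (v w : a) (f : Fun k a) :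
    leftTr k a v (rightTr k a w f) = rightTr k a w (leftTr k a v f) := by
  ext x
  simp only [leftTr_apply, rightTr_apply, mul_assoc]

theorem leftTr_lie (v w : a) (f : Fun k a) :
    leftTr k a ⁅v, w⁆ f = leftTr k a v (leftTr k a w f) - leftTr k a w (leftTr k a v f) := by
  ext x
  simp only [map_sub, LinearMap.sub_apply, leftTr_apply, inU_lie, sub_mul, mul_assoc]
  ring

theorem rightTr_lie (v w : a) (f : Fun k a) :
    rightTr k a ⁅v, w⁆ f = rightTr k a v (rightTr k a w f) - rightTr k a w (rightTr k a v f) := by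
  ext x
  simp only [rightTr_apply, inU_lie, mul_sub, ← mul_assoc, map_sub, LinearMap.sub_apply]

variable [LieBialgebra k a]

theorem plBracket_apply (f g : Fun k a) (x : U k a) : plBracket k a f g x =
    LinearMap.mul' k k (TensorProduct.map ((toDualAlg k _).symm f) ((toDualAlg k _).symm g)
      (deltaU k a x)) := rfl

/-- `∑ f'(x₁) f''(x₂)` for the bivector `t = ∑ x₁ ⊗ x₂` and linear operators `θ` indexed by `a`. -/
def biAct {B : Type*} [CommRing B] [Algebra k B] (θ : a →ₗ[k] Module.End k B) (f g : B) :
    a ⊗[k] a →ₗ[k] B :=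
  LinearMap.mul' k B ∘ₗ TensorProduct.map (θ.flip f) (θ.flip g)

@[simp] theorem biAct_tmul {B : Type*} [CommRing B] [Algebra k B] (θ : a →ₗ[k] Module.End k B)
    (f g : B) (x y : a) : biAct θ f g (x ⊗ₜ y) = θ x f * θ y g := rfl

theorem deltaU_one : deltaU k a 1 = 0 := by
  have := deltaU_mul k a 1 1
  simpa using this

theorem plBracket_apply_one (f g : Fun k a) : plBracket k a f g 1 = 0 := by
  rw [plBracket_apply, deltaU_one, map_zero, map_zero]

/-- Infinitesimal multiplicativity of the Poisson structure:
$\delta_U(vx)=\Delta(v)\delta_U(x)+\delta(v)\Delta(x)$. The two signs in a product of left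
translations cancel, so the overall sign of $\mathbf L_v$ survives in front of $\delta(v)$; right
translations give a plus. -/
theorem leftTr_plBracket (v : a) (f g : Fun k a) :
    leftTr k a v (plBracket k a f g) = plBracket k a (leftTr k a v f) g +
      plBracket k a f (leftTr k a v g) - biAct (leftTr k a) f g (cobr k a v) := by
  ext x
  have h2 : (biAct (leftTr k a) f g (cobr k a v)) x =
      LinearMap.mul' k k (TensorProduct.map ((toDualAlg k _).symm f) ((toDualAlg k _).symm g)
        (cobrU k a v * Coalgebra.comul (R := k) x)) := by
    rw [cobrU, LinearMap.comp_apply]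
    induction cobr k a v using TensorProduct.induction_on with
    | zero => simp
    | add s t hs ht => simp only [map_add, add_mul, LinearMap.add_apply, hs, ht]
    | tmul y z =>
      rw [biAct_tmul, DualAlg.mul_apply, TensorProduct.map_tmul]
      induction Coalgebra.comul (R := k) x using TensorProduct.induction_on with
      | zero => simp
      | add s t hs ht => simp only [map_add, mul_add, hs, ht]
      | tmul p q =>
        simp only [Algebra.TensorProduct.tmul_mul_tmul, TensorProduct.map_tmul,
          LinearMap.mul'_apply, ← DualAlg.coe_def, leftTr_apply]
        ring
  rw [sub_eq_add_neg, DualAlg.add_apply, DualAlg.add_apply, DualAlg.neg_apply, h2, leftTr_apply,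
    plBracket_apply, plBracket_apply, plBracket_apply, deltaU_mul, comul_inU, deltaU_inU, map_add,
    map_add, neg_add, add_left_inj]
  induction deltaU k a x using TensorProduct.induction_on with
  | zero => simp
  | add s t hs ht => simp only [mul_add, map_add, neg_add_rev, hs, ht]; ring
  | tmul y z =>
    simp only [add_mul, Algebra.TensorProduct.tmul_mul_tmul, one_mul, map_add,
      TensorProduct.map_tmul, LinearMap.mul'_apply, ← DualAlg.coe_def, leftTr_apply]
    ring

theorem rightTr_plBracket (v : a) (f g : Fun k a) :
    rightTr k a v (plBracket k a f g) = plBracket k a (rightTr k a v f) g +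
      plBracket k a f (rightTr k a v g) + biAct (rightTr k a) f g (cobr k a v) := by
  ext x
  have h2 : (biAct (rightTr k a) f g (cobr k a v)) x =
      LinearMap.mul' k k (TensorProduct.map ((toDualAlg k _).symm f) ((toDualAlg k _).symm g)
        (Coalgebra.comul (R := k) x * cobrU k a v)) := by
    rw [cobrU, LinearMap.comp_apply]
    induction cobr k a v using TensorProduct.induction_on with
    | zero => simp
    | add s t hs ht => simp only [map_add, mul_add, LinearMap.add_apply, hs, ht]
    | tmul y z =>
      rw [biAct_tmul, DualAlg.mul_apply, TensorProduct.map_tmul]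
      induction Coalgebra.comul (R := k) x using TensorProduct.induction_on with
      | zero => simp
      | add s t hs ht => simp only [map_add, add_mul, hs, ht]
      | tmul p q =>
        simp only [Algebra.TensorProduct.tmul_mul_tmul, TensorProduct.map_tmul,
          LinearMap.mul'_apply, ← DualAlg.coe_def, rightTr_apply]
  rw [DualAlg.add_apply, DualAlg.add_apply, h2, rightTr_apply,
    plBracket_apply, plBracket_apply, plBracket_apply, deltaU_mul, comul_inU, deltaU_inU, map_add,
    map_add, add_comm, add_left_inj]
  induction deltaU k a x using TensorProduct.induction_on with
  | zero => simp
  | add s t hs ht => simp only [add_mul, map_add, hs, ht]; ring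
  | tmul y z =>
    simp only [mul_add, Algebra.TensorProduct.tmul_mul_tmul, mul_one, map_add,
      TensorProduct.map_tmul, LinearMap.mul'_apply, ← DualAlg.coe_def, rightTr_apply]

end Functions
-- Dressing fields and the Poisson bracket expressed through them
section Dressing

variable {k : Type*} [Field k] {a : Type*} [LieRing a] [LieAlgebra k a] [LieBialgebra k a]

theorem adDouble_apply (x : a) (p : a × Module.Dual k a) :
    adDouble k a x p =
      (⁅x, p.1⁆ + contr k p.2 (cobr k a x), -(p.2 ∘ₗ (LieModule.toEnd k a a x))) := rfl

theorem actDouble_inU (x : a) : actDouble k a (inU k x) = adDouble k a x := liftU_inU _ _ _ _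

theorem dressT_apply (v : a × Module.Dual k a) (x : U k a) : dressT k a v x =
    -LinearMap.mul' k (U k a) (TensorProduct.map LinearMap.id
      (inU k ∘ₗ LinearMap.fst k a (Module.Dual k a) ∘ₗ LinearMap.applyₗ v ∘ₗ
        (actDouble k a).toLinearMap ∘ₗ antipode k a) (Coalgebra.comul (R := k) x)) := rfl

/-- Infinitesimal form of $\mathrm{Ad}((gx)^{-1})v=\mathrm{Ad}(x^{-1})\mathrm{Ad}(g^{-1})v$: in
$\Delta(\xi x)$ the primitive $\xi$ lands either on the first factor, or on the second, where the
antipode turns it into $-\mathrm{ad}_\xi$ applied to `v`. -/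
theorem dressT_inU_mul (v : a × Module.Dual k a) (ξ : a) (x : U k a) :
    dressT k a v (inU k ξ * x) = inU k ξ * dressT k a v x - dressT k a (adDouble k a ξ v) x := by
  rw [dressT_apply, dressT_apply, dressT_apply, Bialgebra.comul_mul, comul_inU]
  induction Coalgebra.comul (R := k) x using TensorProduct.induction_on with
  | zero => simp
  | add s t hs ht =>
    simp only [mul_add, map_add, neg_add_rev] at hs ht ⊢
    rw [hs, ht]
    abel
  | tmul y z =>
    simp only [add_mul, Algebra.TensorProduct.tmul_mul_tmul, one_mul, map_add,
      TensorProduct.map_tmul, LinearMap.mul'_apply, LinearMap.id_apply, LinearMap.comp_apply,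
      antipode_mul, antipode_inU, AlgHom.toLinearMap_apply, map_mul, map_neg, actDouble_inU,
      LinearMap.applyₗ_apply_apply, Module.End.mul_apply, mul_neg, mul_assoc]
    abel

theorem dress_apply (v : a × Module.Dual k a) (f : Fun k a) (x : U k a) :
    dress k a v f x = f (dressT k a v x) := rfl

theorem leftTr_dress (ξ : a) (v : a × Module.Dual k a) (f : Fun k a) :
    leftTr k a ξ (dress k a v f) =
      dress k a v (leftTr k a ξ f) + dress k a (adDouble k a ξ v) f := by
  ext x
  rw [leftTr_apply, DualAlg.add_apply, dress_apply, dress_apply, dress_apply, leftTr_apply,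
    dressT_inU_mul, map_sub]
  ring

theorem dress_apply_one (v : a × Module.Dual k a) (f : Fun k a) :
    dress k a v f 1 = -f (inU k v.1) := by
  rw [dress_apply, dressT_apply, Bialgebra.comul_one, Algebra.TensorProduct.one_def]
  simp [antipode_one]

variable (k a) in
/-- The dressing action of the elements of `a^*`. -/
def dualDress : Module.Dual k a →ₗ[k] Module.End k (Fun k a) :=
  dress k a ∘ₗ LinearMap.inr k _ _

theorem dress_inr (η : Module.Dual k a) (f : Fun k a) :
    dress k a (0, η) f = dualDress k a η f := rfl

theorem dualDress_apply_one (η : Module.Dual k a) (f : Fun k a) :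
    dualDress k a η f 1 = 0 := by
  rw [← dress_inr, dress_apply_one]; simp

/-- For $y\in\mathfrak a$ the vector $\mathrm{Ad}(x^{-1})y$ stays in $\mathfrak a$, and moving it to
the right of $x$ is the same as putting $y$ on the left. -/
theorem dress_inl (y : a) (f : Fun k a) : dress k a (y, 0) f = leftTr k a y f := by
  have := eq_zero_of_leftTr (k := k) (a := a)
    -- The family is indexed by `y` as well as by `f`, because a left translation by `ξ` also
    -- replaces `y` by `⁅ξ, y⁆`.
    (fun p : a × Fun k a => dress k a (p.1, 0) p.2 - leftTr k a p.1 p.2) ?_ ?_ (y, f)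
  · exact sub_eq_zero.mp this
  · rintro ⟨y, f⟩
    rw [map_sub, LinearMap.sub_apply, dress_apply_one, leftTr_apply]
    simp
  · rintro ξ ⟨y, f⟩
    have : leftTr k a ξ (dress k a (y, 0) f - leftTr k a y f) =
        (dress k a (y, 0) (leftTr k a ξ f) - leftTr k a y (leftTr k a ξ f)) +
        (dress k a (⁅ξ, y⁆, 0) f - leftTr k a ⁅ξ, y⁆ f) := by
      have h : adDouble k a ξ (y, 0) = (⁅ξ, y⁆, 0) := by
        rw [adDouble_apply]; ext <;> simp [contr]
      rw [map_sub, leftTr_dress, leftTr_lie, h]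
      abel
    simp only [this]
    exact add_mem (Submodule.subset_span ⟨(y, _), rfl⟩) (Submodule.subset_span ⟨(_, f), rfl⟩)

/-- The coefficients of the cobracket in a basis are the structure constants of the dual. -/
theorem tensor_eq_sum {V n : Type*} [AddCommGroup V] [Module k V] [Fintype n]
    (e : Module.Basis n k V) (t : V ⊗[k] V) :
    t = ∑ p, ∑ q, TensorProduct.dualDistrib k V V (e.coord p ⊗ₜ e.coord q) t • (e p ⊗ₜ[k] e q) := by
  induction t using TensorProduct.induction_on with
  | zero => simp
  | add s t hs ht =>
    simp only [map_add, add_smul, Finset.sum_add_distrib]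
    rw [← hs, ← ht]
  | tmul x y =>
    conv_lhs => rw [← e.sum_repr x, ← e.sum_repr y, TensorProduct.sum_tmul]
    refine Finset.sum_congr rfl fun p _ => ?_
    rw [TensorProduct.tmul_sum]
    refine Finset.sum_congr rfl fun q _ => ?_
    rw [TensorProduct.smul_tmul_smul]
    simp

theorem cobr_eq_sum {n : Type*} [Fintype n] (e : Module.Basis n k a) (v : a) :
    cobr k a v = ∑ p, ∑ q, dualBracket k (e.coord p) (e.coord q) v • (e p ⊗ₜ[k] e q) :=
  tensor_eq_sum e _

theorem contr_cobr_eq_sum {n : Type*} [Fintype n] (e : Module.Basis n k a) (ξ : Module.Dual k a)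
    (v : a) : contr k ξ (cobr k a v) = ∑ q, dualBracket k ξ (e.coord q) v • e q := by
  conv_lhs => rw [← e.sum_repr (contr k ξ (cobr k a v))]
  refine Finset.sum_congr rfl fun q _ => ?_
  rw [dualBracket_eq, Module.Basis.coord_apply]

theorem map_eq_sum {V M n : Type*} [AddCommGroup V] [Module k V] [AddCommGroup M] [Module k M]
    [Fintype n] (e : Module.Basis n k V) (T : V →ₗ[k] Module.End k M) (x : V) (f : M) :
    T x f = ∑ i, e.coord i x • T (e i) f := by
  conv_lhs => rw [← e.sum_repr x]
  simp only [map_sum, map_smul, LinearMap.sum_apply, LinearMap.smul_apply, e.coord_apply]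

theorem dual_eq_sum {n : Type*} [Fintype n] (e : Module.Basis n k a) (ξ : Module.Dual k a) :
    ξ = ∑ i, ξ (e i) • e.coord i := by
  classical
  apply e.ext
  intro j
  simp

theorem biAct_cobr {B : Type*} [CommRing B] [Algebra k B] {n : Type*} [Fintype n]
    (e : Module.Basis n k a) (θ : a →ₗ[k] Module.End k B) (f g : B) (v : a) :
    biAct θ f g (cobr k a v) =
      ∑ p, ∑ q, dualBracket k (e.coord p) (e.coord q) v • (θ (e p) f * θ (e q) g) := by
  rw [cobr_eq_sum e]
  simp only [map_sum, map_smul, biAct_tmul]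

theorem biAct_comm {B : Type*} [CommRing B] [Algebra k B] (θ : a →ₗ[k] Module.End k B) (f g : B)
    (t : a ⊗[k] a) : biAct θ f g (TensorProduct.comm k a a t) = biAct θ g f t := by
  induction t using TensorProduct.induction_on with
  | zero => simp
  | add s t hs ht => simp only [map_add, hs, ht]
  | tmul x y => simp [mul_comm]

theorem biAct_cobr_swap {B : Type*} [CommRing B] [Algebra k B] (θ : a →ₗ[k] Module.End k B)
    (f g : B) (v : a) : biAct θ g f (cobr k a v) = -biAct θ f g (cobr k a v) := by
  rw [← biAct_comm, LieBialgebra.antisymm, map_neg]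

/-- The symmetric part of the bracket vanishes at the unit, and the cobracket terms in its left
translations cancel by the antisymmetry of $\delta$. -/
theorem plBracket_swap (f g : Fun k a) : plBracket k a f g = -plBracket k a g f := by
  have := eq_zero_of_leftTr (k := k) (a := a)
    (fun p : Fun k a × Fun k a => plBracket k a p.1 p.2 + plBracket k a p.2 p.1) ?_ ?_ (f, g)
  · exact eq_neg_of_add_eq_zero_left this
  · rintro ⟨f, g⟩
    simp only [map_add, LinearMap.add_apply, plBracket_apply_one, add_zero]
  · rintro ξ ⟨f, g⟩
    have : leftTr k a ξ (plBracket k a f g + plBracket k a g f) =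
        (plBracket k a (leftTr k a ξ f) g + plBracket k a g (leftTr k a ξ f)) +
        (plBracket k a f (leftTr k a ξ g) + plBracket k a (leftTr k a ξ g) f) := by
      rw [map_add, leftTr_plBracket, leftTr_plBracket, biAct_cobr_swap]
      abel
    simp only [this]
    exact add_mem (Submodule.subset_span ⟨(_, _), rfl⟩) (Submodule.subset_span ⟨(_, _), rfl⟩)

variable {n : Type*} [Fintype n] (e : Module.Basis n k a)

theorem adDouble_inr (ξ : a) (η : Module.Dual k a) : adDouble k a ξ (0, η) =
    (contr k η (cobr k a ξ), 0) + (0, -(η ∘ₗ LieModule.toEnd k a a ξ)) := by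
  rw [adDouble_apply]; simp

/-- The commutator of $\mathbf L_\xi$ with dressing by $\eta$ is dressing by $[\xi,\eta]$ in the
double; its component in $\mathfrak a$ acts as a left translation, by `dress_inl`. -/
theorem leftTr_dualDress (ξ : a) (η : Module.Dual k a) (f : Fun k a) :
    leftTr k a ξ (dualDress k a η f) = dualDress k a η (leftTr k a ξ f) +
      leftTr k a (contr k η (cobr k a ξ)) f - dualDress k a (η ∘ₗ LieModule.toEnd k a a ξ) f := by
  have h : ((0, -(η ∘ₗ LieModule.toEnd k a a ξ)) : a × Module.Dual k a) =
    -(0, η ∘ₗ LieModule.toEnd k a a ξ) := by simp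
  rw [← dress_inr, leftTr_dress, adDouble_inr, map_add, LinearMap.add_apply, dress_inl, h, map_neg,
    LinearMap.neg_apply, dress_inr, dress_inr]
  abel

/-- The Poisson bracket in terms of dressing vector fields. -/
theorem plBracket_eq_dress (f g : Fun k a) :
    plBracket k a f g = ∑ i, dualDress k a (e.coord i) f * leftTr k a (e i) g := by
  have := eq_zero_of_leftTr (k := k) (a := a) (fun p : Fun k a × Fun k a => plBracket k a p.1 p.2
    - ∑ i, dualDress k a (e.coord i) p.1 * leftTr k a (e i) p.2) ?_ ?_ (f, g)
  · exact sub_eq_zero.mp this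
  · rintro ⟨f, g⟩
    simp only [map_sub, LinearMap.sub_apply, plBracket_apply_one, zero_sub, neg_eq_zero]
    rw [DualAlg.sum_apply]
    refine Finset.sum_eq_zero fun i _ => ?_
    rw [Fun.mul_apply_one, dualDress_apply_one, zero_mul]
  · rintro ξ ⟨f, g⟩
    -- The components in `a` of the brackets of `ξ` with the dual basis assemble into the cobracket
    -- term of `leftTr_plBracket`.
    have h1 : ∑ i, leftTr k a (contr k (e.coord i) (cobr k a ξ)) f * leftTr k a (e i) g =
        -biAct (leftTr k a) f g (cobr k a ξ) := by
      rw [← biAct_cobr_swap, biAct_cobr e]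
      refine Finset.sum_congr rfl fun i _ => ?_
      rw [contr_cobr_eq_sum e, map_sum, LinearMap.sum_apply, Finset.sum_mul]
      refine Finset.sum_congr rfl fun q _ => ?_
      rw [map_smul, LinearMap.smul_apply, smul_mul_assoc, mul_comm]
    -- The canonical element $\sum_i e^i\otimes e_i$ is invariant, so the components in the dual
    -- cancel against the commutators of left translations.
    have h2 : ∑ i, dualDress k a (e.coord i ∘ₗ LieModule.toEnd k a a ξ) f * leftTr k a (e i) g =
        ∑ i, dualDress k a (e.coord i) f * leftTr k a ⁅ξ, e i⁆ g := by
      have l : ∀ i, dualDress k a (e.coord i ∘ₗ LieModule.toEnd k a a ξ) f =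
          ∑ j, e.coord i ⁅ξ, e j⁆ • dualDress k a (e.coord j) f := by
        intro i
        conv_lhs => rw [dual_eq_sum e (e.coord i ∘ₗ LieModule.toEnd k a a ξ)]
        simp only [map_sum, map_smul, LinearMap.sum_apply, LinearMap.smul_apply]
        rfl
      have r : ∀ i, leftTr k a ⁅ξ, e i⁆ g = ∑ j, e.coord j ⁅ξ, e i⁆ • leftTr k a (e j) g :=
        fun i => map_eq_sum e _ _ _
      simp only [l, r, Finset.sum_mul, Finset.mul_sum]
      rw [Finset.sum_comm]
      simp
    have : leftTr k a ξ (plBracket k a f g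
          - ∑ i, dualDress k a (e.coord i) f * leftTr k a (e i) g) =
        (plBracket k a (leftTr k a ξ f) g
          - ∑ i, dualDress k a (e.coord i) (leftTr k a ξ f) * leftTr k a (e i) g) +
        (plBracket k a f (leftTr k a ξ g)
          - ∑ i, dualDress k a (e.coord i) f * leftTr k a (e i) (leftTr k a ξ g)) := by
      have h3 : ∑ i, leftTr k a ξ (dualDress k a (e.coord i) f * leftTr k a (e i) g) =
          ∑ i, dualDress k a (e.coord i) (leftTr k a ξ f) * leftTr k a (e i) g +
          ∑ i, leftTr k a (contr k (e.coord i) (cobr k a ξ)) f * leftTr k a (e i) g -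
          ∑ i, dualDress k a (e.coord i ∘ₗ LieModule.toEnd k a a ξ) f * leftTr k a (e i) g +
          ∑ i, dualDress k a (e.coord i) f * leftTr k a (e i) (leftTr k a ξ g) +
          ∑ i, dualDress k a (e.coord i) f * leftTr k a ⁅ξ, e i⁆ g := by
        simp only [← Finset.sum_add_distrib, ← Finset.sum_sub_distrib]
        refine Finset.sum_congr rfl fun i _ => ?_
        rw [leftTr_mul, leftTr_dualDress, leftTr_lie]
        ring
      rw [map_sub, map_sum, h3, h1, h2, leftTr_plBracket]
      abel
    simp only [this]
    exact add_mem (Submodule.subset_span ⟨(_, _), rfl⟩) (Submodule.subset_span ⟨(_, _), rfl⟩)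

end Dressing
-- Leibniz, action and Jacobi identities on one Poisson–Lie group
section Dressing

variable {k : Type*} [Field k] {a : Type*} [LieRing a] [LieAlgebra k a] [LieBialgebra k a]

/-- By `FunctionRing.dress_eq`, a dressing field is a combination of right translations whose
coefficients are functions. -/
theorem dress_mul [FiniteDimensional k a] (v : a × Module.Dual k a) (f g : Fun k a) :
    dress k a v (f * g) = dress k a v f * g + f * dress k a v g := by
  have h : ∀ c : Fin (Module.finrank k a) → Fun k a,
      ∑ i, rightTr k a (Module.finBasis k a i) (f * g) * c i =
        (∑ i, rightTr k a (Module.finBasis k a i) f * c i) * g +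
        f * ∑ i, rightTr k a (Module.finBasis k a i) g * c i := by
    intro c
    rw [Finset.sum_mul, Finset.mul_sum, ← Finset.sum_add_distrib]
    refine Finset.sum_congr rfl fun i _ => ?_
    rw [rightTr_mul]
    ring
  rw [FunctionRing.dress_eq, FunctionRing.dress_eq, FunctionRing.dress_eq, h]
  ring

theorem dualDress_mul [FiniteDimensional k a] (η : Module.Dual k a) (f g : Fun k a) :
    dualDress k a η (f * g) = dualDress k a η f * g + f * dualDress k a η g :=
  dress_mul _ f g

theorem plBracket_mul_left [FiniteDimensional k a] (f f' g : Fun k a) :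
    plBracket k a (f * f') g = plBracket k a f g * f' + f * plBracket k a f' g := by
  simp only [plBracket_eq_dress (Module.finBasis k a), dualDress_mul, Finset.sum_mul,
    Finset.mul_sum, ← Finset.sum_add_distrib]
  exact Finset.sum_congr rfl fun i _ => by ring

theorem plBracket_mul_right [FiniteDimensional k a] (f g g' : Fun k a) :
    plBracket k a f (g * g') = plBracket k a f g * g' + g * plBracket k a f g' := by
  simp only [plBracket_eq_dress (Module.finBasis k a), leftTr_mul, Finset.sum_mul,
    Finset.mul_sum, ← Finset.sum_add_distrib]
  exact Finset.sum_congr rfl fun i _ => by ring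

/-- Contraction of $\delta$ with $u$ is, up to sign, the coadjoint action of $u\in\mathfrak a^*$ on
$\mathfrak a$. Paired with a third form `w`, the identity is the Jacobi identity of $\mathfrak a^*$.
-/
theorem contr_cobr_dualBracket (u v : Module.Dual k a) (ξ : a) :
    contr k (dualBracket k u v) (cobr k a ξ) =
      contr k v (cobr k a (contr k u (cobr k a ξ))) -
        contr k u (cobr k a (contr k v (cobr k a ξ))) := by
  rw [← sub_eq_zero]
  refine (Module.forall_dual_apply_eq_zero_iff k _).mp fun w => ?_
  have h := dualBracket_jacobi k u v w ξ
  have e : dualBracket k w u = -dualBracket k u w := LinearMap.ext fun y => by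
    simpa using dualBracket_swap k w u y
  have e' : dualBracket k (-dualBracket k u w) v ξ = dualBracket k v (dualBracket k u w) ξ := by
    rw [dualBracket_swap]; simp [dualBracket_eq]
  rw [e, e', dualBracket_swap k (dualBracket k v w)] at h
  simp only [map_sub, ← dualBracket_eq]
  linear_combination h

/-- This is the cocycle condition on $\delta[\xi,y]$ paired with `u ⊗ v`, rearranged as an identity
of forms in `y`. With `contr_cobr_dualBracket` it gives the two components of the Jacobi identity of
the double for $\xi,u,v$. -/
theorem dualBracket_comp_ad [FiniteDimensional k a] (u v : Module.Dual k a) (ξ : a) :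
    u ∘ₗ LieModule.toEnd k a a (contr k v (cobr k a ξ)) -
      v ∘ₗ LieModule.toEnd k a a (contr k u (cobr k a ξ)) +
      dualBracket k u v ∘ₗ LieModule.toEnd k a a ξ =
    dualBracket k u (v ∘ₗ LieModule.toEnd k a a ξ) +
      dualBracket k (u ∘ₗ LieModule.toEnd k a a ξ) v := by
  ext y
  have h := contr_cobr_lie k u ξ y v
  have s : ∀ (w : Module.Dual k a) (z : a), w ⁅y, z⁆ = -w ⁅z, y⁆ := fun w z => by
    rw [← map_neg, lie_skew]
  rw [s, s] at h
  simp only [LinearMap.add_apply, LinearMap.sub_apply, LinearMap.comp_apply,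
    LieModule.toEnd_apply_apply]
  rw [dualBracket_swap k (u ∘ₗ _) v, dualBracket_eq k u (v ∘ₗ _),
    dualBracket_eq k v (u ∘ₗ _)]
  simp only [LinearMap.comp_apply, LieModule.toEnd_apply_apply]
  linear_combination h

theorem dualDress_lie [FiniteDimensional k a] (u v : Module.Dual k a) (f : Fun k a) :
    dualDress k a (dualBracket k u v) f =
      dualDress k a u (dualDress k a v f) - dualDress k a v (dualDress k a u f) := by
  let C : Module.Dual k a × Module.Dual k a × Fun k a → Fun k a := fun p =>
    dualDress k a p.1 (dualDress k a p.2.1 p.2.2) - dualDress k a p.2.1 (dualDress k a p.1 p.2.2) -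
      dualDress k a (dualBracket k p.1 p.2.1) p.2.2
  have := eq_zero_of_leftTr (k := k) (a := a) C ?_ ?_ (u, v, f)
  · exact (sub_eq_zero.mp this).symm
  · rintro ⟨u, v, f⟩
    simp only [C, map_sub, LinearMap.sub_apply, dualDress_apply_one, sub_zero]
  · rintro ξ ⟨u, v, f⟩
    -- Left translations produced by `leftTr_dualDress` cancel by `contr_cobr_dualBracket`; the
    -- dressing terms outside the defects cancel by `dualBracket_comp_ad`.
    have : leftTr k a ξ (C (u, v, f)) = C (u, v, leftTr k a ξ f) -
        C (u ∘ₗ LieModule.toEnd k a a ξ, v, f) - C (u, v ∘ₗ LieModule.toEnd k a a ξ, f) := by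
      have h := congrArg (fun w => dualDress k a w f) (dualBracket_comp_ad u v ξ)
      simp only [map_add, map_sub, LinearMap.add_apply, LinearMap.sub_apply] at h
      simp only [C, map_sub, leftTr_dualDress, contr_cobr_dualBracket, map_add,
        LinearMap.sub_apply]
      linear_combination (exp := 1) h
    rw [this]
    exact sub_mem (sub_mem (Submodule.subset_span ⟨_, rfl⟩) (Submodule.subset_span ⟨_, rfl⟩))
      (Submodule.subset_span ⟨_, rfl⟩)

variable {n : Type*} [Fintype n] (e : Module.Basis n k a)

theorem dualDress_eq_sum (u : Module.Dual k a) (f : Fun k a) :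
    dualDress k a u f = ∑ i, u (e i) • dualDress k a (e.coord i) f := by
  conv_lhs => rw [dual_eq_sum e u]
  simp only [map_sum, map_smul, LinearMap.sum_apply, LinearMap.smul_apply]

/-- The commutator of dressing fields and left translations. -/
theorem dualDress_leftTr (u : Module.Dual k a) (ξ : a) (f : Fun k a) :
    dualDress k a u (leftTr k a ξ f) = leftTr k a ξ (dualDress k a u f) +
      (∑ j, u ⁅ξ, e j⁆ • dualDress k a (e.coord j) f -
        ∑ j, dualBracket k u (e.coord j) ξ • leftTr k a (e j) f) := by
  have h := leftTr_dualDress ξ u f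
  have h1 : leftTr k a (contr k u (cobr k a ξ)) f =
      ∑ j, dualBracket k u (e.coord j) ξ • leftTr k a (e j) f := by
    rw [map_eq_sum e]
    simp only [dualBracket_eq]
  have h2 := dualDress_eq_sum e (u ∘ₗ LieModule.toEnd k a a ξ) f
  rw [h1, h2] at h
  rw [h]
  simp only [LinearMap.comp_apply, LieModule.toEnd_apply_apply]
  abel

/-- Dressing is a Poisson action: commute $\mathrm{dress}_u$ past both factors of each term
$\mathrm{dress}_{e^i}(f)\,\mathbf L_{e_i}(g)$. What survives has the structure constants of
$\mathfrak a$ as coefficients, that is, the cobracket of $\mathfrak a^*$ on `u`. -/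
theorem dualDress_plBracket [FiniteDimensional k a] (u : Module.Dual k a) (f g : Fun k a) :
    dualDress k a u (plBracket k a f g) = plBracket k a (dualDress k a u f) g +
      plBracket k a f (dualDress k a u g) +
      ∑ i, ∑ j, u ⁅e i, e j⁆ • (dualDress k a (e.coord i) f * dualDress k a (e.coord j) g) := by
  have h1 : ∀ i, dualDress k a u (dualDress k a (e.coord i) f) =
      dualDress k a (e.coord i) (dualDress k a u f) +
        ∑ j, dualBracket k u (e.coord i) (e j) • dualDress k a (e.coord j) f := by
    intro i
    rw [← dualDress_eq_sum, dualDress_lie]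
    abel
  -- Invariance of the canonical element under $u\in\mathfrak a^*$: the commutators of dressing
  -- fields cancel against the left translation part of `dualDress_leftTr`.
  have h2 : ∑ i, (∑ j, dualBracket k u (e.coord i) (e j) • dualDress k a (e.coord j) f) *
      leftTr k a (e i) g = ∑ i, dualDress k a (e.coord i) f *
        ∑ j, dualBracket k u (e.coord j) (e i) • leftTr k a (e j) g := by
    simp only [Finset.sum_mul, Finset.mul_sum]
    rw [Finset.sum_comm]
    simp
  have h3 : ∑ i, dualDress k a (e.coord i) f * ∑ j, u ⁅e i, e j⁆ • dualDress k a (e.coord j) g =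
      ∑ i, ∑ j, u ⁅e i, e j⁆ • (dualDress k a (e.coord i) f * dualDress k a (e.coord j) g) := by
    simp only [Finset.mul_sum, mul_smul_comm]
  rw [plBracket_eq_dress e, plBracket_eq_dress e, plBracket_eq_dress e, ← h3, map_sum]
  simp only [dualDress_mul, h1, dualDress_leftTr e, add_mul, mul_add, mul_sub,
    Finset.sum_add_distrib, Finset.sum_sub_distrib, h2]
  abel

/-- A left translation of the Jacobiator is a sum of Jacobiators plus terms with one $\delta$ and
one bracket (`M`) and terms with two $\delta$ (`T`). The `M` terms cancel in the cyclic sum; the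
cyclic sum of the `T` terms is the co-Jacobi identity. -/
theorem plBracket_jacobi [FiniteDimensional k a] (f₁ f₂ f₃ : Fun k a) :
    plBracket k a (plBracket k a f₁ f₂) f₃ + plBracket k a (plBracket k a f₂ f₃) f₁ +
      plBracket k a (plBracket k a f₃ f₁) f₂ = 0 := by
  let J : Fun k a × Fun k a × Fun k a → Fun k a := fun p =>
    plBracket k a (plBracket k a p.1 p.2.1) p.2.2 + plBracket k a (plBracket k a p.2.1 p.2.2) p.1 +
      plBracket k a (plBracket k a p.2.2 p.1) p.2.1
  refine eq_zero_of_leftTr (k := k) (a := a) J ?_ ?_ (f₁, f₂, f₃)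
  · rintro ⟨f₁, f₂, f₃⟩
    simp only [J, map_add, LinearMap.add_apply, plBracket_apply_one, add_zero]
  rintro v ⟨f₁, f₂, f₃⟩
  let e := Module.finBasis k a
  let D : Fin (Module.finrank k a) → Fin (Module.finrank k a) → k := fun p q =>
    dualBracket k (e.coord p) (e.coord q) v
  let X : Fin (Module.finrank k a) → Module.End k (Fun k a) := fun p => leftTr k a (e p)
  have hD : ∀ p q, D q p = -D p q := fun p q => dualBracket_swap k _ _ _
  have hb : ∀ f g, biAct (leftTr k a) f g (cobr k a v) = ∑ p, ∑ q, D p q • (X p f * X q g) :=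
    fun f g => biAct_cobr e _ f g v
  let M : Fun k a → Fun k a → Fun k a → Fun k a := fun f g h =>
    ∑ p, ∑ q, D p q • (plBracket k a (X p f) g * X q h)
  let T : Fun k a → Fun k a → Fun k a → Fun k a := fun f g h =>
    ∑ p, ∑ q, D p q • (biAct (leftTr k a) f g (cobr k a (e p)) * X q h)
  have h1 : ∀ f g h, plBracket k a (biAct (leftTr k a) f g (cobr k a v)) h = M f h g - M g h f := by
    intro f g h
    have : M g h f = -∑ p, ∑ q, D p q • (X p f * plBracket k a (X q g) h) := by
      simp only [M]
      rw [Finset.sum_comm, ← Finset.sum_neg_distrib]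
      refine Finset.sum_congr rfl fun p _ => ?_
      rw [← Finset.sum_neg_distrib]
      refine Finset.sum_congr rfl fun q _ => ?_
      rw [hD p q, mul_comm]
      simp only [Algebra.smul_def, map_neg]
      ring
    rw [this, sub_neg_eq_add, hb]
    simp only [M, map_sum, map_smul, LinearMap.sum_apply, LinearMap.smul_apply,
      plBracket_mul_left, smul_add, Finset.sum_add_distrib]
  have h2 : ∀ f g h, biAct (leftTr k a) (plBracket k a f g) h (cobr k a v) =
      M f g h - M g f h - T f g h := by
    intro f g h
    rw [hb]
    simp only [M, T, X, ← Finset.sum_sub_distrib, leftTr_plBracket]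
    refine Finset.sum_congr rfl fun p _ => Finset.sum_congr rfl fun q _ => ?_
    rw [plBracket_swap f]
    simp only [Algebra.smul_def]
    ring
  have h3 : ∀ f g h, leftTr k a v (plBracket k a (plBracket k a f g) h) =
      plBracket k a (plBracket k a (leftTr k a v f) g) h +
      plBracket k a (plBracket k a f (leftTr k a v g)) h +
      plBracket k a (plBracket k a f g) (leftTr k a v h) -
      (M f h g - M g h f) - (M f g h - M g f h - T f g h) := by
    intro f g h
    rw [leftTr_plBracket, leftTr_plBracket, map_sub, LinearMap.sub_apply, map_add,
      LinearMap.add_apply, h1, h2]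
    abel
  -- Each `T` is $(\delta\otimes\mathrm{id})\delta(v)$ applied to three functions through left
  -- translations; permuting the functions amounts to permuting the tensor cyclically.
  have h4 : T f₁ f₂ f₃ + T f₂ f₃ f₁ + T f₃ f₁ f₂ = 0 := by
    let tri : Fun k a → Fun k a → Fun k a → a ⊗[k] (a ⊗[k] a) →ₗ[k] Fun k a := fun f g h =>
      LinearMap.mul' k _ ∘ₗ TensorProduct.map ((leftTr k a).flip f) (biAct (leftTr k a) g h)
    have hc : ∀ f g h t, tri f g h (cyc k a t) = tri h f g t := by
      intro f g h t
      have : tri f g h ∘ₗ cyc k a = tri h f g := by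
        refine TensorProduct.ext' fun x t => ?_
        induction t using TensorProduct.induction_on with
        | zero => simp
        | add s t hs ht => simp only [TensorProduct.tmul_add, map_add, hs, ht]
        | tmul y z =>
          simp only [tri, LinearMap.comp_apply, cyc_tmul, TensorProduct.map_tmul, biAct_tmul,
            LinearMap.mul'_apply, LinearMap.flip_apply]
          ring
      exact congr($this t)
    have ht : ∀ f g h, tri f g h (TensorProduct.assoc k a a a ((cobr k a).rTensor a (cobr k a v))) =
        T f g h := by
      intro f g h
      conv_lhs => rw [cobr_eq_sum e v]
      simp only [map_sum, map_smul, T, D]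
      refine Finset.sum_congr rfl fun p _ => Finset.sum_congr rfl fun q _ => ?_
      congr 1
      rw [LinearMap.rTensor_tmul]
      generalize cobr k a (e p) = t
      induction t using TensorProduct.induction_on with
      | zero => simp
      | add s t hs ht => simp only [TensorProduct.add_tmul, map_add, add_mul, hs, ht]
      | tmul x y => simp [tri, X, mul_assoc]
    have h := congrArg (tri f₁ f₂ f₃) (LieBialgebra.coJacobi (k := k) v)
    simp only [cycAlt, LinearMap.add_apply, LinearMap.comp_apply, map_add, hc, LinearMap.id_apply,
      map_zero] at h
    have h' := h
    rw [ht, ht, ht] at h'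
    rw [← h']
    abel
  have : leftTr k a v (J (f₁, f₂, f₃)) = J (leftTr k a v f₁, f₂, f₃) + J (f₁, leftTr k a v f₂, f₃) +
      J (f₁, f₂, leftTr k a v f₃) := by
    simp only [J, map_add, h3]
    linear_combination h4
  rw [this]
  exact add_mem (add_mem (Submodule.subset_span ⟨_, rfl⟩) (Submodule.subset_span ⟨_, rfl⟩))
      (Submodule.subset_span ⟨_, rfl⟩)

end Dressing

/-! ### Left and right actions of an invariant trivector -/

section Trivector

variable {k : Type*} [Field k] [CharZero k] {a : Type*} [LieRing a] [LieAlgebra k a]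
  [LieBialgebra k a]

@[simp] theorem triAction_tmul {B : Type*} [CommRing B] [Algebra k B] (θ : a →ₗ[k] Module.End k B)
    (f g h : B) (x y z : a) : triAction θ f g h (x ⊗ₜ (y ⊗ₜ z)) = θ x f * (θ y g * θ z h) := rfl

/-- On an invariant trivector, left and right translations differ by a sign. -/
theorem triAction_leftTr {Z : a ⊗[k] (a ⊗[k] a)} (hZ : ∀ x : a, ⁅x, Z⁆ = 0) (f₁ f₂ f₃ : Fun k a) :
    triAction (leftTr k a) f₁ f₂ f₃ Z = -triAction (rightTr k a) f₁ f₂ f₃ Z := by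
  let F : Fun k a × Fun k a × Fun k a → Fun k a := fun p =>
    triAction (leftTr k a) p.1 p.2.1 p.2.2 Z + triAction (rightTr k a) p.1 p.2.1 p.2.2 Z
  have := eq_zero_of_leftTr (k := k) (a := a) F ?_ ?_ (f₁, f₂, f₃)
  · exact eq_neg_of_add_eq_zero_left this
  · rintro ⟨f₁, f₂, f₃⟩
    have : ∀ Z : a ⊗[k] (a ⊗[k] a), (triAction (leftTr k a) f₁ f₂ f₃ Z +
        triAction (rightTr k a) f₁ f₂ f₃ Z) 1 = 0 := by
      intro Z
      induction Z using TensorProduct.induction_on with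
      | zero => simp
      | add s t hs ht =>
        simp only [map_add, LinearMap.add_apply] at hs ht ⊢
        linear_combination hs + ht
      | tmul x t =>
        induction t using TensorProduct.induction_on with
        | zero => simp
        | add s t hs ht =>
          simp only [TensorProduct.tmul_add, map_add, LinearMap.add_apply] at hs ht ⊢
          linear_combination hs + ht
        | tmul y z =>
          -- At the unit, $\mathbf L_xf$ and $\mathbf R_xf$ have opposite values; an odd number of
          -- factors leaves one sign.
          rw [triAction_tmul, triAction_tmul, DualAlg.add_apply]
          simp only [Fun.mul_apply_one, leftTr_apply, rightTr_apply, mul_one, one_mul]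
          ring
    exact this Z
  · rintro v ⟨f₁, f₂, f₃⟩
    -- Commuting left translations produces an extra action of `⁅v, Z⁆`, which vanishes by
    -- invariance. The right version has no such term, as left and right translations commute.
    have hl : ∀ Z : a ⊗[k] (a ⊗[k] a), leftTr k a v (triAction (leftTr k a) f₁ f₂ f₃ Z) =
        triAction (leftTr k a) (leftTr k a v f₁) f₂ f₃ Z +
        triAction (leftTr k a) f₁ (leftTr k a v f₂) f₃ Z +
        triAction (leftTr k a) f₁ f₂ (leftTr k a v f₃) Z +
        triAction (leftTr k a) f₁ f₂ f₃ ⁅v, Z⁆ := by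
      intro Z
      induction Z using TensorProduct.induction_on with
      | zero => simp
      | add s t hs ht => simp only [map_add, lie_add, hs, ht]; abel
      | tmul x t =>
        induction t using TensorProduct.induction_on with
        | zero => simp
        | add s t hs ht => simp only [map_add, lie_add, TensorProduct.tmul_add, hs, ht]; abel
        | tmul y z =>
          simp only [TensorProduct.LieModule.lie_tmul_right, TensorProduct.tmul_add, map_add,
            triAction_tmul, leftTr_mul, leftTr_lie]
          ring
    have hr : ∀ Z : a ⊗[k] (a ⊗[k] a), leftTr k a v (triAction (rightTr k a) f₁ f₂ f₃ Z) =
        triAction (rightTr k a) (leftTr k a v f₁) f₂ f₃ Z +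
        triAction (rightTr k a) f₁ (leftTr k a v f₂) f₃ Z +
        triAction (rightTr k a) f₁ f₂ (leftTr k a v f₃) Z := by
      intro Z
      induction Z using TensorProduct.induction_on with
      | zero => simp
      | add s t hs ht => simp only [map_add, hs, ht]; abel
      | tmul x t =>
        induction t using TensorProduct.induction_on with
        | zero => simp
        | add s t hs ht => simp only [map_add, TensorProduct.tmul_add, hs, ht]; abel
        | tmul y z =>
          simp only [triAction_tmul, leftTr_mul, leftTr_rightTr]
          ring
    have : leftTr k a v (F (f₁, f₂, f₃)) = F (leftTr k a v f₁, f₂, f₃) +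
        F (f₁, leftTr k a v f₂, f₃) + F (f₁, f₂, leftTr k a v f₃) := by
      simp only [F, map_add, hl, hr, hZ, map_zero]
      abel
    rw [this]
    exact add_mem (add_mem (Submodule.subset_span ⟨_, rfl⟩) (Submodule.subset_span ⟨_, rfl⟩))
      (Submodule.subset_span ⟨_, rfl⟩)

end Trivector
-- Restriction of the identities to a function ring
namespace FunctionRing

variable {k : Type*} [Field k] {a : Type*} [LieRing a] [LieAlgebra k a] [LieBialgebra k a]
  (O : FunctionRing k a)

theorem left_mul (v : a) (f g : O.carrier) : O.left v (f * g) = O.left v f * g + f * O.left v g :=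
  Subtype.ext (leftTr_mul v f.1 g.1)

theorem right_mul (v : a) (f g : O.carrier) :
    O.right v (f * g) = O.right v f * g + f * O.right v g :=
  Subtype.ext (rightTr_mul v f.1 g.1)

theorem left_right (v w : a) (f : O.carrier) : O.left v (O.right w f) = O.right w (O.left v f) :=
  Subtype.ext (leftTr_rightTr v w f.1)

theorem left_lie (v w : a) (f : O.carrier) :
    O.left ⁅v, w⁆ f = O.left v (O.left w f) - O.left w (O.left v f) :=
  Subtype.ext (leftTr_lie v w f.1)

theorem right_lie (v w : a) (f : O.carrier) :
    O.right ⁅v, w⁆ f = O.right v (O.right w f) - O.right w (O.right v f) :=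
  Subtype.ext (rightTr_lie v w f.1)

theorem bracket_swap (f g : O.carrier) : O.bracket f g = -O.bracket g f :=
  Subtype.ext (plBracket_swap f.1 g.1)

theorem bracket_mul_left [FiniteDimensional k a] (f f' g : O.carrier) :
    O.bracket (f * f') g = O.bracket f g * f' + f * O.bracket f' g :=
  Subtype.ext (plBracket_mul_left f.1 f'.1 g.1)

theorem bracket_mul_right [FiniteDimensional k a] (f g g' : O.carrier) :
    O.bracket f (g * g') = O.bracket f g * g' + g * O.bracket f g' :=
  Subtype.ext (plBracket_mul_right f.1 g.1 g'.1)

theorem bracket_jacobi [FiniteDimensional k a] (f₁ f₂ f₃ : O.carrier) :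
    O.bracket (O.bracket f₁ f₂) f₃ + O.bracket (O.bracket f₂ f₃) f₁ +
      O.bracket (O.bracket f₃ f₁) f₂ = 0 :=
  Subtype.ext (plBracket_jacobi f₁.1 f₂.1 f₃.1)

theorem coe_biAct_left (f g : O.carrier) (t : a ⊗[k] a) :
    (biAct O.left f g t : O.carrier).1 = biAct (leftTr k a) f.1 g.1 t := by
  induction t using TensorProduct.induction_on with
  | zero => simp
  | add s t hs ht => simp only [map_add, ← hs, ← ht]; rfl
  | tmul x y => rfl

theorem coe_biAct_right (f g : O.carrier) (t : a ⊗[k] a) :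
    (biAct O.right f g t : O.carrier).1 = biAct (rightTr k a) f.1 g.1 t := by
  induction t using TensorProduct.induction_on with
  | zero => simp
  | add s t hs ht => simp only [map_add, ← hs, ← ht]; rfl
  | tmul x y => rfl

theorem left_bracket (v : a) (f g : O.carrier) :
    O.left v (O.bracket f g) = O.bracket (O.left v f) g + O.bracket f (O.left v g) -
      biAct O.left f g (cobr k a v) := by
  apply Subtype.ext
  have := leftTr_plBracket v f.1 g.1
  rw [← coe_biAct_left] at this
  exact this

theorem right_bracket (v : a) (f g : O.carrier) :
    O.right v (O.bracket f g) = O.bracket (O.right v f) g + O.bracket f (O.right v g) +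
      biAct O.right f g (cobr k a v) := by
  apply Subtype.ext
  have := rightTr_plBracket v f.1 g.1
  rw [← coe_biAct_right] at this
  exact this

theorem triAction_left [CharZero k] {Z : a ⊗[k] (a ⊗[k] a)} (hZ : ∀ x : a, ⁅x, Z⁆ = 0)
    (f₁ f₂ f₃ : O.carrier) : triAction O.left f₁ f₂ f₃ Z = -triAction O.right f₁ f₂ f₃ Z := by
  have key : ∀ (θ : a →ₗ[k] Module.End k O.carrier) (θ' : a →ₗ[k] Module.End k (Fun k a))
      (_ : ∀ v f, (θ v f : O.carrier).1 = θ' v f.1) (Z : a ⊗[k] (a ⊗[k] a)),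
      (triAction θ f₁ f₂ f₃ Z).1 = triAction θ' f₁.1 f₂.1 f₃.1 Z := by
    intro θ θ' hθ Z
    have : O.carrier.val.toLinearMap ∘ₗ triAction θ f₁ f₂ f₃ =
        triAction θ' f₁.1 f₂.1 f₃.1 := by
      refine TensorProduct.ext' fun x t => ?_
      induction t using TensorProduct.induction_on with
      | zero => simp
      | add s t hs ht => simp only [TensorProduct.tmul_add, map_add, hs, ht]
      | tmul y z => simp [hθ]
    exact congr($this Z)
  apply Subtype.ext
  have h := triAction_leftTr hZ f₁.1 f₂.1 f₃.1
  rw [← key O.left (leftTr k a) (fun _ _ => rfl), ← key O.right (rightTr k a) (fun _ _ => rfl)] at h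
  exact h

end FunctionRing

/-! ### The group with Lie bialgebra $\mathfrak h^*$, in dual bases -/

section DualGroup

variable {k : Type*} [Field k] [CharZero k]
  {h : Type*} [LieRing h] [LieAlgebra k h] [LieBialgebra k h] [FiniteDimensional k h]
  {n : Type*} [Fintype n] (b : Module.Basis n k h)

/-- The basis of `h^*` dual to a basis of `h`. -/
def dualBasisLie : Module.Basis n k (DualLie k h) :=
  open Classical in b.dualBasis.map (DualLie.of k)

theorem dualBasisLie_apply (i : n) : dualBasisLie b i = DualLie.of k (b.coord i) := by
  simp [dualBasisLie]

theorem coord_dualBasisLie (i : n) :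
    (dualBasisLie b).coord i = (toDouble (k := k) (b i)).2 := by
  classical
  apply (dualBasisLie b).ext
  intro j
  rw [toDouble_apply, dualBasisLie_apply, ← dualBasisLie_apply, Module.Basis.coord_apply,
    Module.Basis.repr_self, dualBasisLie_apply, LinearEquiv.symm_apply_apply]
  rw [Module.Basis.coord_apply, Module.Basis.repr_self, Finsupp.single_apply,
    Finsupp.single_apply]
  simp only [eq_comm]

/-- The cobracket of $\mathfrak h^*$ is the transpose of the bracket of $\mathfrak h$, so biduality
identifies $(\mathfrak h^*)^*$ with $\mathfrak h$ as Lie algebras. -/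
theorem dualBracket_toDouble (u v : h) :
    dualBracket k (toDouble (k := k) u).2 (toDouble (k := k) v).2 =
      (toDouble (k := k) ⁅u, v⁆).2 := by
  have key : ∀ t : DualLie k h ⊗[k] DualLie k h, TensorProduct.dualDistrib k _ _
      ((toDouble (k := k) u).2 ⊗ₜ (toDouble (k := k) v).2) t = pair2 k t (u ⊗ₜ v) := by
    intro t
    induction t using TensorProduct.induction_on with
    | zero => simp
    | add s t hs ht => simp only [map_add, LinearMap.add_apply, hs, ht]
    | tmul ξ η => simp [toDouble_apply]
  ext ξ
  rw [toDouble_apply, ← pair2_dualCobr, ← key]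
  rfl

theorem lie_of_coord (i j : n) :
    ⁅DualLie.of k (b.coord i), DualLie.of k (b.coord j)⁆ =
      ∑ m, dualBracket k (b.coord i) (b.coord j) (b m) • DualLie.of k (b.coord m) := by
  rw [DualLie.lie_def, LinearEquiv.symm_apply_apply, LinearEquiv.symm_apply_apply,
    dual_eq_sum b (dualBracket k (b.coord i) (b.coord j)), map_sum]
  simp only [map_smul, ← dual_eq_sum b]

namespace FunctionRing

variable (O : FunctionRing k (DualLie k h))

/-- The infinitesimal left translation by an element of the dual basis. -/
def leftCoord (m : n) : Module.End k O.carrier := O.left (DualLie.of k (b.coord m))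

theorem leftCoord_bracket (m : n) (f g : O.carrier) :
    O.leftCoord b m (O.bracket f g) = O.bracket (O.leftCoord b m f) g +
      O.bracket f (O.leftCoord b m g) -
      ∑ i, ∑ j, b.coord m ⁅b i, b j⁆ • (O.leftCoord b i f * O.leftCoord b j g) := by
  rw [leftCoord, left_bracket, biAct_cobr (dualBasisLie b)]
  congr 1
  refine Finset.sum_congr rfl fun i _ => Finset.sum_congr rfl fun j _ => ?_
  rw [coord_dualBasisLie, coord_dualBasisLie, dualBracket_toDouble, toDouble_apply,
    dualBasisLie_apply, dualBasisLie_apply, LinearEquiv.symm_apply_apply]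
  rfl

theorem leftCoord_comm (i j : n) (f : O.carrier) :
    O.leftCoord b i (O.leftCoord b j f) - O.leftCoord b j (O.leftCoord b i f) =
      ∑ m, dualBracket k (b.coord i) (b.coord j) (b m) • O.leftCoord b m f := by
  simp only [leftCoord]
  rw [← left_lie, lie_of_coord, map_sum, LinearMap.sum_apply]
  simp only [map_smul, LinearMap.smul_apply]

variable (hO : O.AdjointExtends)

theorem coe_dressH (u : h) (f : O.carrier) :
    (dressH O hO u f).1 = dualDress k (DualLie k h) (toDouble (k := k) u).2 f.1 := rfl

theorem dressH_mul (u : h) (f g : O.carrier) :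
    dressH O hO u (f * g) = dressH O hO u f * g + f * dressH O hO u g :=
  Subtype.ext (dualDress_mul _ f.1 g.1)

theorem dressH_lie (u v : h) (f : O.carrier) :
    dressH O hO ⁅u, v⁆ f = dressH O hO u (dressH O hO v f) - dressH O hO v (dressH O hO u f) := by
  apply Subtype.ext
  rw [coe_dressH, ← dualBracket_toDouble, dualDress_lie]
  rfl

/-- This lets the equivariance of $\rho$ enter the Jacobiator: it turns the bracket of a coefficient
of $\rho$ with a function on $H^*$ into dressing of that coefficient. -/
theorem bracket_eq_dressH (f g : O.carrier) :
    O.bracket f g = ∑ m, dressH O hO (b m) f * O.leftCoord b m g := by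
  apply Subtype.ext
  have := plBracket_eq_dress (dualBasisLie b) f.1 g.1
  simp only [coord_dualBasisLie, dualBasisLie_apply] at this
  rw [AddSubmonoidClass.coe_finsetSum]
  exact this

theorem dressH_bracket (u : h) (f g : O.carrier) :
    dressH O hO u (O.bracket f g) = O.bracket (dressH O hO u f) g +
      O.bracket f (dressH O hO u g) + ∑ i, ∑ j, dualBracket k (b.coord i) (b.coord j) u •
        (dressH O hO (b i) f * dressH O hO (b j) g) := by
  apply Subtype.ext
  have := dualDress_plBracket (dualBasisLie b) (toDouble (k := k) u).2 f.1 g.1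
  simp only [coord_dualBasisLie, dualBasisLie_apply] at this
  rw [AddMemClass.coe_add, AddSubmonoidClass.coe_finsetSum]
  simp only [AddSubmonoidClass.coe_finsetSum]
  exact this

theorem dressH_leftCoord (u : h) (m : n) (f : O.carrier) :
    dressH O hO u (O.leftCoord b m f) = O.leftCoord b m (dressH O hO u f) +
      (∑ j, dualBracket k (b.coord m) (b.coord j) u • dressH O hO (b j) f -
        ∑ j, b.coord m ⁅u, b j⁆ • O.leftCoord b j f) := by
  apply Subtype.ext
  have := dualDress_leftTr (dualBasisLie b) (toDouble (k := k) u).2 (dualBasisLie b m) f.1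
  simp only [coord_dualBasisLie, dualBracket_toDouble, dualBasisLie_apply] at this
  simp only [toDouble_apply] at this
  rw [AddMemClass.coe_add, AddSubgroupClass.coe_sub, AddSubmonoidClass.coe_finsetSum,
    AddSubmonoidClass.coe_finsetSum]
  exact this

end FunctionRing

end DualGroup
-- Derivations and multiderivations determined on generators
section Derivations

variable (k : Type*) [Field k] {B : Type*} [CommRing B] [Algebra k B]

/-- `D` is a `k`-linear derivation of `B`. -/
structure IsDeriv (D : B → B) : Prop where
  add : ∀ φ ψ, D (φ + ψ) = D φ + D ψ
  smul : ∀ (c : k) φ, D (c • φ) = c • D φ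
  mul : ∀ φ ψ, D (φ * ψ) = D φ * ψ + φ * D ψ

variable {k}

theorem IsDeriv.of_linear (D : B →ₗ[k] B) (h : ∀ φ ψ, D (φ * ψ) = D φ * ψ + φ * D ψ) :
    IsDeriv k (fun φ => D φ) := ⟨map_add D, map_smul D, h⟩

theorem IsDeriv.add' {D D' : B → B} (h : IsDeriv k D) (h' : IsDeriv k D') :
    IsDeriv k (fun φ => D φ + D' φ) :=
  ⟨fun φ ψ => by rw [h.add, h'.add]; ring, fun c φ => by rw [h.smul, h'.smul, smul_add],
    fun φ ψ => by rw [h.mul, h'.mul]; ring⟩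

theorem IsDeriv.sub {D D' : B → B} (h : IsDeriv k D) (h' : IsDeriv k D') :
    IsDeriv k (fun φ => D φ - D' φ) :=
  ⟨fun φ ψ => by rw [h.add, h'.add]; ring, fun c φ => by rw [h.smul, h'.smul, smul_sub],
    fun φ ψ => by rw [h.mul, h'.mul]; ring⟩

theorem IsDeriv.mul_left {D : B → B} (h : IsDeriv k D) (c : B) : IsDeriv k (fun φ => c * D φ) :=
  ⟨fun φ ψ => by rw [h.add]; ring, fun c φ => by rw [h.smul, mul_smul_comm],
    fun φ ψ => by rw [h.mul]; ring⟩

theorem IsDeriv.commutator {D D' : B → B} (h : IsDeriv k D) (h' : IsDeriv k D') :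
    IsDeriv k (fun φ => D (D' φ) - D' (D φ)) :=
  ⟨fun φ ψ => by rw [h.add, h'.add, h.add, h'.add]; ring,
    fun c φ => by rw [h.smul, h'.smul, h.smul, h'.smul, smul_sub],
    fun φ ψ => by rw [h.mul, h'.mul, h.add, h'.add, h.mul, h.mul, h'.mul, h'.mul]; ring⟩

variable {A A' : Type*} [CommRing A] [Algebra k A] [CommRing A'] [Algebra k A']

/-- A derivation of `B` is determined by its values on the images of `i` and `j`. -/
def DerivDetermined (i : A →ₐ[k] B) (j : A' →ₐ[k] B) : Prop :=
  ∀ D : B → B, IsDeriv k D → (∀ f, D (i f) = 0) → (∀ γ, D (j γ) = 0) → ∀ φ, D φ = 0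

variable {i : A →ₐ[k] B} {j : A' →ₐ[k] B}

theorem DerivDetermined.bilinear (hd : DerivDetermined i j) {E : B → B → B}
    (h1 : ∀ ψ, IsDeriv k (fun φ => E φ ψ)) (h2 : ∀ φ, IsDeriv k (E φ))
    (hii : ∀ f f', E (i f) (i f') = 0) (hij : ∀ f γ, E (i f) (j γ) = 0)
    (hji : ∀ γ f, E (j γ) (i f) = 0) (hjj : ∀ γ γ', E (j γ) (j γ') = 0) (φ ψ : B) : E φ ψ = 0 :=
  hd _ (h1 ψ) (fun f => hd _ (h2 _) (hii f) (hij f) ψ) (fun γ => hd _ (h2 _) (hji γ) (hjj γ) ψ) φ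

/-- Trilinear derivations with cyclic symmetry are determined by four families of values. -/
theorem DerivDetermined.trilinear (hd : DerivDetermined i j) {E : B → B → B → B}
    (h1 : ∀ ψ χ, IsDeriv k (fun φ => E φ ψ χ)) (h2 : ∀ φ χ, IsDeriv k (fun ψ => E φ ψ χ))
    (h3 : ∀ φ ψ, IsDeriv k (fun χ => E φ ψ χ))
    (hiii : ∀ f f' f'', E (i f) (i f') (i f'') = 0)
    (hiij : ∀ f f' γ, E (i f) (i f') (j γ) = 0 ∧ E (i f') (j γ) (i f) = 0 ∧
      E (j γ) (i f) (i f') = 0)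
    (hijj : ∀ f γ γ', E (i f) (j γ) (j γ') = 0 ∧ E (j γ) (j γ') (i f) = 0 ∧
      E (j γ') (i f) (j γ) = 0)
    (hjjj : ∀ γ γ' γ'', E (j γ) (j γ') (j γ'') = 0) (φ ψ χ : B) : E φ ψ χ = 0 := by
  refine hd _ (h1 ψ χ) (fun f => ?_) (fun γ => ?_) φ
  · exact hd.bilinear (E := E (i f)) (fun χ => h2 _ χ) (fun ψ => h3 _ ψ) (fun f' f'' => hiii f f' f'')
      (fun f' γ => (hiij f f' γ).1) (fun γ f' => (hiij f' f γ).2.1)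
      (fun γ γ' => (hijj f γ γ').1) ψ χ
  · exact hd.bilinear (E := E (j γ)) (fun χ => h2 _ χ) (fun ψ => h3 _ ψ)
      (fun f f' => (hiij f f' γ).2.2) (fun f γ' => (hijj f γ' γ).2.2)
      (fun γ' f => (hijj f γ γ').2.1) (fun γ' γ'' => hjjj γ γ' γ'') ψ χ

end Derivations

/-! ### Coefficients of $\rho$ in a basis -/

section Coefficients

variable {k : Type*} [Field k] {V A : Type*} [AddCommGroup V] [Module k V]
  [CommRing A] [Algebra k A] {m : Type*} [Fintype m]

theorem exists_coeff (e : Module.Basis m k V) (ρ : (V ⊗[k] V) ⊗[k] A) :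
    ∃ r : m → m → A, ρ = ∑ p, ∑ q, (e p ⊗ₜ[k] e q) ⊗ₜ[k] r p q := by
  induction ρ using TensorProduct.induction_on with
  | zero => exact ⟨0, by simp⟩
  | add s t hs ht =>
    obtain ⟨r, rfl⟩ := hs
    obtain ⟨r', rfl⟩ := ht
    exact ⟨r + r', by simp only [Pi.add_apply, TensorProduct.tmul_add, Finset.sum_add_distrib]⟩
  | tmul t l =>
    refine ⟨fun p q => TensorProduct.dualDistrib k V V (e.coord p ⊗ₜ e.coord q) t • l, ?_⟩
    conv_lhs => rw [tensor_eq_sum e t]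
    simp only [TensorProduct.sum_tmul, TensorProduct.tmul_smul, TensorProduct.smul_tmul']

/-- Half of the antisymmetrization of any coefficient matrix works. Antisymmetric coefficients allow
the later computations to exchange the two indices of $\rho$ at the cost of a sign. -/
theorem exists_antisymm_coeff [CharZero k] (e : Module.Basis m k V) (ρ : (V ⊗[k] V) ⊗[k] A)
    (hρ : (TensorProduct.comm k V V).toLinearMap.rTensor A ρ = -ρ) :
    ∃ r : m → m → A, (∀ p q, r q p = -r p q) ∧ ρ = ∑ p, ∑ q, (e p ⊗ₜ[k] e q) ⊗ₜ[k] r p q := by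
  obtain ⟨s, hs⟩ := exists_coeff e ρ
  have h2 : (2 : k) ≠ 0 := two_ne_zero
  refine ⟨fun p q => (2 : k)⁻¹ • (s p q - s q p), fun p q => ?_, ?_⟩
  · rw [← smul_neg, neg_sub]
  · have hc : ∑ p, ∑ q, (e p ⊗ₜ[k] e q) ⊗ₜ[k] s q p = -ρ := by
      rw [← hρ, hs, map_sum, Finset.sum_comm]
      simp only [map_sum, LinearMap.rTensor_tmul, LinearEquiv.coe_coe, TensorProduct.comm_tmul]
    have : (2 : k) • ρ = ∑ p, ∑ q, (e p ⊗ₜ[k] e q) ⊗ₜ[k] (s p q - s q p) := by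
      simp only [TensorProduct.tmul_sub, Finset.sum_sub_distrib, hc, ← hs]
      rw [sub_neg_eq_add, two_smul]
    simp only [TensorProduct.tmul_smul, ← Finset.smul_sum, ← this]
    rw [smul_smul, inv_mul_cancel₀ h2, one_smul]

end Coefficients

/-! ### Uniqueness and existence of the bracket -/

section Existence

variable {k : Type*} [Field k] [CharZero k]
  {g : Type*} [LieRing g] [LieAlgebra k g] [LieBialgebra k g] [FiniteDimensional k g]
  {h : Type*} [LieRing h] [LieAlgebra k h] [LieBialgebra k h] [FiniteDimensional k h]
  {B : Type*} [CommRing B] [Algebra k B] {n : Type*} [Fintype n]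
  {OH : FunctionRing k (DualLie k h)} {OG : FunctionRing k g}
  {i : OH.carrier →ₐ[k] B} {j : OG.carrier →ₐ[k] B} {ι : h →ₗ⁅k⁆ g} {b : Module.Basis n k h}
  {ρ : (g ⊗[k] g) ⊗[k] OH.carrier}

theorem rhoTerm_sum {m : Type*} [Fintype m] (x : m → g) (r : m → m → OH.carrier)
    (γ₁ γ₂ : OG.carrier) : rhoTerm OH OG i j γ₁ γ₂ (∑ p, ∑ q, (x p ⊗ₜ[k] x q) ⊗ₜ[k] r p q) =
      ∑ p, ∑ q, i (r p q) * (j (OG.left (x p) γ₁) * j (OG.left (x q) γ₂)) := by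
  simp only [map_sum, rhoTerm, LinearMap.comp_apply, TensorProduct.map_tmul, LinearMap.mul'_apply,
    AlgHom.toLinearMap_apply, LinearMap.flip_apply, map_mul]
  exact Finset.sum_congr rfl fun p _ => Finset.sum_congr rfl fun q _ => mul_comm _ _

theorem IsAntisymmBiderivation.left {br : B →ₗ[k] B →ₗ[k] B} (hb : IsAntisymmBiderivation br)
    (ψ : B) : IsDeriv k (fun φ => br φ ψ) :=
  IsDeriv.of_linear (br.flip ψ) (fun φ χ => hb.2.2 φ χ ψ)

theorem IsAntisymmBiderivation.right {br : B →ₗ[k] B →ₗ[k] B} (hb : IsAntisymmBiderivation br)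
    (φ : B) : IsDeriv k (fun ψ => br φ ψ) :=
  IsDeriv.of_linear (br φ) (hb.2.1 φ)

theorem IsDynamicalBracket.eq (hd : DerivDetermined i j) {br br' : B →ₗ[k] B →ₗ[k] B}
    (hb : IsDynamicalBracket OH OG i j ι b ρ br) (hb' : IsDynamicalBracket OH OG i j ι b ρ br') :
    br = br' := by
  ext φ ψ
  rw [← sub_eq_zero]
  refine hd.bilinear (E := fun φ ψ => br φ ψ - br' φ ψ)
    (fun ψ => (hb.biderivation.left ψ).sub (hb'.biderivation.left ψ))
    (fun φ => (hb.biderivation.right φ).sub (hb'.biderivation.right φ)) (fun f f' => ?_)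
    (fun f γ => ?_) (fun γ f => ?_) (fun γ γ' => ?_) φ ψ
  · rw [hb.base, hb'.base, sub_self]
  · rw [hb.mixed, hb'.mixed, sub_self]
  · rw [hb.biderivation.1, hb'.biderivation.1, hb.mixed, hb'.mixed, sub_self]
  · rw [hb.fiber, hb'.fiber, sub_self]

/-- Extensions to `B` of the translations and of the Poisson brackets of `O_{H^*}` and `O_G`. -/
structure ProductCalculus (i : OH.carrier →ₐ[k] B) (j : OG.carrier →ₐ[k] B) where
  transH : DualLie k h → Module.End k B
  transH_mul : ∀ ξ φ ψ, transH ξ (φ * ψ) = transH ξ φ * ψ + φ * transH ξ ψ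
  transH_left : ∀ ξ f, transH ξ (i f) = i (OH.left ξ f)
  transH_right : ∀ ξ γ, transH ξ (j γ) = 0
  transG : g → Module.End k B
  transG_mul : ∀ x φ ψ, transG x (φ * ψ) = transG x φ * ψ + φ * transG x ψ
  transG_left : ∀ x f, transG x (i f) = 0
  transG_right : ∀ x γ, transG x (j γ) = j (OG.left x γ)
  brH : B →ₗ[k] B →ₗ[k] B
  brH_mul_left : ∀ φ ψ χ, brH (φ * ψ) χ = brH φ χ * ψ + φ * brH ψ χ
  brH_mul_right : ∀ φ ψ χ, brH φ (ψ * χ) = brH φ ψ * χ + ψ * brH φ χ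
  brH_left : ∀ f f', brH (i f) (i f') = i (OH.bracket f f')
  brH_right : ∀ φ γ, brH φ (j γ) = 0 ∧ brH (j γ) φ = 0
  brG : B →ₗ[k] B →ₗ[k] B
  brG_mul_left : ∀ φ ψ χ, brG (φ * ψ) χ = brG φ χ * ψ + φ * brG ψ χ
  brG_mul_right : ∀ φ ψ χ, brG φ (ψ * χ) = brG φ ψ * χ + ψ * brG φ χ
  brG_right : ∀ γ γ', brG (j γ) (j γ') = j (OG.bracket γ γ')
  brG_left : ∀ φ f, brG φ (i f) = 0 ∧ brG (i f) φ = 0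

theorem exists_isDynamicalBracket (hd : DerivDetermined i j) (P : ProductCalculus i j)
    (hρ : IsBivector k g ρ) : ∃ br, IsDynamicalBracket OH OG i j ι b ρ br := by
  let e := Module.finBasis k g
  obtain ⟨r, hr, rfl⟩ := exists_antisymm_coeff e ρ hρ
  let M : Module.End k B → Module.End k B → B →ₗ[k] B →ₗ[k] B := (LinearMap.mul k B).compl₁₂
  let X : n → Module.End k B := fun m => P.transH (DualLie.of k (b.coord m))
  let Y : n → Module.End k B := fun m => P.transG (ι (b m))
  -- Each summand is a biderivation. The mixed summand is a wedge, so that it gives the prescribed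
  -- bracket of a function on $H^*$ with one on $G$, and its opposite in the other order.
  let br : B →ₗ[k] B →ₗ[k] B := -P.brH + ∑ m, (M (X m) (Y m) - M (Y m) (X m)) + P.brG +
    ∑ p, ∑ q, M (LinearMap.mulLeft k (i (r p q)) ∘ₗ P.transG (e p)) (P.transG (e q))
  have hbr : ∀ φ ψ, br φ ψ = -P.brH φ ψ + ∑ m, (X m φ * Y m ψ - Y m φ * X m ψ) + P.brG φ ψ +
      ∑ p, ∑ q, i (r p q) * P.transG (e p) φ * P.transG (e q) ψ := by
    intro φ ψ
    simp only [br, M, LinearMap.add_apply, LinearMap.neg_apply, LinearMap.sum_apply,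
      LinearMap.sub_apply, LinearMap.compl₁₂_apply, LinearMap.mul_apply', LinearMap.comp_apply,
      LinearMap.mulLeft_apply]
  have h1 : ∀ φ ψ χ, br φ (ψ * χ) = br φ ψ * χ + ψ * br φ χ := by
    intro φ ψ χ
    simp only [hbr, P.brH_mul_right, P.brG_mul_right, X, Y, P.transH_mul, P.transG_mul, mul_add,
      add_mul, Finset.sum_mul, Finset.mul_sum, Finset.sum_add_distrib, Finset.sum_sub_distrib,
      sub_mul, mul_sub, neg_mul, mul_neg]
    ring_nf
  have h2 : ∀ φ ψ χ, br (φ * ψ) χ = br φ χ * ψ + φ * br ψ χ := by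
    intro φ ψ χ
    simp only [hbr, P.brH_mul_left, P.brG_mul_left, X, Y, P.transH_mul, P.transG_mul, mul_add,
      add_mul, Finset.sum_mul, Finset.mul_sum, Finset.sum_add_distrib, Finset.sum_sub_distrib,
      sub_mul, mul_sub, neg_mul, mul_neg]
    ring_nf
  have hii : ∀ f f', br (i f) (i f') = -i (OH.bracket f f') := by
    intro f f'
    simp [hbr, X, Y, P.brH_left, P.transG_left, (P.brG_left _ _).1]
  have hij : ∀ f γ, br (i f) (j γ) =
      ∑ m, i (OH.left (DualLie.of k (b.coord m)) f) * j (OG.left (ι (b m)) γ) := by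
    intro f γ
    simp [hbr, X, Y, (P.brH_right _ _).1, P.transG_left, P.transG_right, P.transH_left,
      (P.brG_left _ _).2]
  have hji : ∀ γ f, br (j γ) (i f) =
      -∑ m, i (OH.left (DualLie.of k (b.coord m)) f) * j (OG.left (ι (b m)) γ) := by
    intro γ f
    simp [hbr, X, Y, (P.brH_right _ _).2, P.transG_left, P.transG_right, P.transH_left,
      P.transH_right, (P.brG_left _ _).1, mul_comm]
  have hjj : ∀ γ γ', br (j γ) (j γ') = j (OG.bracket γ γ') +
      ∑ p, ∑ q, i (r p q) * (j (OG.left (e p) γ) * j (OG.left (e q) γ')) := by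
    intro γ γ'
    simp [hbr, X, Y, (P.brH_right _ _).2, P.transG_right, P.transH_right, P.brG_right, mul_assoc]
  refine ⟨br, ⟨?_, h1, h2⟩, hii, hij, fun γ γ' => by rw [hjj, rhoTerm_sum]⟩
  -- The calculus does not include antisymmetry of `brH` and `brG`, so antisymmetry of the sum is
  -- verified on generators.
  intro φ ψ
  rw [eq_neg_iff_add_eq_zero]
  refine hd.bilinear (E := fun φ ψ => br φ ψ + br ψ φ)
    (fun ψ => (IsDeriv.of_linear (br.flip ψ) (fun φ χ => h2 φ χ ψ)).add'
      (IsDeriv.of_linear (br ψ) (h1 ψ)))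
    (fun φ => (IsDeriv.of_linear (br φ) (h1 φ)).add'
      (IsDeriv.of_linear (br.flip φ) (fun ψ χ => h2 ψ χ φ)))
    (fun f f' => ?_) (fun f γ => ?_) (fun γ f => ?_) (fun γ γ' => ?_) φ ψ
  · rw [hii, hii, OH.bracket_swap, map_neg]; ring
  · rw [hij, hji]; ring
  · rw [hij, hji]; ring
  · have : ∑ p, ∑ q, i (r p q) * (j (OG.left (e p) γ') * j (OG.left (e q) γ)) =
        -∑ p, ∑ q, i (r p q) * (j (OG.left (e p) γ) * j (OG.left (e q) γ')) := by
      rw [Finset.sum_comm]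
      simp only [← Finset.sum_neg_distrib]
      refine Finset.sum_congr rfl fun p _ => Finset.sum_congr rfl fun q _ => ?_
      rw [hr p q, map_neg]
      ring
    rw [hjj, hjj, this, OG.bracket_swap, map_neg]
    ring

end Existence

/-! ### Bivectors and trivectors acting through derivations -/

section Generalities

variable {k : Type*} [Field k] {g : Type*} [LieRing g] [LieAlgebra k g] [LieBialgebra k g]
  {B : Type*} [CommRing B] [Algebra k B]

theorem IsDeriv.zero : IsDeriv k (fun _ : B => (0 : B)) :=
  ⟨by simp, by simp, by simp⟩

theorem biAct_deriv_left {θ : g →ₗ[k] Module.End k B}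
    (hθ : ∀ x φ ψ, θ x (φ * ψ) = θ x φ * ψ + φ * θ x ψ) (t : g ⊗[k] g) (ψ : B) :
    IsDeriv k (fun φ => biAct θ φ ψ t) := by
  induction t using TensorProduct.induction_on with
  | zero => simpa only [map_zero] using IsDeriv.zero
  | add s t hs ht => simpa only [map_add] using hs.add' ht
  | tmul x y =>
    simpa only [biAct_tmul, mul_comm] using (IsDeriv.of_linear (θ x) (hθ x)).mul_left (θ y ψ)

theorem biAct_deriv_right {θ : g →ₗ[k] Module.End k B}
    (hθ : ∀ x φ ψ, θ x (φ * ψ) = θ x φ * ψ + φ * θ x ψ) (t : g ⊗[k] g) (φ : B) :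
    IsDeriv k (fun ψ => biAct θ φ ψ t) := by
  simpa only [biAct_comm] using biAct_deriv_left hθ (TensorProduct.comm k g g t) φ

theorem triAction_deriv [CharZero k] {θ : g →ₗ[k] Module.End k B}
    (hθ : ∀ x φ ψ, θ x (φ * ψ) = θ x φ * ψ + φ * θ x ψ) (Z : g ⊗[k] (g ⊗[k] g)) (φ ψ χ : B) :
    IsDeriv k (fun φ => triAction θ φ ψ χ Z) ∧ IsDeriv k (fun ψ => triAction θ φ ψ χ Z) ∧
      IsDeriv k (fun χ => triAction θ φ ψ χ Z) := by
  induction Z using TensorProduct.induction_on with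
  | zero => simp only [map_zero]; exact ⟨IsDeriv.zero, IsDeriv.zero, IsDeriv.zero⟩
  | add s t hs ht =>
    simp only [map_add]
    exact ⟨hs.1.add' ht.1, hs.2.1.add' ht.2.1, hs.2.2.add' ht.2.2⟩
  | tmul x t =>
    induction t using TensorProduct.induction_on with
    | zero =>
      simp only [TensorProduct.tmul_zero, map_zero]
      exact ⟨IsDeriv.zero, IsDeriv.zero, IsDeriv.zero⟩
    | add s t hs ht =>
      simp only [TensorProduct.tmul_add, map_add]
      exact ⟨hs.1.add' ht.1, hs.2.1.add' ht.2.1, hs.2.2.add' ht.2.2⟩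
    | tmul y z =>
      simp only [triAction_tmul]
      have h := fun x => IsDeriv.of_linear (θ x) (hθ x)
      refine ⟨?_, ?_, ?_⟩
      · simpa only [mul_comm] using (h x).mul_left (θ y ψ * θ z χ)
      · have := (h y).mul_left (θ x φ * θ z χ)
        convert this using 2
        ring
      · have := (h z).mul_left (θ x φ * θ y ψ)
        convert this using 2
        ring

theorem triAction_eq_zero [CharZero k] {θ : g →ₗ[k] Module.End k B} (Z : g ⊗[k] (g ⊗[k] g))
    {φ ψ χ : B} (hz : (∀ x, θ x φ = 0) ∨ (∀ x, θ x ψ = 0) ∨ (∀ x, θ x χ = 0)) :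
    triAction θ φ ψ χ Z = 0 := by
  induction Z using TensorProduct.induction_on with
  | zero => simp
  | add s t hs ht => rw [map_add, hs, ht, add_zero]
  | tmul x t =>
    induction t using TensorProduct.induction_on with
    | zero => simp
    | add s t hs ht => rw [TensorProduct.tmul_add, map_add, hs, ht, add_zero]
    | tmul y z =>
      rw [triAction_tmul]
      rcases hz with hz | hz | hz <;> simp [hz]

theorem triAction_map [CharZero k] {A : Type*} [CommRing A] [Algebra k A] (j : A →ₐ[k] B)
    {θ : g →ₗ[k] Module.End k B} {θ' : g →ₗ[k] Module.End k A}
    (hθ : ∀ x γ, θ x (j γ) = j (θ' x γ)) (Z : g ⊗[k] (g ⊗[k] g)) (γ₁ γ₂ γ₃ : A) :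
    triAction θ (j γ₁) (j γ₂) (j γ₃) Z = j (triAction θ' γ₁ γ₂ γ₃ Z) := by
  induction Z using TensorProduct.induction_on with
  | zero => simp
  | add s t hs ht => simp only [map_add, hs, ht]
  | tmul x t =>
    induction t using TensorProduct.induction_on with
    | zero => simp
    | add s t hs ht => simp only [TensorProduct.tmul_add, map_add, hs, ht]
    | tmul y z => simp only [triAction_tmul, hθ, map_mul]

theorem triAction_cyc [CharZero k] {θ : g →ₗ[k] Module.End k B} (Z : g ⊗[k] (g ⊗[k] g))
    (φ ψ χ : B) : triAction θ φ ψ χ (cyc k g Z) = triAction θ χ φ ψ Z := by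
  induction Z using TensorProduct.induction_on with
  | zero => simp
  | add s t hs ht => simp only [map_add, hs, ht]
  | tmul x t =>
    induction t using TensorProduct.induction_on with
    | zero => simp
    | add s t hs ht => simp only [TensorProduct.tmul_add, map_add, hs, ht]
    | tmul y z =>
      simp only [triAction_tmul, cyc_tmul]
      ring

theorem triAction_cycAlt [CharZero k] {θ : g →ₗ[k] Module.End k B} (Z : g ⊗[k] (g ⊗[k] g))
    (φ ψ χ : B) : triAction θ φ ψ χ (cycAlt k g Z) =
      triAction θ φ ψ χ Z + triAction θ χ φ ψ Z + triAction θ ψ χ φ Z := by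
  simp only [cycAlt, LinearMap.add_apply, LinearMap.comp_apply, map_add, triAction_cyc,
    LinearMap.id_apply]

theorem triAction_assoc [CharZero k] {θ : g →ₗ[k] Module.End k B} (t : g ⊗[k] g) (z : g)
    (φ ψ χ : B) : triAction θ φ ψ χ (TensorProduct.assoc k g g g (t ⊗ₜ z)) =
      biAct θ φ ψ t * θ z χ := by
  induction t using TensorProduct.induction_on with
  | zero => simp
  | add s t hs ht => simp only [TensorProduct.add_tmul, map_add, hs, ht, add_mul]
  | tmul x y => simp [mul_assoc]

theorem biAct_eq_zero {θ : g →ₗ[k] Module.End k B} (t : g ⊗[k] g) {φ ψ : B}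
    (hz : (∀ x, θ x φ = 0) ∨ (∀ x, θ x ψ = 0)) : biAct θ φ ψ t = 0 := by
  induction t using TensorProduct.induction_on with
  | zero => simp
  | add s t hs ht => rw [map_add, hs, ht, add_zero]
  | tmul x y =>
    rw [biAct_tmul]
    rcases hz with hz | hz <;> simp [hz]

theorem biAct_map {A : Type*} [CommRing A] [Algebra k A] (j : A →ₐ[k] B)
    {θ : g →ₗ[k] Module.End k B} {θ' : g →ₗ[k] Module.End k A}
    (hθ : ∀ x γ, θ x (j γ) = j (θ' x γ)) (t : g ⊗[k] g) (γ₁ γ₂ : A) :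
    biAct θ (j γ₁) (j γ₂) t = j (biAct θ' γ₁ γ₂ t) := by
  induction t using TensorProduct.induction_on with
  | zero => simp
  | add s t hs ht => simp only [map_add, hs, ht]
  | tmul x y => simp only [biAct_tmul, hθ, map_mul]

end Generalities

/-! ### The Jacobiator with at least one function on $H^*$ -/

section QuasiPoisson

variable {k : Type*} [Field k] [CharZero k]
  {g : Type*} [LieRing g] [LieAlgebra k g] [LieBialgebra k g] [FiniteDimensional k g]
  {h : Type*} [LieRing h] [LieAlgebra k h] [LieBialgebra k h] [FiniteDimensional k h]
  {B : Type*} [CommRing B] [Algebra k B] {n : Type*} [Fintype n]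
  {OH : FunctionRing k (DualLie k h)} {OG : FunctionRing k g}
  {i : OH.carrier →ₐ[k] B} {j : OG.carrier →ₐ[k] B} {ι : h →ₗ⁅k⁆ g} {b : Module.Basis n k h}
  {br : B →ₗ[k] B →ₗ[k] B} {hO : OH.AdjointExtends}

theorem leftG_lie (x y : g) (γ : OG.carrier) :
    j (OG.left ⁅x, y⁆ γ) = j (OG.left x (OG.left y γ)) - j (OG.left y (OG.left x γ)) := by
  rw [OG.left_lie, map_sub]

theorem leftG_coord (u : h) (γ : OG.carrier) : j (OG.left (ι u) γ) =
    ∑ m, algebraMap k B (b.coord m u) * j (OG.left (ι (b m)) γ) := by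
  have h := map_eq_sum b (OG.left ∘ₗ (ι : h →ₗ[k] g)) u γ
  simp only [LinearMap.comp_apply, LieHom.coe_toLinearMap] at h
  rw [h, map_sum]
  simp only [Algebra.smul_def, map_mul, AlgHom.commutes]

theorem leftG_bracket_coord (hδ : ∀ u : h, cobr k g (ι u) =
      TensorProduct.map (ι : h →ₗ[k] g) (ι : h →ₗ[k] g) (cobr k h u)) (u : h) (γ γ' : OG.carrier) :
    j (OG.left (ι u) (OG.bracket γ γ')) = j (OG.bracket (OG.left (ι u) γ) γ') +
      j (OG.bracket γ (OG.left (ι u) γ')) -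
      ∑ p, ∑ q, algebraMap k B (dualBracket k (b.coord p) (b.coord q) u) *
        (j (OG.left (ι (b p)) γ) * j (OG.left (ι (b q)) γ')) := by
  rw [OG.left_bracket, hδ, cobr_eq_sum b]
  simp only [map_sum, map_smul, TensorProduct.map_tmul, biAct_tmul, LieHom.coe_toLinearMap, map_sub,
    map_add, Algebra.smul_def, map_mul, AlgHom.commutes]

theorem leftCoord_bracket_map (m : n) (f f' : OH.carrier) :
    i (OH.leftCoord b m (OH.bracket f f')) = i (OH.bracket (OH.leftCoord b m f) f') +
      i (OH.bracket f (OH.leftCoord b m f')) -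
      ∑ p, ∑ q, algebraMap k B (b.coord m ⁅b p, b q⁆) *
        (i (OH.leftCoord b p f) * i (OH.leftCoord b q f')) := by
  rw [OH.leftCoord_bracket]
  simp only [map_sum, map_sub, map_add, Algebra.smul_def, map_mul, AlgHom.commutes]

theorem leftCoord_comm_map (p q : n) (f : OH.carrier) :
    i (OH.leftCoord b p (OH.leftCoord b q f)) - i (OH.leftCoord b q (OH.leftCoord b p f)) =
      ∑ m, algebraMap k B (dualBracket k (b.coord p) (b.coord q) (b m)) *
        i (OH.leftCoord b m f) := by
  rw [← map_sub, OH.leftCoord_comm]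
  simp only [map_sum, Algebra.smul_def, map_mul, AlgHom.commutes]

namespace IsDynamicalBracket

variable {ρ : (g ⊗[k] g) ⊗[k] OH.carrier}

theorem mul_left (hb : IsDynamicalBracket OH OG i j ι b ρ br) (φ ψ χ : B) :
    br (φ * ψ) χ = br φ χ * ψ + φ * br ψ χ := hb.biderivation.2.2 φ ψ χ

theorem mixed' (hb : IsDynamicalBracket OH OG i j ι b ρ br) (f : OH.carrier) (γ : OG.carrier) :
    br (i f) (j γ) = ∑ m, i (OH.leftCoord b m f) * j (OG.left (ι (b m)) γ) := hb.mixed f γ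

theorem mixed_symm (hb : IsDynamicalBracket OH OG i j ι b ρ br) (f : OH.carrier)
    (γ : OG.carrier) :
    br (j γ) (i f) = -∑ m, i (OH.leftCoord b m f) * j (OG.left (ι (b m)) γ) := by
  rw [hb.biderivation.1, hb.mixed']

theorem jacobi_base (hb : IsDynamicalBracket OH OG i j ι b ρ br) (f₁ f₂ f₃ : OH.carrier) :
    br (br (i f₁) (i f₂)) (i f₃) + br (br (i f₂) (i f₃)) (i f₁) +
      br (br (i f₃) (i f₁)) (i f₂) = 0 := by
  simp only [hb.base, map_neg, LinearMap.neg_apply, neg_neg]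
  rw [← map_add, ← map_add, OH.bracket_jacobi, map_zero]

/-- Only left translations of `γ` occur, so $\rho$ plays no role. Translating $\{f_1,f_2\}_{H^*}$
brings in the cobracket of $\mathfrak h^*$; the double translations of `γ` bring in commutators in
$\mathfrak h$. They cancel because the two are dual and `ι` preserves brackets. -/
theorem jacobi_base_base_fiber (hb : IsDynamicalBracket OH OG i j ι b ρ br)
    (f₁ f₂ : OH.carrier) (γ : OG.carrier) :
    br (br (i f₁) (i f₂)) (j γ) + br (br (i f₂) (j γ)) (i f₁) +
      br (br (j γ) (i f₁)) (i f₂) = 0 := by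
  let c : n → n → n → B := fun p q m => algebraMap k B (b.coord m ⁅b p, b q⁆)
  let X : n → OH.carrier → B := fun m f => i (OH.leftCoord b m f)
  let Y : n → OG.carrier → B := fun m γ => j (OG.left (ι (b m)) γ)
  have hY : ∀ p q, Y p (OG.left (ι (b q)) γ) - Y q (OG.left (ι (b p)) γ) =
      ∑ m, c p q m * Y m γ := by
    intro p q
    simp only [Y]
    rw [← leftG_lie, ← LieHom.map_lie, leftG_coord (b := b)]
  have t : ∀ f f', br (br (i f) (j γ)) (i f') =
      -∑ m, i (OH.bracket (OH.leftCoord b m f) f') * Y m γ -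
      ∑ m, ∑ l, X m f * X l f' * Y l (OG.left (ι (b m)) γ) := by
    intro f f'
    rw [hb.mixed', map_sum, LinearMap.sum_apply, ← Finset.sum_neg_distrib,
      ← Finset.sum_sub_distrib]
    refine Finset.sum_congr rfl fun m _ => ?_
    rw [hb.mul_left, hb.base, hb.mixed_symm, mul_neg, Finset.mul_sum]
    simp only [X, Y, mul_assoc]
    ring
  have t1 : br (br (i f₁) (i f₂)) (j γ) = -∑ m, X m (OH.bracket f₁ f₂) * Y m γ := by
    rw [hb.base, map_neg, LinearMap.neg_apply, hb.mixed']
  have t3 : br (br (j γ) (i f₁)) (i f₂) = -br (br (i f₁) (j γ)) (i f₂) := by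
    rw [hb.biderivation.1 (j γ), map_neg, LinearMap.neg_apply]
  -- The last sum is the defect of $\mathbf L_{\varepsilon^m}$ from being a derivation of
  -- $\{,\}_{H^*}$, with the structure constants of $\mathfrak h$ as coefficients.
  have a1 : ∑ m, X m (OH.bracket f₁ f₂) * Y m γ =
      ∑ m, i (OH.bracket (OH.leftCoord b m f₁) f₂) * Y m γ -
      ∑ m, i (OH.bracket (OH.leftCoord b m f₂) f₁) * Y m γ -
      ∑ p, ∑ q, X p f₁ * X q f₂ * ∑ m, c p q m * Y m γ := by
    have : ∑ p, ∑ q, X p f₁ * X q f₂ * ∑ m, c p q m * Y m γ =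
        ∑ m, (∑ p, ∑ q, c p q m * (X p f₁ * X q f₂)) * Y m γ := by
      simp only [Finset.mul_sum, Finset.sum_mul]
      rw [Finset.sum_comm_cycle]
      refine Finset.sum_congr rfl fun m _ => Finset.sum_congr rfl fun p _ =>
        Finset.sum_congr rfl fun q _ => ?_
      ring
    rw [this, ← Finset.sum_sub_distrib, ← Finset.sum_sub_distrib]
    refine Finset.sum_congr rfl fun m _ => ?_
    simp only [X, c]
    rw [leftCoord_bracket_map, OH.bracket_swap f₁, map_neg]
    ring
  have a2 : ∑ m, ∑ l, X m f₂ * X l f₁ * Y l (OG.left (ι (b m)) γ) =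
      ∑ m, ∑ l, X m f₁ * X l f₂ * Y m (OG.left (ι (b l)) γ) := by
    rw [Finset.sum_comm]
    refine Finset.sum_congr rfl fun m _ => Finset.sum_congr rfl fun p _ => ?_
    ring
  have a3 : ∑ p, ∑ q, X p f₁ * X q f₂ * ∑ m, c p q m * Y m γ =
      ∑ m, ∑ l, X m f₁ * X l f₂ * Y m (OG.left (ι (b l)) γ) -
      ∑ m, ∑ l, X m f₁ * X l f₂ * Y l (OG.left (ι (b m)) γ) := by
    simp only [← hY, mul_sub, Finset.sum_sub_distrib]
  rw [t1, t3, t, t, a1, a2, a3]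
  ring

variable {m : Type*} [Fintype m] {e : Module.Basis m k g} {r : m → m → OH.carrier}

theorem fiber_sum (hb : IsDynamicalBracket OH OG i j ι b ρ br)
    (hρ : ρ = ∑ p, ∑ q, (e p ⊗ₜ[k] e q) ⊗ₜ[k] r p q) (γ γ' : OG.carrier) :
    br (j γ) (j γ') = j (OG.bracket γ γ') +
      ∑ p, ∑ q, i (r p q) * (j (OG.left (e p) γ) * j (OG.left (e q) γ')) := by
  rw [hb.fiber, hρ, rhoTerm_sum]

theorem sum_antisymm (hr : ∀ p q, r q p = -r p q) (F : m → m → B) :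
    ∑ p, ∑ q, i (r p q) * F p q = -∑ p, ∑ q, i (r p q) * F q p := by
  rw [Finset.sum_comm, ← Finset.sum_neg_distrib]
  refine Finset.sum_congr rfl fun p _ => ?_
  rw [← Finset.sum_neg_distrib]
  refine Finset.sum_congr rfl fun q _ => ?_
  rw [hr p q, map_neg, neg_mul]

end IsDynamicalBracket

theorem equivariant_sum {m : Type*} [Fintype m] {e : Module.Basis m k g}
    {r : m → m → OH.carrier} {ρ : (g ⊗[k] g) ⊗[k] OH.carrier}
    (hρ : ρ = ∑ p, ∑ q, (e p ⊗ₜ[k] e q) ⊗ₜ[k] r p q)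
    (u : h) (he : (dressH OH hO u).lTensor (g ⊗[k] g) ρ +
      (LieModule.toEnd k g (g ⊗[k] g) (ι u)).rTensor OH.carrier ρ = 0) (γ γ' : OG.carrier) :
    ∑ p, ∑ q, i (dressH OH hO u (r p q)) * (j (OG.left (e p) γ) * j (OG.left (e q) γ')) +
      ∑ p, ∑ q, i (r p q) * (j (OG.left ⁅ι u, e p⁆ γ) * j (OG.left (e q) γ') +
        j (OG.left (e p) γ) * j (OG.left ⁅ι u, e q⁆ γ')) = 0 := by
  have h := congrArg (rhoTerm OH OG i j γ γ') he
  rw [hρ] at h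
  simp only [map_add, map_sum, LinearMap.lTensor_tmul, LinearMap.rTensor_tmul,
    LieModule.toEnd_apply_apply, TensorProduct.LieModule.lie_tmul_right, TensorProduct.add_tmul,
    rhoTerm, LinearMap.comp_apply, TensorProduct.map_tmul, LinearMap.mul'_apply,
    AlgHom.toLinearMap_apply, LinearMap.flip_apply, map_mul, map_zero] at h
  rw [← h]
  congr 1
  · exact Finset.sum_congr rfl fun p _ => Finset.sum_congr rfl fun q _ => mul_comm _ _
  · exact Finset.sum_congr rfl fun p _ => Finset.sum_congr rfl fun q _ => by ring

namespace IsDynamicalBracket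

variable {ρ : (g ⊗[k] g) ⊗[k] OH.carrier}
variable {m : Type*} [Fintype m] {e : Module.Basis m k g} {r : m → m → OH.carrier}

/-- Without $\rho$, the commutators of translations on $H^*$ (bracket of $\mathfrak h^*$) cancel
against the cobracket term of translations by $\mathfrak h$ on $G$, as $\delta$ restricts to
$\mathfrak h$: `a1` and `a2`. The terms with $\rho$ form $\sum_m\mathbf L_{\varepsilon^m}(f)$ times
the equivariance equation for $e_m$: `a5`. -/
theorem jacobi_base_fiber_fiber (hb : IsDynamicalBracket OH OG i j ι b ρ br)
    (hδ : ∀ u : h, cobr k g (ι u) =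
      TensorProduct.map (ι : h →ₗ[k] g) (ι : h →ₗ[k] g) (cobr k h u))
    (hr : ∀ p q, r q p = -r p q) (hρ : ρ = ∑ p, ∑ q, (e p ⊗ₜ[k] e q) ⊗ₜ[k] r p q)
    (he : ∀ u : h, (dressH OH hO u).lTensor (g ⊗[k] g) ρ +
      (LieModule.toEnd k g (g ⊗[k] g) (ι u)).rTensor OH.carrier ρ = 0)
    (f : OH.carrier) (γ₁ γ₂ : OG.carrier) :
    br (br (i f) (j γ₁)) (j γ₂) + br (br (j γ₁) (j γ₂)) (i f) +
      br (br (j γ₂) (i f)) (j γ₁) = 0 := by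
  let d : n → n → n → B := fun p q m =>
    algebraMap k B (dualBracket k (b.coord p) (b.coord q) (b m))
  let X : n → OH.carrier → B := fun m f => i (OH.leftCoord b m f)
  let Y : n → OG.carrier → B := fun m γ => j (OG.left (ι (b m)) γ)
  let L : m → OG.carrier → B := fun p γ => j (OG.left (e p) γ)
  have hd : ∀ p q m, d q p m = -d p q m := by
    intro p q m
    simp only [d]
    rw [dualBracket_swap, map_neg]
  have t : ∀ γ γ', br (br (i f) (j γ)) (j γ') =
      ∑ m, ∑ l, X l (OH.leftCoord b m f) * Y l γ' * Y m γ +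
      ∑ m, X m f * j (OG.bracket (OG.left (ι (b m)) γ) γ') +
      ∑ m, X m f * ∑ p, ∑ q, i (r p q) * (L p (OG.left (ι (b m)) γ) * L q γ') := by
    intro γ γ'
    rw [hb.mixed', map_sum, LinearMap.sum_apply]
    simp only [← Finset.sum_add_distrib]
    refine Finset.sum_congr rfl fun m _ => ?_
    rw [hb.mul_left, hb.mixed', hb.fiber_sum hρ, Finset.sum_mul]
    simp only [X, Y, L]
    ring
  have t2 : br (br (j γ₁) (j γ₂)) (i f) =
      -∑ m, X m f * Y m (OG.bracket γ₁ γ₂) +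
      (-∑ p, ∑ q, i (OH.bracket (r p q) f) * (L p γ₁ * L q γ₂) -
      ∑ m, X m f * ∑ p, ∑ q, i (r p q) *
        (Y m (OG.left (e p) γ₁) * L q γ₂ + L p γ₁ * Y m (OG.left (e q) γ₂))) := by
    rw [hb.fiber_sum hρ, map_add, LinearMap.add_apply, hb.mixed_symm]
    congr 1
    have : ∑ m, X m f * ∑ p, ∑ q, i (r p q) *
        (Y m (OG.left (e p) γ₁) * L q γ₂ + L p γ₁ * Y m (OG.left (e q) γ₂)) =
        ∑ p, ∑ q, i (r p q) * ((∑ m, X m f * Y m (OG.left (e p) γ₁)) * L q γ₂ +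
          L p γ₁ * ∑ m, X m f * Y m (OG.left (e q) γ₂)) := by
      simp only [Finset.mul_sum, Finset.sum_mul, ← Finset.sum_add_distrib]
      rw [Finset.sum_comm]
      refine Finset.sum_congr rfl fun p _ => ?_
      rw [Finset.sum_comm]
      refine Finset.sum_congr rfl fun q _ => Finset.sum_congr rfl fun m _ => ?_
      ring
    rw [this]
    simp only [map_sum, LinearMap.sum_apply, ← Finset.sum_sub_distrib, ← Finset.sum_neg_distrib]
    refine Finset.sum_congr rfl fun p _ => Finset.sum_congr rfl fun q _ => ?_
    rw [hb.mul_left, hb.mul_left, hb.base, hb.mixed_symm, hb.mixed_symm]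
    simp only [X, Y, L]
    ring
  have t3 : br (br (j γ₂) (i f)) (j γ₁) = -br (br (i f) (j γ₂)) (j γ₁) := by
    rw [hb.biderivation.1 (j γ₂), map_neg, LinearMap.neg_apply]
  have a1 : ∑ m, ∑ l, X l (OH.leftCoord b m f) * Y l γ₂ * Y m γ₁ -
      ∑ m, ∑ l, X l (OH.leftCoord b m f) * Y l γ₁ * Y m γ₂ =
      -∑ m, X m f * ∑ p, ∑ q, d p q m * (Y p γ₁ * Y q γ₂) := by
    have : ∑ m, ∑ l, X l (OH.leftCoord b m f) * Y l γ₁ * Y m γ₂ =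
        ∑ m, ∑ l, X m (OH.leftCoord b l f) * Y m γ₁ * Y l γ₂ := Finset.sum_comm
    rw [this, ← Finset.sum_sub_distrib]
    have h2 : ∑ m, X m f * ∑ p, ∑ q, d p q m * (Y p γ₁ * Y q γ₂) =
        ∑ p, ∑ q, (∑ m, d p q m * X m f) * (Y p γ₁ * Y q γ₂) := by
      simp only [Finset.mul_sum, Finset.sum_mul]
      rw [Finset.sum_comm]
      refine Finset.sum_congr rfl fun p _ => ?_
      rw [Finset.sum_comm]
      refine Finset.sum_congr rfl fun q _ => Finset.sum_congr rfl fun m _ => ?_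
      ring
    rw [h2, ← Finset.sum_neg_distrib]
    refine Finset.sum_congr rfl fun p _ => ?_
    rw [← Finset.sum_sub_distrib, ← Finset.sum_neg_distrib]
    refine Finset.sum_congr rfl fun q _ => ?_
    have := leftCoord_comm_map (i := i) (b := b) p q f
    simp only [d, X]
    rw [← this]
    ring
  have a2 : ∑ m, X m f * j (OG.bracket (OG.left (ι (b m)) γ₁) γ₂) -
      ∑ m, X m f * j (OG.bracket (OG.left (ι (b m)) γ₂) γ₁) - ∑ m, X m f * Y m (OG.bracket γ₁ γ₂) =
      ∑ m, X m f * ∑ p, ∑ q, d p q m * (Y p γ₁ * Y q γ₂) := by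
    simp only [← Finset.sum_sub_distrib]
    refine Finset.sum_congr rfl fun m _ => ?_
    simp only [Y, d]
    rw [leftG_bracket_coord (b := b) hδ, OG.bracket_swap γ₁, map_neg]
    ring
  have a3 : ∀ m, ∑ p, ∑ q, i (r p q) * (L p (OG.left (ι (b m)) γ₂) * L q γ₁) =
      -∑ p, ∑ q, i (r p q) * (L p γ₁ * L q (OG.left (ι (b m)) γ₂)) := by
    intro m
    rw [sum_antisymm hr]
    simp only [mul_comm (L _ γ₁)]
  -- Expanding the bracket with dressing on the first argument leaves `f` only under left
  -- translations, as in the remaining terms.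
  have a4 : ∑ p, ∑ q, i (OH.bracket (r p q) f) * (L p γ₁ * L q γ₂) =
      ∑ m, X m f * ∑ p, ∑ q, i (dressH OH hO (b m) (r p q)) * (L p γ₁ * L q γ₂) := by
    simp only [Finset.mul_sum]
    symm
    rw [Finset.sum_comm]
    refine Finset.sum_congr rfl fun p _ => ?_
    rw [Finset.sum_comm]
    refine Finset.sum_congr rfl fun q _ => ?_
    rw [OH.bracket_eq_dressH b hO, map_sum, Finset.sum_mul]
    refine Finset.sum_congr rfl fun m _ => ?_
    rw [map_mul]
    ring
  have a5 : ∑ m, X m f * ∑ p, ∑ q, i (r p q) * (L p (OG.left (ι (b m)) γ₁) * L q γ₂) -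
      ∑ m, X m f * ∑ p, ∑ q, i (r p q) * (L p (OG.left (ι (b m)) γ₂) * L q γ₁) -
      ∑ p, ∑ q, i (OH.bracket (r p q) f) * (L p γ₁ * L q γ₂) -
      ∑ m, X m f * ∑ p, ∑ q, i (r p q) *
        (Y m (OG.left (e p) γ₁) * L q γ₂ + L p γ₁ * Y m (OG.left (e q) γ₂)) = 0 := by
    rw [a4]
    simp only [← Finset.sum_sub_distrib, a3]
    refine Finset.sum_eq_zero fun m _ => ?_
    have := equivariant_sum (i := i) (j := j) hρ (b m) (he (b m)) γ₁ γ₂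
    simp only [leftG_lie] at this
    have h2 : ∑ p, ∑ q, i (r p q) * ((Y m (OG.left (e p) γ₁) - L p (OG.left (ι (b m)) γ₁)) * L q γ₂ +
        L p γ₁ * (Y m (OG.left (e q) γ₂) - L q (OG.left (ι (b m)) γ₂))) =
        ∑ p, ∑ q, i (r p q) *
          (Y m (OG.left (e p) γ₁) * L q γ₂ + L p γ₁ * Y m (OG.left (e q) γ₂)) -
        ∑ p, ∑ q, i (r p q) * (L p (OG.left (ι (b m)) γ₁) * L q γ₂) -
        ∑ p, ∑ q, i (r p q) * (L p γ₁ * L q (OG.left (ι (b m)) γ₂)) := by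
      simp only [← Finset.sum_sub_distrib]
      refine Finset.sum_congr rfl fun p _ => Finset.sum_congr rfl fun q _ => ?_
      ring
    have h3 := this
    simp only [L, Y] at h2 ⊢
    rw [h2] at h3
    -- For each basis vector `b m`, the coefficient of `X m f` is minus the equivariance equation.
    linear_combination (-X m f) * h3
  rw [t3, t, t, t2]
  linear_combination a1 + a2 + a5

end IsDynamicalBracket

end QuasiPoisson

/-! ### The Jacobiator of three functions on $G$ -/

section QuasiPoisson

variable {k : Type*} [Field k] [CharZero k]
  {g : Type*} [LieRing g] [LieAlgebra k g] [LieBialgebra k g] [FiniteDimensional k g]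
  {h : Type*} [LieRing h] [LieAlgebra k h] [LieBialgebra k h] [FiniteDimensional k h]
  {B : Type*} [CommRing B] [Algebra k B] {n : Type*} [Fintype n]
  {OH : FunctionRing k (DualLie k h)} {OG : FunctionRing k g}
  {i : OH.carrier →ₐ[k] B} {j : OG.carrier →ₐ[k] B} {ι : h →ₗ⁅k⁆ g} {b : Module.Basis n k h}
  {br : B →ₗ[k] B →ₗ[k] B} {hO : OH.AdjointExtends}
  {m : Type*} [Fintype m] {e : Module.Basis m k g} {r : m → m → OH.carrier}

variable (i r) in
/-- The sum of `r_pq r_st F(p, q, s, t)` in `B`. -/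
def quadSum (F : m → m → m → m → B) : B :=
  ∑ p, ∑ q, i (r p q) * ∑ s, ∑ t, i (r s t) * F p q s t

theorem quadSum_sub (F G : m → m → m → m → B) :
    quadSum i r (fun p q s t => F p q s t - G p q s t) = quadSum i r F - quadSum i r G := by
  simp only [quadSum, mul_sub, Finset.sum_sub_distrib]

theorem quadSum_add (F G : m → m → m → m → B) :
    quadSum i r (fun p q s t => F p q s t + G p q s t) = quadSum i r F + quadSum i r G := by
  simp only [quadSum, mul_add, Finset.sum_add_distrib]

theorem quadSum_swap (F : m → m → m → m → B) :
    quadSum i r F = quadSum i r (fun p q s t => F s t p q) := by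
  have h : ∀ F : m → m → m → m → B, quadSum i r F =
      ∑ x : m × m, ∑ y : m × m, i (r x.1 x.2) * i (r y.1 y.2) * F x.1 x.2 y.1 y.2 := by
    intro F
    simp only [quadSum, Fintype.sum_prod_type, Finset.mul_sum, mul_assoc]
  rw [h, h, Finset.sum_comm]
  exact Finset.sum_congr rfl fun x _ => Finset.sum_congr rfl fun y _ => by ring

theorem quadSum_antisymm_left (hr : ∀ p q, r q p = -r p q) (F : m → m → m → m → B) :
    quadSum i r F = -quadSum i r (fun p q s t => F q p s t) :=
  IsDynamicalBracket.sum_antisymm hr _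

theorem quadSum_antisymm_right (hr : ∀ p q, r q p = -r p q) (F : m → m → m → m → B) :
    quadSum i r F = -quadSum i r (fun p q s t => F p q t s) := by
  rw [quadSum_swap, quadSum_antisymm_left hr, quadSum_swap]

theorem cyb_sum (x : m → g) : cyb k g (∑ p, ∑ q, (x p ⊗ₜ[k] x q) ⊗ₜ[k] r p q) =
    ∑ p, ∑ q, ∑ s, ∑ t, cybMap k g ((x p ⊗ₜ x q) ⊗ₜ (x s ⊗ₜ x t)) ⊗ₜ[k] (r p q * r s t) := by
  have h : ∑ p, ∑ q, (x p ⊗ₜ[k] x q) ⊗ₜ[k] r p q =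
    ∑ y : m × m, (x y.1 ⊗ₜ[k] x y.2) ⊗ₜ[k] r y.1 y.2 := by rw [Fintype.sum_prod_type]
  rw [h, cyb, TensorProduct.sum_tmul, map_sum, map_sum, Fintype.sum_prod_type]
  refine Finset.sum_congr rfl fun p _ => Finset.sum_congr rfl fun q _ => ?_
  rw [TensorProduct.tmul_sum, map_sum, map_sum, Fintype.sum_prod_type]
  refine Finset.sum_congr rfl fun s _ => Finset.sum_congr rfl fun t _ => ?_
  rw [TensorProduct.tensorTensorTensorComm_tmul, TensorProduct.map_tmul, LinearMap.mul'_apply]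

/-- The dynamical classical Yang-Baxter equation, evaluated on three functions on `G`. -/
theorem dynamical_sum {Z : g ⊗[k] (g ⊗[k] g)} {ρ : (g ⊗[k] g) ⊗[k] OH.carrier}
    (hρ : ρ = ∑ p, ∑ q, (e p ⊗ₜ[k] e q) ⊗ₜ[k] r p q)
    (hd : cyb k g (A := OH.carrier) ρ + (cycAlt k g).rTensor OH.carrier (dLeft OH ι b ρ) +
      (cycAlt k g ∘ₗ (TensorProduct.assoc k g g g).toLinearMap ∘ₗ
        (cobr k g).rTensor g).rTensor OH.carrier ρ = Z ⊗ₜ 1) (γ₁ γ₂ γ₃ : OG.carrier)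
    (L : m → OG.carrier → OG.carrier) (hL : ∀ p γ, L p γ = OG.left (e p) γ)
    (X : OG.carrier → OG.carrier → OG.carrier → B)
    (hX : ∀ γ₁ γ₂ γ₃, X γ₁ γ₂ γ₃ = ∑ p, ∑ q, (∑ l, i (OH.leftCoord b l (r p q)) *
      j (OG.left (ι (b l)) γ₃)) * (j (L p γ₁) * j (L q γ₂)))
    (E : OG.carrier → OG.carrier → OG.carrier → B)
    (hE : ∀ γ₁ γ₂ γ₃, E γ₁ γ₂ γ₃ = ∑ p, ∑ q, i (r p q) *
      (j (biAct OG.left γ₁ γ₂ (cobr k g (e p))) * j (L q γ₃))) :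
    quadSum i r (fun p q s t =>
        (j (L p (L s γ₁)) - j (L s (L p γ₁))) * (j (L q γ₂) * j (L t γ₃)) +
        j (L p γ₁) * ((j (L q (L s γ₂)) - j (L s (L q γ₂))) * j (L t γ₃)) +
        j (L p γ₁) * (j (L s γ₂) * (j (L q (L t γ₃)) - j (L t (L q γ₃))))) -
      (X γ₁ γ₂ γ₃ + X γ₃ γ₁ γ₂ + X γ₂ γ₃ γ₁) + (E γ₁ γ₂ γ₃ + E γ₃ γ₁ γ₂ + E γ₂ γ₃ γ₁) =
      j (triAction OG.left γ₁ γ₂ γ₃ Z) := by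
  -- The tensor equation is applied to the three functions through left translations and multiplied
  -- by its coefficient in $\mathcal O_{H^*}$.
  let Φ : (g ⊗[k] (g ⊗[k] g)) ⊗[k] OH.carrier →ₗ[k] B := LinearMap.mul' k B ∘ₗ
    TensorProduct.map (j.toLinearMap ∘ₗ triAction OG.left γ₁ γ₂ γ₃) i.toLinearMap
  have hΦ : ∀ T l, Φ (T ⊗ₜ l) = j (triAction OG.left γ₁ γ₂ γ₃ T) * i l := fun T l => rfl
  have h := congrArg Φ hd
  rw [map_add, map_add, hΦ, map_one, mul_one] at h
  rw [← h]
  congr 1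
  · rw [sub_eq_add_neg]
    congr 1
    · rw [hρ, cyb_sum, quadSum]
      simp only [map_sum, Finset.mul_sum]
      refine Finset.sum_congr rfl fun p _ => Finset.sum_congr rfl fun q _ =>
        Finset.sum_congr rfl fun s _ => Finset.sum_congr rfl fun t _ => ?_
      rw [hΦ, cybMap_tmul]
      simp only [map_add, triAction_tmul, OG.left_lie, ← hL, map_mul, map_sub]
      ring
    · have h0 : ∀ p q, Φ ((cycAlt k g).rTensor OH.carrier
          (dLeft OH ι b ((e p ⊗ₜ[k] e q) ⊗ₜ[k] r p q))) =
          -∑ l, i (OH.leftCoord b l (r p q)) *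
            (j (OG.left (ι (b l)) γ₃) * (j (L p γ₁) * j (L q γ₂)) +
              j (OG.left (ι (b l)) γ₂) * (j (L p γ₃) * j (L q γ₁)) +
              j (OG.left (ι (b l)) γ₁) * (j (L p γ₂) * j (L q γ₃))) := by
        intro p q
        simp only [dLeft, LinearMap.neg_apply, LinearMap.sum_apply,
          TensorProduct.map_tmul, map_neg, map_sum, LinearMap.rTensor_tmul, hΦ,
          LinearMap.comp_apply, LinearEquiv.coe_coe, LinearMap.flip_apply, TensorProduct.mk_apply,
          triAction_cycAlt, triAction_assoc, biAct_tmul, map_add, map_mul, ← hL, neg_inj]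
        refine Finset.sum_congr rfl fun l _ => ?_
        rw [FunctionRing.leftCoord]
        ring
      rw [hρ]
      simp only [map_sum, h0, hX, Finset.sum_neg_distrib, neg_inj, ← Finset.sum_add_distrib]
      refine Finset.sum_congr rfl fun p _ => Finset.sum_congr rfl fun q _ => ?_
      simp only [Finset.sum_mul, ← Finset.sum_add_distrib]
      exact Finset.sum_congr rfl fun l _ => by ring
  · rw [hρ]
    simp only [map_sum, hE, LinearMap.rTensor_tmul, hΦ, LinearMap.comp_apply, LinearEquiv.coe_coe,
      triAction_cycAlt, triAction_assoc, ← hL, map_add, map_mul, ← Finset.sum_add_distrib]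
    refine Finset.sum_congr rfl fun p _ => Finset.sum_congr rfl fun q _ => ?_
    ring

namespace IsDynamicalBracket

/-- The cyclic sum consists of the Jacobiator of $\{,\}_G$, which vanishes, and minus the left side
of the dynamical equation acting by left translations: the terms quadratic in $\rho$ give CYB,
brackets of coefficients with functions on $G$ give $\mathrm d^L\rho$, and the cobracket defect
gives $(\delta\otimes\mathrm{id})\rho$. -/
theorem jacobi_fiber {Z : g ⊗[k] (g ⊗[k] g)} {ρ : (g ⊗[k] g) ⊗[k] OH.carrier}
    (hb : IsDynamicalBracket OH OG i j ι b ρ br)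
    (hr : ∀ p q, r q p = -r p q) (hρ : ρ = ∑ p, ∑ q, (e p ⊗ₜ[k] e q) ⊗ₜ[k] r p q)
    (hZ : ∀ x : g, ⁅x, Z⁆ = 0)
    (hd : cyb k g (A := OH.carrier) ρ + (cycAlt k g).rTensor OH.carrier (dLeft OH ι b ρ) +
      (cycAlt k g ∘ₗ (TensorProduct.assoc k g g g).toLinearMap ∘ₗ
        (cobr k g).rTensor g).rTensor OH.carrier ρ = Z ⊗ₜ 1) (γ₁ γ₂ γ₃ : OG.carrier) :
    br (br (j γ₁) (j γ₂)) (j γ₃) + br (br (j γ₂) (j γ₃)) (j γ₁) +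
      br (br (j γ₃) (j γ₁)) (j γ₂) = j (triAction OG.right γ₁ γ₂ γ₃ Z) := by
  let L : m → OG.carrier → OG.carrier := fun p γ => OG.left (e p) γ
  -- The contributions to an iterated bracket: `X` has the mixed bracket on a coefficient of $\rho$,
  -- `E` the cobracket of $\mathfrak g$, `S` one bracket of $G$ and one $\rho$, `T` two copies of
  -- $\rho$.
  let X : OG.carrier → OG.carrier → OG.carrier → B := fun γ₁ γ₂ γ₃ =>
    ∑ p, ∑ q, (∑ l, i (OH.leftCoord b l (r p q)) *
      j (OG.left (ι (b l)) γ₃)) * (j (L p γ₁) * j (L q γ₂))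
  let E : OG.carrier → OG.carrier → OG.carrier → B := fun γ₁ γ₂ γ₃ =>
    ∑ p, ∑ q, i (r p q) * (j (biAct OG.left γ₁ γ₂ (cobr k g (e p))) * j (L q γ₃))
  let S : OG.carrier → OG.carrier → OG.carrier → B := fun γ₁ γ₂ γ₃ =>
    ∑ p, ∑ q, i (r p q) * (j (OG.bracket (L p γ₁) γ₂) * j (L q γ₃))
  let T : OG.carrier → OG.carrier → OG.carrier → B := fun γ₁ γ₂ γ₃ =>
    quadSum i r (fun p q s t => j (L s (L p γ₁)) * (j (L q γ₂) * j (L t γ₃)))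
  have h1 := dynamical_sum (i := i) (j := j) hρ hd γ₁ γ₂ γ₃ L (fun _ _ => rfl) X
    (fun _ _ _ => rfl) E (fun _ _ _ => rfl)
  -- Renaming indices and exchanging the two copies of $\rho$ brings each commutator of CYB to the
  -- shape of `T`, in which both translations fall on the first function.
  have h2 : quadSum i r (fun p q s t =>
        (j (L p (L s γ₁)) - j (L s (L p γ₁))) * (j (L q γ₂) * j (L t γ₃)) +
        j (L p γ₁) * ((j (L q (L s γ₂)) - j (L s (L q γ₂))) * j (L t γ₃)) +
        j (L p γ₁) * (j (L s γ₂) * (j (L q (L t γ₃)) - j (L t (L q γ₃))))) =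
      T γ₁ γ₃ γ₂ - T γ₁ γ₂ γ₃ + (T γ₂ γ₁ γ₃ - T γ₂ γ₃ γ₁) + (T γ₃ γ₂ γ₁ - T γ₃ γ₁ γ₂) := by
    simp only [mul_sub, sub_mul]
    rw [quadSum_add, quadSum_add, quadSum_sub, quadSum_sub, quadSum_sub]
    have e1 : quadSum i r (fun p q s t => j (L p (L s γ₁)) * (j (L q γ₂) * j (L t γ₃))) =
        T γ₁ γ₃ γ₂ := by
      rw [quadSum_swap]; simp only [T, mul_comm (j (L _ γ₂))]
    have e2 : quadSum i r (fun p q s t => j (L p γ₁) * (j (L q (L s γ₂)) * j (L t γ₃))) =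
        -T γ₂ γ₃ γ₁ := by
      rw [quadSum_antisymm_left hr, quadSum_swap]
      simp only [T]
      congr 2
      funext p q s t
      ring
    have e3 : quadSum i r (fun p q s t => j (L p γ₁) * (j (L s (L q γ₂)) * j (L t γ₃))) =
        -T γ₂ γ₁ γ₃ := by
      rw [quadSum_antisymm_left hr]
      simp only [T]
      congr 2
      funext p q s t
      ring
    have e4 : quadSum i r (fun p q s t => j (L p γ₁) * (j (L s γ₂) * j (L q (L t γ₃)))) =
        T γ₃ γ₂ γ₁ := by
      rw [quadSum_antisymm_left hr, quadSum_antisymm_right hr, quadSum_swap, neg_neg]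
      simp only [T]
      congr 2
      funext p q s t
      ring
    have e5 : quadSum i r (fun p q s t => j (L p γ₁) * (j (L s γ₂) * j (L t (L q γ₃)))) =
        T γ₃ γ₁ γ₂ := by
      rw [quadSum_antisymm_left hr, quadSum_antisymm_right hr, neg_neg]
      simp only [T]
      congr 2
      funext p q s t
      ring
    rw [e1, e2, e3, e4, e5]
    simp only [T]
    ring
  have h3 : ∀ γ₁ γ₂ γ₃, br (br (j γ₁) (j γ₂)) (j γ₃) =
      j (OG.bracket (OG.bracket γ₁ γ₂) γ₃) + (S γ₁ γ₂ γ₃ - S γ₂ γ₁ γ₃ - E γ₁ γ₂ γ₃) +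
      (X γ₁ γ₂ γ₃ + S γ₁ γ₃ γ₂ - S γ₂ γ₃ γ₁ + T γ₁ γ₂ γ₃ - T γ₂ γ₁ γ₃) := by
    intro γ₁ γ₂ γ₃
    have s1 : ∑ p, ∑ q, i (r p q) * (j (L p (OG.bracket γ₁ γ₂)) * j (L q γ₃)) =
        S γ₁ γ₂ γ₃ - S γ₂ γ₁ γ₃ - E γ₁ γ₂ γ₃ := by
      simp only [S, E, ← Finset.sum_sub_distrib]
      refine Finset.sum_congr rfl fun p _ => Finset.sum_congr rfl fun q _ => ?_
      simp only [L]
      rw [OG.left_bracket, OG.bracket_swap γ₁]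
      simp only [map_sub, map_add, map_neg]
      ring
    have s2 : S γ₂ γ₃ γ₁ = -∑ p, ∑ q, i (r p q) * (j (L p γ₁) * j (OG.bracket (L q γ₂) γ₃)) := by
      simp only [S]
      rw [sum_antisymm hr]
      simp only [mul_comm (j (L _ γ₁))]
    have s3 : T γ₂ γ₁ γ₃ = -quadSum i r
        (fun p q s t => j (L p γ₁) * (j (L s (L q γ₂)) * j (L t γ₃))) := by
      simp only [T]
      rw [quadSum_antisymm_left hr]
      congr 2
      funext p q s t
      ring
    rw [hb.fiber_sum hρ, map_add, LinearMap.add_apply, hb.fiber_sum hρ]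
    change _ + ∑ p, ∑ q, i (r p q) * (j (L p (OG.bracket γ₁ γ₂)) * j (L q γ₃)) + _ = _
    rw [s1]
    congr 1
    rw [s2, s3, sub_neg_eq_add, sub_neg_eq_add]
    simp only [X, S, T, quadSum, map_sum, LinearMap.sum_apply, ← Finset.sum_add_distrib]
    refine Finset.sum_congr rfl fun p _ => Finset.sum_congr rfl fun q _ => ?_
    rw [hb.mul_left, hb.mul_left, hb.mixed', hb.fiber_sum hρ, hb.fiber_sum hρ]
    have q1 : ∑ s, ∑ t, i (r s t) * (j (L s (L p γ₁)) * (j (L q γ₂) * j (L t γ₃))) =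
        (∑ s, ∑ t, i (r s t) * (j (L s (L p γ₁)) * j (L t γ₃))) * j (L q γ₂) := by
      simp only [Finset.sum_mul]
      refine Finset.sum_congr rfl fun p _ => Finset.sum_congr rfl fun q _ => ?_
      ring
    have q2 : ∑ s, ∑ t, i (r s t) * (j (L p γ₁) * (j (L s (L q γ₂)) * j (L t γ₃))) =
        j (L p γ₁) * (∑ s, ∑ t, i (r s t) * (j (L s (L q γ₂)) * j (L t γ₃))) := by
      simp only [Finset.mul_sum]
      refine Finset.sum_congr rfl fun p _ => Finset.sum_congr rfl fun q _ => ?_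
      ring
    rw [q1, q2]
    simp only [L]
    ring
  rw [h2] at h1
  have h4 : j (OG.bracket (OG.bracket γ₁ γ₂) γ₃) + j (OG.bracket (OG.bracket γ₂ γ₃) γ₁) +
      j (OG.bracket (OG.bracket γ₃ γ₁) γ₂) = 0 := by
    rw [← map_add, ← map_add, OG.bracket_jacobi, map_zero]
  have h5 := OG.triAction_left hZ γ₁ γ₂ γ₃
  -- The sign from invariance of `Z` matches the minus sign with which the dynamical equation
  -- enters; the `S` terms cancel in the cyclic sum.
  have h6 : j (triAction OG.right γ₁ γ₂ γ₃ Z) = -j (triAction OG.left γ₁ γ₂ γ₃ Z) := by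
    rw [h5, map_neg, neg_neg]
  rw [h6, h3, h3, h3, ← h1]
  linear_combination h4

end IsDynamicalBracket

end QuasiPoisson

/-! ### From generators to the quasi-Poisson structure -/

section QuasiPoisson

variable {k : Type*} [Field k] [CharZero k]
  {g : Type*} [LieRing g] [LieAlgebra k g] [LieBialgebra k g] [FiniteDimensional k g]
  {h : Type*} [LieRing h] [LieAlgebra k h] [LieBialgebra k h] [FiniteDimensional k h]
  {B : Type*} [CommRing B] [Algebra k B] {n : Type*} [Fintype n]
  {OH : FunctionRing k (DualLie k h)} {OG : FunctionRing k g}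
  {i : OH.carrier →ₐ[k] B} {j : OG.carrier →ₐ[k] B} {ι : h →ₗ⁅k⁆ g} {b : Module.Basis n k h}
  {br : B →ₗ[k] B →ₗ[k] B} {hO : OH.AdjointExtends} {ρ : (g ⊗[k] g) ⊗[k] OH.carrier}

namespace IsDynamicalBracket

theorem jacobiator {Z : g ⊗[k] (g ⊗[k] g)} (hdet : DerivDetermined i j)
    (hδ : ∀ u : h, cobr k g (ι u) =
      TensorProduct.map (ι : h →ₗ[k] g) (ι : h →ₗ[k] g) (cobr k h u))
    (hρ : IsPLDynamicalRMatrix OH hO ι b Z ρ) (hb : IsDynamicalBracket OH OG i j ι b ρ br)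
    {θ : g →ₗ[k] Module.End k B} (hθ : ∀ x φ ψ, θ x (φ * ψ) = θ x φ * ψ + φ * θ x ψ)
    (hθi : ∀ x f, θ x (i f) = 0) (hθj : ∀ x γ, θ x (j γ) = j (OG.right x γ)) (φ₁ φ₂ φ₃ : B) :
    br (br φ₁ φ₂) φ₃ + br (br φ₂ φ₃) φ₁ + br (br φ₃ φ₁) φ₂ = triAction θ φ₁ φ₂ φ₃ Z := by
  obtain ⟨r, hr, hs⟩ := exists_antisymm_coeff (Module.finBasis k g) ρ hρ.bivector
  let J : B → B → B → B := fun φ ψ χ => br (br φ ψ) χ + br (br ψ χ) φ + br (br χ φ) ψ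
  have hJ : ∀ φ ψ χ, J φ ψ χ = J ψ χ φ := by
    intro φ ψ χ
    simp only [J]
    ring
  have hd1 : ∀ ψ χ, IsDeriv k (fun φ => J φ ψ χ) := by
    intro ψ χ
    -- After one use of antisymmetry, two terms of the Jacobiator form a commutator of derivations
    -- in `φ` and the third is itself a derivation. Cyclic symmetry then covers the other two
    -- variables.
    have h1 := ((hb.biderivation.left χ).commutator (hb.biderivation.left ψ)).add'
      (hb.biderivation.right (br ψ χ))
    convert h1 using 2 with φ
    simp only [J]
    rw [hb.biderivation.1 χ φ, map_neg, LinearMap.neg_apply]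
    ring
  have hd2 : ∀ φ χ, IsDeriv k (fun ψ => J φ ψ χ) := by
    intro φ χ
    simpa only [hJ φ] using hd1 χ φ
  have hd3 : ∀ φ ψ, IsDeriv k (fun χ => J φ ψ χ) := by
    intro φ ψ
    simpa only [hJ φ] using hd2 ψ φ
  have hT := triAction_deriv hθ Z
  rw [← sub_eq_zero]
  refine hdet.trilinear (E := fun φ ψ χ => J φ ψ χ - triAction θ φ ψ χ Z)
    (fun ψ χ => (hd1 ψ χ).sub (hT 0 ψ χ).1) (fun φ χ => (hd2 φ χ).sub (hT φ 0 χ).2.1)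
    (fun φ ψ => (hd3 φ ψ).sub (hT φ ψ 0).2.2) ?_ ?_ ?_ ?_ φ₁ φ₂ φ₃
  · intro f f' f''
    rw [triAction_eq_zero Z (Or.inl (fun x => hθi x f)), sub_zero]
    exact hb.jacobi_base f f' f''
  · intro f f' γ
    have h1 : J (i f) (i f') (j γ) = 0 := hb.jacobi_base_base_fiber f f' γ
    have h2 : J (i f') (j γ) (i f) = 0 := by rw [← hJ]; exact h1
    have h3 : J (j γ) (i f) (i f') = 0 := by rw [hJ]; exact h1
    rw [triAction_eq_zero Z (Or.inl (fun x => hθi x f)), h1,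
      triAction_eq_zero Z (Or.inl (fun x => hθi x f')), h2,
      triAction_eq_zero Z (Or.inr (Or.inl (fun x => hθi x f))), h3, sub_zero]
    exact ⟨rfl, rfl, rfl⟩
  · intro f γ γ'
    have h1 : J (i f) (j γ) (j γ') = 0 :=
      hb.jacobi_base_fiber_fiber hδ hr hs hρ.equivariant f γ γ'
    have h2 : J (j γ) (j γ') (i f) = 0 := by rw [← hJ]; exact h1
    have h3 : J (j γ') (i f) (j γ) = 0 := by rw [hJ]; exact h1
    rw [triAction_eq_zero Z (Or.inl (fun x => hθi x f)), h1,
      triAction_eq_zero Z (Or.inr (Or.inr (fun x => hθi x f))), h2,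
      triAction_eq_zero Z (Or.inr (Or.inl (fun x => hθi x f))), h3, sub_zero]
    exact ⟨rfl, rfl, rfl⟩
  · intro γ γ' γ''
    rw [triAction_map j hθj, sub_eq_zero]
    exact hb.jacobi_fiber hr hs hρ.invariant.2.2 hρ.dynamical γ γ' γ''

end IsDynamicalBracket

/-- The first two terms in which `φ` is bracketed with `ψ` are the commutator of $\theta_x$ with
$\{\cdot,\psi\}$. The tensor `t` is arbitrary, so that both $\delta$ and $-\delta$ are covered. -/
theorem poissonDefect_deriv {a : Type*} [LieRing a] [LieAlgebra k a] [LieBialgebra k a]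
    (hbr : IsAntisymmBiderivation br) {θ : a →ₗ[k] Module.End k B}
    (hθ : ∀ x φ ψ, θ x (φ * ψ) = θ x φ * ψ + φ * θ x ψ) (x : a) (t : a ⊗[k] a) (ψ : B) :
    IsDeriv k (fun φ => θ x (br φ ψ) - br (θ x φ) ψ - br φ (θ x ψ) - biAct θ φ ψ t) ∧
    IsDeriv k (fun φ => θ x (br ψ φ) - br (θ x ψ) φ - br ψ (θ x φ) - biAct θ ψ φ t) := by
  have h := IsDeriv.of_linear (θ x) (hθ x)
  refine ⟨((h.commutator (hbr.left ψ)).sub (hbr.left (θ x ψ))).sub (biAct_deriv_left hθ t ψ), ?_⟩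
  convert ((h.commutator (hbr.right ψ)).sub (hbr.right (θ x ψ))).sub (biAct_deriv_right hθ t ψ)
    using 2 with φ
  ring

namespace IsDynamicalBracket

/-- Right translations kill functions of $H^*$ and commute with the left translations in the mixed
and $\rho$ terms, so only $\{,\}_G$ contributes, and it contributes $\delta$. -/
theorem isPoissonAction_right (hdet : DerivDetermined i j) (hρ : IsBivector k g ρ)
    (hb : IsDynamicalBracket OH OG i j ι b ρ br)
    {θ : g →ₗ[k] Module.End k B} (hθ : ∀ x φ ψ, θ x (φ * ψ) = θ x φ * ψ + φ * θ x ψ)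
    (hθi : ∀ x f, θ x (i f) = 0) (hθj : ∀ x γ, θ x (j γ) = j (OG.right x γ)) :
    IsPoissonAction (cobr k g) θ br := by
  obtain ⟨r, hr, hs⟩ := exists_antisymm_coeff (Module.finBasis k g) ρ hρ
  have hD := fun x => IsDeriv.of_linear (θ x) (hθ x)
  refine ⟨hθ, fun x y f => ?_, fun x φ ψ => ?_⟩
  · rw [← sub_eq_zero]
    refine hdet _ ((hD ⁅x, y⁆).sub ((hD x).commutator (hD y))) (fun f => ?_) (fun γ => ?_) f
    · simp only [hθi, map_zero, sub_zero]
    · simp only [hθj]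
      rw [OG.right_lie, map_sub, sub_self]
  · change _ = _ + biAct θ φ ψ (cobr k g x)
    rw [← sub_eq_iff_eq_add', ← sub_eq_zero, ← sub_sub]
    refine hdet.bilinear
      (E := fun φ ψ => θ x (br φ ψ) - br (θ x φ) ψ - br φ (θ x ψ) - biAct θ φ ψ (cobr k g x))
      (fun ψ => (poissonDefect_deriv hb.biderivation hθ x _ ψ).1)
      (fun φ => (poissonDefect_deriv hb.biderivation hθ x _ φ).2)
      (fun f f' => ?_) (fun f γ => ?_) (fun γ f => ?_) (fun γ γ' => ?_) φ ψ
    · rw [biAct_eq_zero _ (Or.inl fun x => hθi x f)]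
      simp only [hb.base, hθi, map_neg, map_zero, LinearMap.zero_apply, neg_zero, sub_zero]
    · rw [biAct_eq_zero _ (Or.inl fun x => hθi x f)]
      simp only [hb.mixed', hθi, hθj, hθ, map_zero, map_sum, LinearMap.zero_apply, zero_mul,
        zero_add, sub_zero, OG.left_right, sub_self]
    · rw [biAct_eq_zero _ (Or.inr fun x => hθi x f)]
      simp only [hb.mixed_symm, hθi, hθj, hθ, map_zero, map_sum, map_neg, zero_mul,
        zero_add, OG.left_right, sub_self]
    · rw [biAct_map j hθj]
      simp only [hb.fiber_sum hs, hθi, hθj, hθ, map_sum, map_add, zero_mul, zero_add, mul_add,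
        OG.right_bracket, OG.left_right, Finset.sum_add_distrib]
      ring

/-- The cobracket appears as $-\delta$ on every pair of generators. On $H^*$ the sign comes from
$-\{,\}_{H^*}$, on $G$ from left translations; the terms with $\rho$ cancel by equivariance, and the
mixed pair uses the commutator of dressing with left translations. -/
theorem isPoissonAction_left (hdet : DerivDetermined i j)
    (hδ : ∀ u : h, cobr k g (ι u) =
      TensorProduct.map (ι : h →ₗ[k] g) (ι : h →ₗ[k] g) (cobr k h u)) (hρ : IsBivector k g ρ)
    (he : ∀ u : h, (dressH OH hO u).lTensor (g ⊗[k] g) ρ +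
      (LieModule.toEnd k g (g ⊗[k] g) (ι u)).rTensor OH.carrier ρ = 0)
    (hb : IsDynamicalBracket OH OG i j ι b ρ br)
    {θ : h →ₗ[k] Module.End k B} (hθ : ∀ x φ ψ, θ x (φ * ψ) = θ x φ * ψ + φ * θ x ψ)
    (hθi : ∀ u f, θ u (i f) = i (dressH OH hO u f))
    (hθj : ∀ u γ, θ u (j γ) = j (OG.left (ι u) γ)) :
    IsPoissonAction (-cobr k h) θ br := by
  obtain ⟨r, hr, hs⟩ := exists_antisymm_coeff (Module.finBasis k g) ρ hρ
  have hD := fun x => IsDeriv.of_linear (θ x) (hθ x)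
  have hbi : ∀ u φ ψ, biAct θ φ ψ ((-cobr k h) u) = -∑ p, ∑ q,
      algebraMap k B (dualBracket k (b.coord p) (b.coord q) u) * (θ (b p) φ * θ (b q) ψ) := by
    intro u φ ψ
    rw [LinearMap.neg_apply, map_neg, biAct_cobr b]
    simp only [Algebra.smul_def]
  refine ⟨hθ, fun x y f => ?_, fun u φ ψ => ?_⟩
  · rw [← sub_eq_zero]
    refine hdet _ ((hD ⁅x, y⁆).sub ((hD x).commutator (hD y))) (fun f => ?_) (fun γ => ?_) f
    · simp only [hθi]
      rw [OH.dressH_lie, map_sub, sub_self]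
    · simp only [hθj]
      rw [LieHom.map_lie, OG.left_lie, map_sub, sub_self]
  · change _ = _ + biAct θ φ ψ ((-cobr k h) u)
    rw [← sub_eq_iff_eq_add', ← sub_eq_zero, ← sub_sub]
    have hij : ∀ f γ, θ u (br (i f) (j γ)) - br (θ u (i f)) (j γ) - br (i f) (θ u (j γ)) -
        biAct θ (i f) (j γ) ((-cobr k h) u) = 0 := by
      intro f γ
      rw [hbi]
      simp only [hb.mixed', hθi, hθj, map_sum, hθ]
      -- In $[\mathrm{dress}_u,\mathbf L_{\varepsilon^m}]$ the dressing part gives the cobracket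
      -- term, and the translation part cancels the commutator of $\mathbf L_u$ with $\mathbf
      -- L_{e_m}$ on `γ`.
      have e1 : ∑ m, i (dressH OH hO u (OH.leftCoord b m f)) * j (OG.left (ι (b m)) γ) =
          ∑ m, i (OH.leftCoord b m (dressH OH hO u f)) * j (OG.left (ι (b m)) γ) -
          ∑ p, ∑ q, algebraMap k B (dualBracket k (b.coord p) (b.coord q) u) *
            (i (dressH OH hO (b p) f) * j (OG.left (ι (b q)) γ)) -
          ∑ m, i (OH.leftCoord b m f) * j (OG.left ⁅ι u, ι (b m)⁆ γ) := by
        have a1 : ∑ p, ∑ q, algebraMap k B (dualBracket k (b.coord p) (b.coord q) u) *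
            (i (dressH OH hO (b p) f) * j (OG.left (ι (b q)) γ)) =
            -∑ m, (∑ l, algebraMap k B (dualBracket k (b.coord m) (b.coord l) u) *
              i (dressH OH hO (b l) f)) * j (OG.left (ι (b m)) γ) := by
          simp only [Finset.sum_mul]
          rw [Finset.sum_comm, ← Finset.sum_neg_distrib]
          refine Finset.sum_congr rfl fun p _ => ?_
          rw [← Finset.sum_neg_distrib]
          refine Finset.sum_congr rfl fun q _ => ?_
          rw [dualBracket_swap k (b.coord q), map_neg]
          ring
        have a2 : ∑ m, i (OH.leftCoord b m f) * j (OG.left ⁅ι u, ι (b m)⁆ γ) =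
            ∑ m, (∑ l, algebraMap k B (b.coord m ⁅u, b l⁆) * i (OH.leftCoord b l f)) *
              j (OG.left (ι (b m)) γ) := by
          simp only [← LieHom.map_lie, Finset.sum_mul]
          rw [Finset.sum_comm]
          refine Finset.sum_congr rfl fun m _ => ?_
          rw [leftG_coord (b := b), Finset.mul_sum]
          exact Finset.sum_congr rfl fun l _ => by ring
        rw [a1, a2, sub_neg_eq_add, ← Finset.sum_add_distrib, ← Finset.sum_sub_distrib]
        refine Finset.sum_congr rfl fun m _ => ?_
        rw [OH.dressH_leftCoord b hO u m f]
        simp only [map_add, map_sub, map_sum, Algebra.smul_def, map_mul, AlgHom.commutes]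
        ring
      simp only [leftG_lie, mul_sub, Finset.sum_sub_distrib] at e1
      simp only [Finset.sum_add_distrib]
      rw [e1]
      ring
    refine hdet.bilinear
      (E := fun φ ψ => θ u (br φ ψ) - br (θ u φ) ψ - br φ (θ u ψ) - biAct θ φ ψ ((-cobr k h) u))
      (fun ψ => (poissonDefect_deriv hb.biderivation hθ u _ ψ).1)
      (fun φ => (poissonDefect_deriv hb.biderivation hθ u _ φ).2)
      (fun f f' => ?_) hij (fun γ f => ?_) (fun γ γ' => ?_) φ ψ
    · rw [hbi]
      simp only [hb.base, hθi, map_neg]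
      rw [OH.dressH_bracket b hO]
      simp only [map_add, map_sum, Algebra.smul_def, map_mul, AlgHom.commutes]
      ring
    · rw [hb.biderivation.1 (j γ), hb.biderivation.1 (θ u (j γ)), hb.biderivation.1 (j γ),
        map_neg]
      have : biAct θ (j γ) (i f) ((-cobr k h) u) = -biAct θ (i f) (j γ) ((-cobr k h) u) := by
        simp only [LinearMap.neg_apply, map_neg]
        rw [biAct_cobr_swap]
      rw [this]
      linear_combination -hij f γ
    · rw [hbi]
      simp only [hθj]
      rw [hb.fiber_sum hs, hb.fiber_sum hs, hb.fiber_sum hs]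
      have e := equivariant_sum (i := i) (j := j) hs u (he u) γ γ'
      simp only [leftG_lie] at e
      simp only [map_add, map_sum, hθ, hθi, hθj, leftG_bracket_coord (b := b) hδ, mul_add,
        Finset.sum_add_distrib]
      simp only [mul_add, sub_mul, mul_sub, Finset.sum_add_distrib, Finset.sum_sub_distrib] at e
      linear_combination e

theorem isQuasiPoisson {Z : g ⊗[k] (g ⊗[k] g)} (hdet : DerivDetermined i j)
    (hδ : ∀ u : h, cobr k g (ι u) =
      TensorProduct.map (ι : h →ₗ[k] g) (ι : h →ₗ[k] g) (cobr k h u))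
    (hρ : IsPLDynamicalRMatrix OH hO ι b Z ρ) (hb : IsDynamicalBracket OH OG i j ι b ρ br)
    {θH : h →ₗ[k] Module.End k B} (hH : ∀ x φ ψ, θH x (φ * ψ) = θH x φ * ψ + φ * θH x ψ)
    (hHi : ∀ u f, θH u (i f) = i (dressH OH hO u f))
    (hHj : ∀ u γ, θH u (j γ) = j (OG.left (ι u) γ))
    {θG : g →ₗ[k] Module.End k B} (hG : ∀ x φ ψ, θG x (φ * ψ) = θG x φ * ψ + φ * θG x ψ)
    (hGi : ∀ x f, θG x (i f) = 0) (hGj : ∀ x γ, θG x (j γ) = j (OG.right x γ)) :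
    IsQuasiPoisson Z θH θG br where
  jacobiator := hb.jacobiator hdet hδ hρ hG hGi hGj
  actionH := hb.isPoissonAction_left hdet hδ hρ.bivector hρ.equivariant hH hHi hHj
  actionG := hb.isPoissonAction_right hdet hρ.bivector hG hGi hGj
  commute u x φ := by
    rw [← sub_eq_zero]
    refine hdet _ ((IsDeriv.of_linear (θH u) (hH u)).commutator
      (IsDeriv.of_linear (θG x) (hG x))) (fun f => ?_) (fun γ => ?_) φ
    · simp only [hGi, hHi, map_zero, sub_zero]
    · simp only [hGj, hHj, OG.left_right, sub_self]

end IsDynamicalBracket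

end QuasiPoisson

/-! ### Derivations and biderivations of an algebraic tensor product -/

section TensorDerivations

variable {k : Type*} [Field k] {A A' : Type*} [CommRing A] [Algebra k A] [CommRing A'] [Algebra k A']

theorem rTensor_deriv {D : Module.End k A} (hD : ∀ x y, D (x * y) = D x * y + x * D y)
    (φ ψ : A ⊗[k] A') :
    D.rTensor A' (φ * ψ) = D.rTensor A' φ * ψ + φ * D.rTensor A' ψ := by
  induction φ using TensorProduct.induction_on with
  | zero => simp
  | add s t hs ht => simp only [add_mul, map_add, hs, ht]; ring
  | tmul x y =>
    induction ψ using TensorProduct.induction_on with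
    | zero => simp
    | add s t hs ht => simp only [mul_add, map_add, hs, ht]; ring
    | tmul z w => simp [hD, TensorProduct.add_tmul]

theorem lTensor_deriv {D : Module.End k A'} (hD : ∀ x y, D (x * y) = D x * y + x * D y)
    (φ ψ : A ⊗[k] A') :
    D.lTensor A (φ * ψ) = D.lTensor A φ * ψ + φ * D.lTensor A ψ := by
  induction φ using TensorProduct.induction_on with
  | zero => simp
  | add s t hs ht => simp only [add_mul, map_add, hs, ht]; ring
  | tmul x y =>
    induction ψ using TensorProduct.induction_on with
    | zero => simp
    | add s t hs ht => simp only [mul_add, map_add, hs, ht]; ring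
    | tmul z w => simp [hD, TensorProduct.tmul_add]

theorem deriv_one {D : Module.End k A} (hD : ∀ x y, D (x * y) = D x * y + x * D y) : D 1 = 0 := by
  simpa using hD 1 1

theorem derivDetermined_tensorProduct : DerivDetermined (k := k)
    (Algebra.TensorProduct.includeLeft : A →ₐ[k] A ⊗[k] A')
    (Algebra.TensorProduct.includeRight : A' →ₐ[k] A ⊗[k] A') := by
  intro D hD hi hj φ
  induction φ using TensorProduct.induction_on with
  | zero => simpa using hD.smul 0 0
  | add s t hs ht => rw [hD.add, hs, ht, add_zero]
  | tmul x y =>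
    have h := hD.mul (x ⊗ₜ 1) (1 ⊗ₜ y)
    have h1 : D (x ⊗ₜ 1) = 0 := hi x
    have h2 : D (1 ⊗ₜ y) = 0 := hj y
    rw [h1, h2, zero_mul, mul_zero, add_zero] at h
    simpa using h

theorem rTensor_includeRight {D : Module.End k A} (hD : ∀ x y, D (x * y) = D x * y + x * D y)
    (y : A') : D.rTensor A' ((1 : A) ⊗ₜ[k] y) = 0 := by
  rw [LinearMap.rTensor_tmul, deriv_one hD, TensorProduct.zero_tmul]

theorem lTensor_includeLeft {D : Module.End k A'} (hD : ∀ x y, D (x * y) = D x * y + x * D y)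
    (x : A) : D.lTensor A (x ⊗ₜ[k] (1 : A')) = 0 := by
  rw [LinearMap.lTensor_tmul, deriv_one hD, TensorProduct.tmul_zero]

section Bidifferential

variable {P : A →ₗ[k] A →ₗ[k] A} {P' : A' →ₗ[k] A' →ₗ[k] A'}

theorem map₂_tmul_tmul (x z : A) (y w : A') :
    TensorProduct.map₂ P P' (x ⊗ₜ y) (z ⊗ₜ w) = P x z ⊗ₜ P' y w := by
  rw [TensorProduct.map₂_apply_tmul, TensorProduct.map_tmul]

/-- The rule is assumed for the pair on pure tensors, so it covers both a biderivation tensored with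
the product and the product tensored with a biderivation. -/
theorem map₂_leibniz_left (h : ∀ x y z u v w, P (x * y) z ⊗ₜ[k] P' (u * v) w =
      (P x z * y) ⊗ₜ (P' u w * v) + (x * P y z) ⊗ₜ (u * P' v w)) (φ ψ χ : A ⊗[k] A') :
    TensorProduct.map₂ P P' (φ * ψ) χ =
      TensorProduct.map₂ P P' φ χ * ψ + φ * TensorProduct.map₂ P P' ψ χ := by
  induction φ using TensorProduct.induction_on with
  | zero => simp
  | add s t hs ht => simp only [add_mul, map_add, LinearMap.add_apply, hs, ht]; ring
  | tmul x y =>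
    induction ψ using TensorProduct.induction_on with
    | zero => simp
    | add s t hs ht => simp only [mul_add, map_add, LinearMap.add_apply, hs, ht]; ring
    | tmul z w =>
      induction χ using TensorProduct.induction_on with
      | zero => simp
      | add s t hs ht => simp only [mul_add, add_mul, map_add, hs, ht]; ring
      | tmul u v => simp only [Algebra.TensorProduct.tmul_mul_tmul, map₂_tmul_tmul, h]

theorem map₂_leibniz_right (h : ∀ x y z u v w, P x (y * z) ⊗ₜ[k] P' u (v * w) =
      (P x y * z) ⊗ₜ (P' u v * w) + (y * P x z) ⊗ₜ (v * P' u w)) (φ ψ χ : A ⊗[k] A') :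
    TensorProduct.map₂ P P' φ (ψ * χ) =
      TensorProduct.map₂ P P' φ ψ * χ + ψ * TensorProduct.map₂ P P' φ χ := by
  induction φ using TensorProduct.induction_on with
  | zero => simp
  | add s t hs ht => simp only [add_mul, mul_add, map_add, LinearMap.add_apply, hs, ht]; ring
  | tmul x y =>
    induction ψ using TensorProduct.induction_on with
    | zero => simp
    | add s t hs ht => simp only [add_mul, map_add, hs, ht]; ring
    | tmul z w =>
      induction χ using TensorProduct.induction_on with
      | zero => simp
      | add s t hs ht => simp only [mul_add, map_add, hs, ht]; ring
      | tmul u v => simp only [Algebra.TensorProduct.tmul_mul_tmul, map₂_tmul_tmul, h]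

theorem map₂_eq_zero_left {s : A} {t : A'} (h : ∀ x y, P x s ⊗ₜ[k] P' y t = 0) (φ : A ⊗[k] A') :
    TensorProduct.map₂ P P' φ (s ⊗ₜ t) = 0 := by
  induction φ using TensorProduct.induction_on with
  | zero => simp
  | add s t hs ht => simp only [map_add, LinearMap.add_apply, hs, ht, add_zero]
  | tmul x y => rw [map₂_tmul_tmul, h]

theorem map₂_eq_zero_right {s : A} {t : A'} (h : ∀ x y, P s x ⊗ₜ[k] P' t y = 0) (φ : A ⊗[k] A') :
    TensorProduct.map₂ P P' (s ⊗ₜ t) φ = 0 := by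
  induction φ using TensorProduct.induction_on with
  | zero => simp
  | add s t hs ht => simp only [map_add, hs, ht, add_zero]
  | tmul x y => rw [map₂_tmul_tmul, h]

theorem deriv_left_one (hP : ∀ x y z, P (x * y) z = P x z * y + x * P y z) (z : A) : P 1 z = 0 := by
  simpa using hP 1 1 z

theorem deriv_right_one (hP : ∀ x y z, P x (y * z) = P x y * z + y * P x z) (x : A) :
    P x 1 = 0 := by
  simpa using hP x 1 1

theorem map₂_mul_left (hP : ∀ x y z, P (x * y) z = P x z * y + x * P y z) (φ ψ χ : A ⊗[k] A') :
    TensorProduct.map₂ P (LinearMap.mul k A') (φ * ψ) χ =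
      TensorProduct.map₂ P (LinearMap.mul k A') φ χ * ψ +
        φ * TensorProduct.map₂ P (LinearMap.mul k A') ψ χ :=
  map₂_leibniz_left (fun x y z u v w => by
    rw [LinearMap.mul_apply', LinearMap.mul_apply', LinearMap.mul_apply', hP,
      TensorProduct.add_tmul, mul_right_comm u v w, mul_assoc u w v, mul_comm w v]) φ ψ χ

theorem map₂_mul_right (hP : ∀ x y z, P x (y * z) = P x y * z + y * P x z) (φ ψ χ : A ⊗[k] A') :
    TensorProduct.map₂ P (LinearMap.mul k A') φ (ψ * χ) =
      TensorProduct.map₂ P (LinearMap.mul k A') φ ψ * χ +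
        ψ * TensorProduct.map₂ P (LinearMap.mul k A') φ χ :=
  map₂_leibniz_right (fun x y z u v w => by
    rw [LinearMap.mul_apply', LinearMap.mul_apply', LinearMap.mul_apply', hP,
      TensorProduct.add_tmul, mul_assoc u v w, mul_left_comm v u w]) φ ψ χ

theorem mul_map₂_left (hP : ∀ x y z, P' (x * y) z = P' x z * y + x * P' y z) (φ ψ χ : A ⊗[k] A') :
    TensorProduct.map₂ (LinearMap.mul k A) P' (φ * ψ) χ =
      TensorProduct.map₂ (LinearMap.mul k A) P' φ χ * ψ +
        φ * TensorProduct.map₂ (LinearMap.mul k A) P' ψ χ :=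
  map₂_leibniz_left (fun x y z u v w => by
    rw [LinearMap.mul_apply', LinearMap.mul_apply', LinearMap.mul_apply', hP,
      TensorProduct.tmul_add, mul_right_comm x y z, mul_assoc x z y, mul_comm z y]) φ ψ χ

theorem mul_map₂_right (hP : ∀ x y z, P' x (y * z) = P' x y * z + y * P' x z) (φ ψ χ : A ⊗[k] A') :
    TensorProduct.map₂ (LinearMap.mul k A) P' φ (ψ * χ) =
      TensorProduct.map₂ (LinearMap.mul k A) P' φ ψ * χ +
        ψ * TensorProduct.map₂ (LinearMap.mul k A) P' φ χ :=
  map₂_leibniz_right (fun x y z u v w => by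
    rw [LinearMap.mul_apply', LinearMap.mul_apply', LinearMap.mul_apply', hP,
      TensorProduct.tmul_add, mul_assoc x y z, mul_left_comm y x z]) φ ψ χ

end Bidifferential

theorem tensor_deriv {D : Module.End k A} {D' : Module.End k A'}
    (hD : ∀ x y, D (x * y) = D x * y + x * D y) (hD' : ∀ x y, D' (x * y) = D' x * y + x * D' y)
    (φ ψ : A ⊗[k] A') : D.rTensor A' (φ * ψ) + D'.lTensor A (φ * ψ) =
      (D.rTensor A' φ + D'.lTensor A φ) * ψ + φ * (D.rTensor A' ψ + D'.lTensor A ψ) := by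
  rw [rTensor_deriv hD, lTensor_deriv hD']
  ring

end TensorDerivations

/-! ### The algebraic case -/

section Algebraic

variable {k : Type*} [Field k] [CharZero k]
  {g : Type*} [LieRing g] [LieAlgebra k g] [LieBialgebra k g] [FiniteDimensional k g]
  {h : Type*} [LieRing h] [LieAlgebra k h] [LieBialgebra k h] [FiniteDimensional k h]

set_option maxHeartbeats 1600000 in
/-- The calculus on the tensor product of two function rings. -/
def algCalculus (OH : FunctionRing k (DualLie k h)) (OG : FunctionRing k g) :
    ProductCalculus (OH := OH) (OG := OG) (B := OH.carrier ⊗[k] OG.carrier)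
      Algebra.TensorProduct.includeLeft Algebra.TensorProduct.includeRight where
  transH ξ := (OH.left ξ).rTensor OG.carrier
  transH_mul ξ := rTensor_deriv (OH.left_mul ξ)
  transH_left ξ f := LinearMap.rTensor_tmul _ _ _ _
  transH_right ξ γ := rTensor_includeRight (OH.left_mul ξ) γ
  transG x := (OG.left x).lTensor OH.carrier
  transG_mul x := lTensor_deriv (OG.left_mul x)
  transG_left x f := lTensor_includeLeft (OG.left_mul x) f
  transG_right x γ := LinearMap.lTensor_tmul _ _ _ _
  brH := TensorProduct.map₂ OH.bracket (LinearMap.mul k OG.carrier)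
  brH_mul_left := map₂_mul_left OH.bracket_mul_left
  brH_mul_right := map₂_mul_right (A := OH.carrier) (A' := OG.carrier) (P := OH.bracket) OH.bracket_mul_right
  brH_left f f' := (map₂_tmul_tmul _ _ _ _).trans (by rw [LinearMap.mul_apply', mul_one]; rfl)
  brH_right φ γ :=
    ⟨map₂_eq_zero_left (fun x y => by
      rw [deriv_right_one OH.bracket_mul_right, TensorProduct.zero_tmul]) φ,
    map₂_eq_zero_right (fun x y => by
      rw [deriv_left_one OH.bracket_mul_left, TensorProduct.zero_tmul]) φ⟩
  brG := TensorProduct.map₂ (LinearMap.mul k OH.carrier) OG.bracket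
  brG_mul_left := mul_map₂_left OG.bracket_mul_left
  brG_mul_right := mul_map₂_right OG.bracket_mul_right
  brG_right γ γ' := (map₂_tmul_tmul _ _ _ _).trans (by rw [LinearMap.mul_apply', mul_one]; rfl)
  brG_left φ f :=
    ⟨map₂_eq_zero_left (fun x y => by
      rw [deriv_right_one OG.bracket_mul_right, TensorProduct.tmul_zero]) φ,
    map₂_eq_zero_right (fun x y => by
      rw [deriv_left_one OG.bracket_mul_left, TensorProduct.tmul_zero]) φ⟩

theorem algActH_apply (OH : FunctionRing k (DualLie k h)) (hOH : OH.AdjointExtends)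
    (OG : FunctionRing k g) (ι : h →ₗ⁅k⁆ g) (u : h) (φ : OH.carrier ⊗[k] OG.carrier) :
    algActH OH hOH OG ι u φ =
      (dressH OH hOH u).rTensor OG.carrier φ + (OG.left (ι u)).lTensor OH.carrier φ := rfl

theorem alg_isQuasiPoisson {OH : FunctionRing k (DualLie k h)} {hOH : OH.AdjointExtends}
    {OG : FunctionRing k g} {ι : h →ₗ⁅k⁆ g} {n : Type*} [Fintype n] {b : Module.Basis n k h}
    {Z : g ⊗[k] (g ⊗[k] g)} {ρ : (g ⊗[k] g) ⊗[k] OH.carrier}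
    (hδ : ∀ u : h, cobr k g (ι u) =
      TensorProduct.map (ι : h →ₗ[k] g) (ι : h →ₗ[k] g) (cobr k h u))
    (hρ : IsPLDynamicalRMatrix OH hOH ι b Z ρ)
    {br : (OH.carrier ⊗[k] OG.carrier) →ₗ[k] (OH.carrier ⊗[k] OG.carrier) →ₗ[k]
      (OH.carrier ⊗[k] OG.carrier)}
    (hb : IsDynamicalBracket OH OG Algebra.TensorProduct.includeLeft
      Algebra.TensorProduct.includeRight ι b ρ br) :
    IsQuasiPoisson Z (algActH OH hOH OG ι) (algActG OH OG) br := by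
  refine hb.isQuasiPoisson derivDetermined_tensorProduct hδ hρ ?_ ?_ ?_ ?_ ?_ ?_
  · intro u φ ψ
    exact tensor_deriv (OH.dressH_mul hOH u) (OG.left_mul _) φ ψ
  · intro u f
    rw [algActH_apply]
    exact (congrArg₂ (· + ·) (LinearMap.rTensor_tmul _ _ _ _)
      (lTensor_includeLeft (OG.left_mul _) f)).trans (add_zero _)
  · intro u γ
    rw [algActH_apply]
    exact (congrArg₂ (· + ·) (rTensor_includeRight (OH.dressH_mul hOH u) γ)
      (LinearMap.lTensor_tmul _ _ _ _)).trans (zero_add _)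
  · intro x φ ψ
    exact lTensor_deriv (OG.right_mul x) φ ψ
  · intro x f
    exact lTensor_includeLeft (OG.right_mul x) f
  · intro x γ
    exact LinearMap.lTensor_tmul _ _ _ _

end Algebraic

/-! ### Polarization and operators diagonal on eigenvectors -/

section Powers

/-- A linear form on `M ⧸ S` turns the family into a scalar polynomial that vanishes at every point
of an infinite field, hence has zero coefficients. -/
theorem coeff_mem_of_forall {k M : Type*} [Field k] [Infinite k] [AddCommGroup M] [Module k M]
    (S : Submodule k M) (N : ℕ) (c : ℕ → M)
    (h : ∀ t : k, ∑ i ∈ Finset.range N, t ^ i • c i ∈ S) {i : ℕ} (hi : i < N) : c i ∈ S := by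
  rw [← Submodule.Quotient.mk_eq_zero, ← Module.forall_dual_apply_eq_zero_iff k]
  intro l
  let l' : M →ₗ[k] k := l ∘ₗ S.mkQ
  let p : Polynomial k := ∑ i ∈ Finset.range N, Polynomial.monomial i (l' (c i))
  have hp : p = 0 := by
    apply Polynomial.funext
    intro t
    have h1 : l' (∑ i ∈ Finset.range N, t ^ i • c i) = 0 := by
      have h2 : S.mkQ (∑ i ∈ Finset.range N, t ^ i • c i) = 0 :=
        (Submodule.Quotient.mk_eq_zero S).2 (h t)
      rw [LinearMap.comp_apply, h2, map_zero]
    rw [map_sum] at h1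
    simp only [map_smul, smul_eq_mul] at h1
    simp only [p, Polynomial.eval_finsetSum, Polynomial.eval_monomial, Polynomial.eval_zero]
    rw [← h1]
    exact Finset.sum_congr rfl fun i _ => mul_comm _ _
  have h3 := congrArg (fun q => Polynomial.coeff q i) hp
  change l' (c i) = 0
  simpa [p, Polynomial.coeff_monomial, Finset.mem_range, hi] using h3

/-- Polarization: the coefficient of `t` in `(x + t y) ^ (n + 1)`. -/
theorem sum_pow_mul_pow_mem {k A : Type*} [Field k] [Infinite k] [Ring A] [Algebra k A]
    (S : Submodule k A) (x y : A) (n : ℕ) (h : ∀ t : k, (x + t • y) ^ (n + 1) ∈ S) :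
    ∑ i ∈ Finset.range (n + 1), x ^ i * y * x ^ (n - i) ∈ S := by
  -- The variable is central, although `x` and `y` need not commute, so evaluation at a scalar is
  -- multiplicative.
  let q : Polynomial A := Polynomial.C x + Polynomial.X * Polynomial.C y
  have h0 : ∀ m, (q ^ m).coeff 0 = x ^ m := by
    intro m
    induction m with
    | zero => simp
    | succ m ih => rw [pow_succ, Polynomial.mul_coeff_zero, ih, pow_succ]; simp [q]
  have h1 : ∀ m, (q ^ (m + 1)).coeff 1 = ∑ i ∈ Finset.range (m + 1), x ^ i * y * x ^ (m - i) := by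
    intro m
    induction m with
    | zero => simp [q]
    | succ m ih =>
      rw [pow_succ, Polynomial.mul_coeff_one, ih, h0, Finset.sum_range_succ _ (m + 1),
        Finset.sum_mul, add_comm]
      congr 1
      · refine Finset.sum_congr rfl fun i hi => ?_
        rw [Finset.mem_range] at hi
        simp only [q, Polynomial.coeff_add, Polynomial.coeff_C_zero, Polynomial.mul_coeff_zero,
          Polynomial.coeff_X_zero, zero_mul, add_zero]
        rw [mul_assoc, ← pow_succ, show m - i + 1 = m + 1 - i by omega]
      · simp [q]
  rw [← h1]
  -- The degree can be zero, for instance when `y = 0`; then the coefficient in question vanishes.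
  by_cases hd : 1 < (q ^ (n + 1)).natDegree + 1
  · refine coeff_mem_of_forall S ((q ^ (n + 1)).natDegree + 1) (fun i => (q ^ (n + 1)).coeff i)
      (fun t => ?_) hd
    have hc : ∀ z : A, Commute (RingHom.id A z) (algebraMap k A t) := fun z =>
      (Algebra.commutes t z).symm
    have hE := map_pow (Polynomial.eval₂RingHom' (RingHom.id A) (algebraMap k A t) hc) q (n + 1)
    have hq : Polynomial.eval₂RingHom' (RingHom.id A) (algebraMap k A t) hc q = x + t • y := by
      simp only [q, map_add, map_mul]
      simp [Polynomial.eval₂RingHom', Algebra.smul_def]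
    rw [hq] at hE
    have hs : Polynomial.eval₂RingHom' (RingHom.id A) (algebraMap k A t) hc (q ^ (n + 1)) =
        ∑ i ∈ Finset.range ((q ^ (n + 1)).natDegree + 1), t ^ i • (q ^ (n + 1)).coeff i := by
      change Polynomial.eval₂ _ _ _ = _
      rw [Polynomial.eval₂_eq_sum_range]
      refine Finset.sum_congr rfl fun i _ => ?_
      rw [RingHom.id_apply, ← map_pow, Algebra.smul_def, Algebra.commutes]
    rw [← hs, hE]
    exact h t
  · rw [Polynomial.coeff_eq_zero_of_natDegree_lt (by omega)]
    exact S.zero_mem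

/-- If the powers of the `x_i` are eigenvectors, operators that are diagonal on them exist. -/
theorem exists_diagonal {k V I : Type*} [Field k] [AddCommGroup V] [Module k V]
    (Ψ : Module.End k V) (x : I → V) (hx : ⊤ ≤ Submodule.span k (Set.range x)) (d : I → ℕ)
    (μ : ℕ → k) (hμ : Function.Injective μ) (hΨ : ∀ i, Ψ (x i) = μ (d i) • x i) (c : ℕ → k) :
    ∃ T : Module.End k V, ∀ i, T (x i) = c (d i) • x i := by
  classical
  let F : (I →₀ k) →ₗ[k] V := Finsupp.linearCombination k x
  have hF : Function.Surjective F := by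
    rw [← LinearMap.range_eq_top, Finsupp.range_linearCombination]
    exact top_le_iff.mp hx
  obtain ⟨s, hs⟩ := LinearMap.exists_rightInverse_of_surjective F (LinearMap.range_eq_top.2 hF)
  let Fc : (I →₀ k) →ₗ[k] V := Finsupp.linearCombination k (fun i => c (d i) • x i)
  -- The `x i` may be dependent, so relations must be respected. Only finitely many eigenvalues
  -- occur in a relation, and a polynomial in `Ψ` that interpolates `c` at them carries `F l` to `Fc
  -- l`.
  have key : ∀ l, F l = 0 → Fc l = 0 := by
    intro l hl
    let N : Finset ℕ := l.support.image d
    let P : Polynomial k := Lagrange.interpolate N μ c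
    have hP : ∀ m ∈ N, P.eval (μ m) = c m := fun m hm =>
      Lagrange.eval_interpolate_at_node _ hμ.injOn hm
    have hA : ∀ i ∈ l.support, Polynomial.aeval Ψ P (x i) = c (d i) • x i := by
      intro i hi
      by_cases h0 : x i = 0
      · simp [h0]
      · rw [Module.End.aeval_apply_of_hasEigenvector (μ := μ (d i))
          ⟨Module.End.mem_eigenspace_iff.2 (hΨ i), h0⟩, hP _ (Finset.mem_image_of_mem d hi)]
    have : Fc l = Polynomial.aeval Ψ P (F l) := by
      simp only [Fc, F, Finsupp.linearCombination_apply, Finsupp.sum, map_sum, map_smul]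
      exact Finset.sum_congr rfl fun i hi => by rw [hA i hi]
    rw [this, hl, map_zero]
  refine ⟨Fc ∘ₗ s, fun i => ?_⟩
  have h1 : F (s (x i) - Finsupp.single i 1) = 0 := by
    have h2 : F (s (x i)) = x i := congr($hs (x i))
    rw [map_sub, h2]
    simp [F]
  have h3 := key _ h1
  rw [map_sub, sub_eq_zero] at h3
  rw [LinearMap.comp_apply, h3]
  simp [Fc]

end Powers

/-! ### Powers in the enveloping algebra and the Hadamard lemma -/

section EnvelopingPowers

variable {k : Type*} [Field k] [CharZero k] {a : Type*} [LieRing a] [LieAlgebra k a]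

variable (k a) in
/-- The span of the powers of the elements of `a` in `U(a)`. -/
def powSpan : Submodule k (U k a) :=
  Submodule.span k (Set.range fun p : a × ℕ => inU k p.1 ^ p.2)

theorem pow_mem_powSpan (v : a) (m : ℕ) : inU k v ^ m ∈ powSpan k a :=
  Submodule.subset_span ⟨(v, m), rfl⟩

/-- Moving `w` past one `v` costs a term of the same form with `⁅v, w⁆` and one factor less, covered
by induction. Hence all positions of `w` agree modulo the span, while their sum lies in it by
polarization. -/
theorem pow_mul_inU_mul_pow_mem (m : ℕ) : ∀ (v w : a) (i : ℕ), i ≤ m →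
    inU k v ^ i * inU k w * inU k v ^ (m - i) ∈ powSpan k a := by
  induction m with
  | zero =>
    intro v w i hi
    obtain rfl : i = 0 := by omega
    simpa using pow_mem_powSpan (k := k) w 1
  | succ m ih =>
    intro v w
    have hdiff : ∀ i, i ≤ m + 1 → inU k v ^ i * inU k w * inU k v ^ (m + 1 - i) -
        inU k w * inU k v ^ (m + 1) ∈ powSpan k a := by
      intro i
      induction i with
      | zero => intro _; simp
      | succ i ihi =>
        intro hi
        have h1 := add_mem (ihi (by omega)) (ih v ⁅v, w⁆ i (by omega))
        convert h1 using 1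
        rw [inU_lie, show m + 1 - (i + 1) = m - i by omega, show m + 1 - i = m - i + 1 by omega,
          pow_succ (inU k v) i, pow_succ' (inU k v) (m - i)]
        noncomm_ring
    have hsum := sum_pow_mul_pow_mem (powSpan k a) (inU k v) (inU k w) (m + 1) (fun t => by
      rw [← map_smul, ← map_add]
      exact pow_mem_powSpan _ _)
    have hw : inU k w * inU k v ^ (m + 1) ∈ powSpan k a := by
      -- There are `m + 2` positions for `w` among `m + 1` factors `v`, and `m + 2` is invertible in
      -- characteristic zero.
      have h2 := sub_mem hsum (sum_mem (t := Finset.range (m + 1 + 1)) fun i hi =>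
        hdiff i (by rw [Finset.mem_range] at hi; omega))
      rw [← Finset.sum_sub_distrib] at h2
      simp only [sub_sub_cancel, Finset.sum_const, Finset.card_range] at h2
      rw [← Nat.cast_smul_eq_nsmul k] at h2
      exact (Submodule.smul_mem_iff _ (Nat.cast_ne_zero.2 (by omega))).1 h2
    intro i hi
    have := add_mem (hdiff i hi) hw
    rwa [sub_add_cancel] at this

/-- The surjectivity of the symmetrization map: the span contains the unit and is stable under left
multiplication by `a`. -/
theorem powSpan_eq_top : powSpan k a = ⊤ := by
  rw [Submodule.eq_top_iff']
  intro x
  induction x using U_induction with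
  | h1 => simpa using pow_mem_powSpan (k := k) (0 : a) 0
  | hadd x y hx hy => exact add_mem hx hy
  | hsmul c x hx => exact Submodule.smul_mem _ c hx
  | hmul w x hx =>
    rw [powSpan] at hx
    induction hx using Submodule.span_induction with
    | mem x hx =>
      obtain ⟨⟨v, m⟩, rfl⟩ := hx
      simpa using pow_mul_inU_mul_pow_mem m v w 0 (Nat.zero_le m)
    | zero => simp
    | add x y _ _ hx hy => rw [mul_add]; exact add_mem hx hy
    | smul c x _ hx => rw [mul_smul_comm]; exact Submodule.smul_mem _ c hx

theorem comul_inU_pow (v : a) (m : ℕ) : Coalgebra.comul (R := k) (inU k v ^ m) =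
    ∑ i ∈ Finset.range (m + 1), (m.choose i : k) • ((inU k v ^ i) ⊗ₜ[k] (inU k v ^ (m - i))) := by
  have hc : Commute (inU k v ⊗ₜ[k] (1 : U k a)) ((1 : U k a) ⊗ₜ[k] inU k v) := by
    simp [Commute, SemiconjBy]
  rw [Bialgebra.comul_pow, comul_inU, hc.add_pow]
  refine Finset.sum_congr rfl fun i _ => ?_
  rw [Algebra.TensorProduct.tmul_pow, Algebra.TensorProduct.tmul_pow, one_pow, one_pow,
    Algebra.TensorProduct.tmul_mul_tmul, mul_one, one_mul, ← nsmul_eq_mul', Nat.cast_smul_eq_nsmul]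

theorem counit_inU_pow (v : a) (m : ℕ) :
    Coalgebra.counit (R := k) (inU k v ^ (m + 1)) = 0 := by
  rw [pow_succ, Bialgebra.counit_mul, counit_inU, mul_zero]

variable (k a) in
/-- The convolution square of the identity of `U(a)`. -/
def convSq : Module.End k (U k a) := LinearMap.mul' k (U k a) ∘ₗ Coalgebra.comul

/-- On the group this is squaring, $e^{tv}\mapsto e^{2tv}$; on powers it is the sum of the binomial
coefficients. -/
theorem convSq_pow (v : a) (m : ℕ) : convSq k a (inU k v ^ m) = (2 : k) ^ m • inU k v ^ m := by
  rw [convSq, LinearMap.comp_apply, comul_inU_pow, map_sum]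
  have : ∀ i ∈ Finset.range (m + 1), LinearMap.mul' k (U k a)
      ((m.choose i : k) • ((inU k v ^ i) ⊗ₜ[k] (inU k v ^ (m - i)))) =
      (m.choose i : k) • inU k v ^ m := by
    intro i hi
    rw [Finset.mem_range] at hi
    rw [map_smul, LinearMap.mul'_apply, ← pow_add, show i + (m - i) = m by omega]
  rw [Finset.sum_congr rfl this, ← Finset.sum_smul, ← Nat.cast_sum, Nat.sum_range_choose]
  simp

/-- The eigenvalues $2^m$ of `convSq` are distinct in characteristic zero, so they separate the
degrees of the powers; no PBW basis is needed. -/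
theorem exists_diagonal_pow (c : ℕ → k) : ∃ T : Module.End k (U k a), ∀ (v : a) (m : ℕ),
    T (inU k v ^ m) = c m • inU k v ^ m := by
  have hμ : Function.Injective (fun m : ℕ => (2 : k) ^ m) := by
    intro m m' h
    have h' : ((2 ^ m : ℕ) : k) = ((2 ^ m' : ℕ) : k) := by simpa using h
    exact Nat.pow_right_injective le_rfl (Nat.cast_injective h')
  obtain ⟨T, hT⟩ := exists_diagonal (convSq k a) (fun p : a × ℕ => inU k p.1 ^ p.2)
    (by rw [← powSpan_eq_top]; exact le_rfl) (fun p => p.2) _ hμ (fun p => convSq_pow p.1 p.2) c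
  exact ⟨T, fun v m => hT (v, m)⟩

/-- A formal Hadamard lemma: an element `y` of `U(a)` is `ε(y)` plus a sum of
`G (e_i y₂) ξ_i(y₁)` where `ξ_i (1) = 0`. -/
theorem exists_hadamard {n : Type*} [Fintype n] (e : Module.Basis n k a) :
    ∃ (ξ : n → Module.Dual k (U k a)) (G : Module.End k (U k a)), (∀ i, ξ i 1 = 0) ∧
      ∀ y, y = Coalgebra.counit (R := k) y • 1 + ∑ i, G (inU k (e i) *
        TensorProduct.lid k _ ((ξ i).rTensor (U k a) (Coalgebra.comul (R := k) y))) := by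
  -- `E` is the projection to degree one, whose components are the coordinate functions $\xi_i$. `G`
  -- inverts the Euler operator, which multiplies degree $m$ by $m$; its value in degree zero plays
  -- no role.
  obtain ⟨E, hE⟩ := exists_diagonal_pow (k := k) (a := a) (fun m => if m = 1 then 1 else 0)
  obtain ⟨G, hG⟩ := exists_diagonal_pow (k := k) (a := a) (fun m => (m : k)⁻¹)
  have hE1 : E 1 = 0 := by simpa using hE 0 0
  have hspan : ∀ y : U k a, y ∈ Submodule.span k (Set.range fun p : a × ℕ => inU k p.1 ^ p.2) := by
    intro y
    have := powSpan_eq_top (k := k) (a := a)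
    rw [powSpan] at this
    rw [this]
    trivial
  have hr : ∀ y, E y ∈ LinearMap.range (inU k : a →ₗ[k] U k a) := by
    intro y
    induction hspan y using Submodule.span_induction with
    | mem y hy =>
      obtain ⟨⟨v, m⟩, rfl⟩ := hy
      rw [hE]
      split_ifs with h
      · exact ⟨v, by simp only at h ⊢; rw [h, pow_one, one_smul]⟩
      · simp
    | zero => simp
    | add x y _ _ hx hy => rw [map_add]; exact add_mem hx hy
    | smul c x _ hx => rw [map_smul]; exact Submodule.smul_mem _ c hx
  -- A linear section of `a` onto its image lifts `E` to `a` without using the injectivity of `inU`.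
  obtain ⟨s, hs⟩ := LinearMap.exists_rightInverse_of_surjective
    (inU k : a →ₗ[k] U k a).rangeRestrict (LinearMap.range_rangeRestrict _)
  let E' : U k a →ₗ[k] a := s ∘ₗ E.codRestrict _ hr
  have hE' : ∀ y, inU k (E' y) = E y := by
    intro y
    exact congrArg Subtype.val (congr($hs (E.codRestrict _ hr y)))
  refine ⟨fun i => e.coord i ∘ₗ E', G, fun i => ?_, fun y => ?_⟩
  · have h1 : E.codRestrict _ hr 1 = 0 := Subtype.ext hE1
    simp only [E', LinearMap.comp_apply, h1, map_zero]
  have hsum : ∀ t : U k a ⊗[k] U k a, ∑ i, inU k (e i) *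
      TensorProduct.lid k _ ((e.coord i ∘ₗ E').rTensor (U k a) t) =
      LinearMap.mul' k (U k a) (E.rTensor (U k a) t) := by
    intro t
    induction t using TensorProduct.induction_on with
    | zero => simp
    | add s t hs ht => simp only [map_add, mul_add, Finset.sum_add_distrib, hs, ht]
    | tmul x y =>
      rw [LinearMap.rTensor_tmul, LinearMap.mul'_apply, ← hE', ← e.sum_repr (E' x), map_sum,
        Finset.sum_mul]
      refine Finset.sum_congr rfl fun i _ => ?_
      simp
  rw [← map_sum, hsum]
  induction hspan y using Submodule.span_induction with
  | mem y hy =>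
    obtain ⟨⟨v, m⟩, rfl⟩ := hy
    simp only
    rw [comul_inU_pow, map_sum, map_sum]
    -- Only the term of degree one in the first factor survives; its binomial coefficient is the `m`
    -- that `G` divides out.
    have hterm : ∀ i ∈ Finset.range (m + 1), LinearMap.mul' k (U k a) (E.rTensor (U k a)
        ((m.choose i : k) • ((inU k v ^ i) ⊗ₜ[k] (inU k v ^ (m - i))))) =
        if i = 1 then (m : k) • inU k v ^ m else 0 := by
      intro i hi
      rw [Finset.mem_range] at hi
      rw [map_smul, map_smul, LinearMap.rTensor_tmul, hE, LinearMap.mul'_apply]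
      split_ifs with h
      · subst h
        rw [one_smul, ← pow_add, show 1 + (m - 1) = m by omega, Nat.choose_one_right]
      · simp
    rw [Finset.sum_congr rfl hterm, Finset.sum_ite_eq' ]
    cases m with
    | zero => simp
    | succ m =>
      rw [if_pos (by simp), map_smul, hG, smul_smul, mul_inv_cancel₀ (Nat.cast_ne_zero.2 (by omega)),
        one_smul, counit_inU_pow, zero_smul, zero_add]
  | zero => simp
  | add x y _ _ hx hy =>
    simp only [map_add, add_smul]
    conv_lhs => rw [hx, hy]
    abel
  | smul c x _ hx =>
    simp only [map_smul, smul_assoc]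
    conv_lhs => rw [hx]
    rw [smul_add]

end EnvelopingPowers
-- Coderivations and their transposes
section Coderivations

variable {k : Type*} [Field k] {C : Type*} [AddCommGroup C] [Module k C] [Coalgebra k C]
  [Coalgebra.IsCocomm k C] {C' : Type*} [AddCommGroup C'] [Module k C'] [Coalgebra k C']
  [Coalgebra.IsCocomm k C']

theorem tensor_ext_dual {V : Type*} [AddCommGroup V] [Module k V] {s t : V ⊗[k] V}
    (h : ∀ f g : Module.Dual k V, TensorProduct.dualDistrib k V V (f ⊗ₜ g) s =
      TensorProduct.dualDistrib k V V (f ⊗ₜ g) t) : s = t := by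
  let e := Module.Basis.ofVectorSpace k V
  have key : ∀ (u : V ⊗[k] V) i j, (e.tensorProduct e).repr u (i, j) =
      TensorProduct.dualDistrib k V V (e.coord i ⊗ₜ e.coord j) u := by
    intro u i j
    induction u using TensorProduct.induction_on with
    | zero => simp
    | add s t hs ht => simp only [map_add, Finsupp.add_apply, hs, ht]
    | tmul x y => simp [mul_comm]
  apply (e.tensorProduct e).repr.injective
  ext ⟨i, j⟩
  rw [key, key, h]

/-- `T` is a coderivation of `C`. -/
def IsCoderiv (T : C →ₗ[k] C) : Prop :=
  ∀ x, Coalgebra.comul (R := k) (T x) =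
    T.rTensor C (Coalgebra.comul (R := k) x) + T.lTensor C (Coalgebra.comul (R := k) x)

theorem transpose_mul_apply (T : C →ₗ[k] C) (f g : DualAlg k C) (x : C) :
    (transpose T f * g + f * transpose T g) x =
      LinearMap.mul' k k (TensorProduct.map ((toDualAlg k C).symm f) ((toDualAlg k C).symm g)
        (T.rTensor C (Coalgebra.comul (R := k) x) + T.lTensor C (Coalgebra.comul (R := k) x))) := by
  rw [DualAlg.add_apply, DualAlg.mul_apply, DualAlg.mul_apply]
  induction Coalgebra.comul (R := k) x using TensorProduct.induction_on with
  | zero => simp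
  | add s t hs ht => simp only [map_add] at *; linear_combination hs + ht
  | tmul y z => simp [← DualAlg.coe_def]

theorem IsCoderiv.transpose_mul {T : C →ₗ[k] C} (hT : IsCoderiv T) (f g : DualAlg k C) :
    transpose T (f * g) = transpose T f * g + f * transpose T g := by
  ext x
  rw [transpose_mul_apply, transpose_apply, DualAlg.mul_apply, hT]

/-- Products of linear forms separate the points of $C\otimes C$. Coderivations extend to the
algebraic tensor product of coalgebras, and transposing back gives derivations of the completed
tensor product of the dual algebras. -/
theorem IsCoderiv.of_transpose {T : C →ₗ[k] C}
    (h : ∀ f g : DualAlg k C, transpose T (f * g) = transpose T f * g + f * transpose T g) :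
    IsCoderiv T := by
  intro x
  apply tensor_ext_dual
  intro f g
  exact congrArg (fun F : DualAlg k C => F x) (h (toDualAlg k C f) (toDualAlg k C g)) |>.trans
    (transpose_mul_apply _ _ _ _)

theorem IsCoderiv.counit {T : C →ₗ[k] C} (hT : IsCoderiv T) (x : C) :
    Coalgebra.counit (R := k) (T x) = 0 := by
  have h := hT.transpose_mul 1 1
  simp only [mul_one, one_mul, left_eq_add] at h
  exact congrArg (fun F : DualAlg k C => F x) h

theorem IsCoderiv.rTensor {T : C →ₗ[k] C} (hT : IsCoderiv T) : IsCoderiv (T.rTensor C') := by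
  intro x
  induction x using TensorProduct.induction_on with
  | zero => simp
  | add s t hs ht => simp only [map_add, hs, ht]; abel
  | tmul x y =>
    rw [LinearMap.rTensor_tmul, TensorProduct.comul_tmul, TensorProduct.comul_tmul, hT]
    induction Coalgebra.comul (R := k) x using TensorProduct.induction_on with
    | zero => simp
    | add s t hs ht =>
      simp only [map_add, TensorProduct.add_tmul] at hs ht ⊢
      rw [add_add_add_comm, hs, ht]
      abel
    | tmul p q =>
      induction Coalgebra.comul (R := k) y using TensorProduct.induction_on with
      | zero => simp
      | add s t hs ht =>
        simp only [map_add, TensorProduct.tmul_add] at hs ht ⊢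
        rw [hs, ht]
        abel
      | tmul r s => simp [TensorProduct.add_tmul]

theorem IsCoderiv.lTensor {T : C' →ₗ[k] C'} (hT : IsCoderiv T) : IsCoderiv (T.lTensor C) := by
  intro x
  induction x using TensorProduct.induction_on with
  | zero => simp
  | add s t hs ht => simp only [map_add, hs, ht]; abel
  | tmul x y =>
    rw [LinearMap.lTensor_tmul, TensorProduct.comul_tmul, TensorProduct.comul_tmul, hT]
    induction Coalgebra.comul (R := k) y using TensorProduct.induction_on with
    | zero => simp
    | add s t hs ht =>
      simp only [map_add, TensorProduct.tmul_add] at hs ht ⊢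
      rw [add_add_add_comm, hs, ht]
      abel
    | tmul p q =>
      induction Coalgebra.comul (R := k) x using TensorProduct.induction_on with
      | zero => simp
      | add s t hs ht =>
        simp only [map_add, TensorProduct.add_tmul] at hs ht ⊢
        rw [hs, ht]
        abel
      | tmul r s => simp [TensorProduct.tmul_add]

theorem DualAlg.ext_tmul {φ ψ : DualAlg k (C ⊗[k] C')} (h : ∀ x y, φ (x ⊗ₜ y) = ψ (x ⊗ₜ y)) :
    φ = ψ := (toDualAlg k _).symm.injective (TensorProduct.ext' h)

end Coderivations
-- Derivations of $k[[H^*\times G]]$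
section Formal

variable {k : Type*} [Field k] [CharZero k]
  {g : Type*} [LieRing g] [LieAlgebra k g] [LieBialgebra k g]
  {h : Type*} [LieRing h] [LieAlgebra k h] [LieBialgebra k h] [FiniteDimensional k h]

/-- Since $1\otimes\gamma$ pairs with $U(\mathfrak h^*)$ through the counit, only the coproduct of
`y` remains. -/
theorem formalRight_mul_apply (γ : (FunctionRing.formal k g).carrier) (φ : FormalFun k g h)
    (x : U k (DualLie k h)) (y : U k g) : (formalRight k g h γ * φ) (x ⊗ₜ y) =
      LinearMap.mul' k k (TensorProduct.map ((toDualAlg k _).symm γ.1)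
        ((toDualAlg k _).symm φ ∘ₗ TensorProduct.mk k _ _ x) (Coalgebra.comul (R := k) y)) := by
  have key : ∀ (s : U k (DualLie k h) ⊗[k] U k (DualLie k h)) (t : U k g ⊗[k] U k g),
      LinearMap.mul' k k (TensorProduct.map ((toDualAlg k _).symm (formalRight k g h γ))
        ((toDualAlg k _).symm φ) (TensorProduct.tensorTensorTensorComm k _ _ _ _ (s ⊗ₜ t))) =
      LinearMap.mul' k k (TensorProduct.map ((toDualAlg k _).symm γ.1)
        ((toDualAlg k _).symm φ ∘ₗ TensorProduct.mk k _ _ (TensorProduct.lid k _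
          (Coalgebra.counit.rTensor _ s))) t) := by
    intro s t
    induction t using TensorProduct.induction_on with
    | zero => simp
    | add t t' ht ht' => simp only [map_add, TensorProduct.tmul_add, ht, ht']
    | tmul p q =>
      induction s using TensorProduct.induction_on with
      | zero => simp
      | add s s' hs hs' =>
        simp only [map_add, TensorProduct.add_tmul, hs, hs', TensorProduct.map_tmul,
          LinearMap.comp_add, LinearMap.add_apply, TensorProduct.tmul_add]
      | tmul r s =>
        have h1 := formalRight_apply (h := h) γ r p
        rw [DualAlg.coe_def] at h1
        simp only [TensorProduct.tensorTensorTensorComm_tmul, TensorProduct.map_tmul,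
          LinearMap.mul'_apply, h1, LinearMap.rTensor_tmul, TensorProduct.lid_tmul,
          LinearMap.comp_apply, map_smul, LinearMap.smul_apply, smul_eq_mul]
        rw [TensorProduct.mk_apply]
        ring
  rw [DualAlg.mul_apply, TensorProduct.comul_tmul]
  refine (key _ _).trans ?_
  rw [Coalgebra.rTensor_counit_comul, TensorProduct.lid_tmul, one_smul]

/-- The derivation is not assumed continuous. The finite decomposition `hφ` replaces density: it can
be iterated, and each iteration improves the order of vanishing of `D φ` along $H^*\times\{1\}$. -/
theorem derivDetermined_formal [FiniteDimensional k g] :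
    DerivDetermined (formalLeft k g h) (formalRight k g h) := by
  intro D hD hi hj
  let e := Module.finBasis k g
  obtain ⟨ξ, G, hξ, hG⟩ := exists_hadamard e
  let Ξ : Fin (Module.finrank k g) → (FunctionRing.formal k g).carrier :=
    fun i => ⟨toDualAlg k _ (ξ i), trivial⟩
  let T : Fin (Module.finrank k g) → FormalFun k g h → FormalFun k g h := fun i =>
    transpose ((G ∘ₗ LinearMap.mulLeft k (inU k (e i))).lTensor _)
  -- The Hadamard formula in the variable `y`; `f` is the restriction of `φ` to $H^*\times\{1\}$.
  have hφ : ∀ φ : FormalFun k g h, ∃ f, φ = formalLeft k g h f +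
      ∑ i, formalRight k g h (Ξ i) * T i φ := by
    intro φ
    refine ⟨⟨toDualAlg k _ ((toDualAlg k _).symm φ ∘ₗ (TensorProduct.mk k _ _).flip 1), trivial⟩, ?_⟩
    apply DualAlg.ext_tmul
    intro x y
    rw [DualAlg.add_apply, DualAlg.sum_apply, formalLeft_apply]
    conv_lhs => rw [hG y, TensorProduct.tmul_add, TensorProduct.tmul_sum, TensorProduct.tmul_smul,
      DualAlg.coe_def, map_add, map_sum, map_smul]
    congr 1
    · rw [smul_eq_mul, mul_comm]
      rfl
    · refine Finset.sum_congr rfl fun i _ => ?_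
      rw [formalRight_mul_apply]
      induction Coalgebra.comul (R := k) y using TensorProduct.induction_on with
      | zero => simp
      | add s t hs ht => simp only [map_add, mul_add, TensorProduct.tmul_add, hs, ht]
      | tmul p q =>
        simp only [LinearMap.rTensor_tmul, TensorProduct.lid_tmul, mul_smul_comm, map_smul,
          TensorProduct.tmul_smul, smul_eq_mul, TensorProduct.map_tmul, LinearMap.mul'_apply]
        rfl
  have hDφ : ∀ φ, D φ = ∑ i, formalRight k g h (Ξ i) * D (T i φ) := by
    intro φ
    have hs : ∀ (s : Finset (Fin (Module.finrank k g))) (F : Fin (Module.finrank k g) →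
        FormalFun k g h), D (∑ i ∈ s, F i) = ∑ i ∈ s, D (F i) :=
      fun s F => map_sum (AddMonoidHom.mk' D hD.add) F s
    obtain ⟨f, hf⟩ := hφ φ
    conv_lhs => rw [hf, hD.add, hi, zero_add, hs]
    refine Finset.sum_congr rfl fun i _ => ?_
    rw [hD.mul, hj, zero_mul, zero_add]
  -- The statement covers all `φ`, since the induction passes to `T i φ`. A factor `Ξ i` vanishes at
  -- the unit, so it must absorb at least one `v`, and the degree drops.
  have key : ∀ (m : ℕ) (φ : FormalFun k g h) (x : U k (DualLie k h)) (v : g),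
      D φ (x ⊗ₜ (inU k v ^ m)) = 0 := by
    intro m
    induction m using Nat.strong_induction_on with
    | _ m ih =>
      intro φ x v
      rw [hDφ, DualAlg.sum_apply]
      refine Finset.sum_eq_zero fun i _ => ?_
      rw [formalRight_mul_apply, comul_inU_pow, map_sum, map_sum]
      refine Finset.sum_eq_zero fun j hj => ?_
      rw [map_smul, map_smul, TensorProduct.map_tmul, LinearMap.mul'_apply]
      rcases Nat.eq_zero_or_pos j with rfl | hj0
      · have : (toDualAlg k _).symm (Ξ i).1 (inU k v ^ 0) = 0 := by
          rw [pow_zero]; exact hξ i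
        rw [this, zero_mul, smul_zero]
      · rw [Finset.mem_range] at hj
        have := ih (m - j) (by omega) (T i φ) x v
        rw [DualAlg.coe_def] at this
        rw [LinearMap.comp_apply, TensorProduct.mk_apply, this, mul_zero, smul_zero]
  intro φ
  apply DualAlg.ext_tmul
  intro x y
  have hy : y ∈ powSpan k g := by rw [powSpan_eq_top]; trivial
  rw [powSpan] at hy
  change D φ (x ⊗ₜ y) = 0
  induction hy using Submodule.span_induction with
  | mem y hy =>
    obtain ⟨⟨v, m⟩, rfl⟩ := hy
    exact key m φ x v
  | zero => simp [DualAlg.coe_def]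
  | add y z _ _ hy hz =>
    rw [TensorProduct.tmul_add, DualAlg.coe_def, map_add, ← DualAlg.coe_def, ← DualAlg.coe_def,
      hy, hz, add_zero]
  | smul c y _ hy => rw [TensorProduct.tmul_smul, DualAlg.coe_def, map_smul, ← DualAlg.coe_def, hy,
      smul_zero]

end Formal

/-! ### The formal case -/

section Formal

variable {k : Type*} [Field k] [CharZero k]

theorem leftT_coderiv {a : Type*} [LieRing a] [LieAlgebra k a] (v : a) : IsCoderiv (leftT k a v) :=
  IsCoderiv.of_transpose (leftTr_mul v)

theorem rightT_coderiv {a : Type*} [LieRing a] [LieAlgebra k a] (v : a) :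
    IsCoderiv (rightT k a v) :=
  IsCoderiv.of_transpose (rightTr_mul v)

theorem dressT_coderiv {a : Type*} [LieRing a] [LieAlgebra k a] [LieBialgebra k a]
    [FiniteDimensional k a] (v : a × Module.Dual k a) : IsCoderiv (dressT k a v) :=
  IsCoderiv.of_transpose (dress_mul v)

variable
  {g : Type*} [LieRing g] [LieAlgebra k g] [LieBialgebra k g] [FiniteDimensional k g]
  {h : Type*} [LieRing h] [LieAlgebra k h] [LieBialgebra k h] [FiniteDimensional k h]

theorem transpose_rTensor_formalLeft (T : Module.End k (U k (DualLie k h)))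
    (f f' : (FunctionRing.formal k (DualLie k h)).carrier) (hf : transpose T f.1 = f'.1) :
    transpose (T.rTensor (U k g)) (formalLeft k g h f) = formalLeft k g h f' := by
  apply DualAlg.ext_tmul
  intro x y
  rw [transpose_apply, LinearMap.rTensor_tmul, formalLeft_apply, formalLeft_apply, ← hf,
    transpose_apply]

theorem transpose_rTensor_formalRight {T : Module.End k (U k (DualLie k h))} (hT : IsCoderiv T)
    (γ : (FunctionRing.formal k g).carrier) :
    transpose (T.rTensor (U k g)) (formalRight k g h γ) = 0 := by
  apply DualAlg.ext_tmul
  intro x y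
  rw [transpose_apply, LinearMap.rTensor_tmul, formalRight_apply, hT.counit, zero_mul]
  rfl

theorem transpose_lTensor_formalRight (T : Module.End k (U k g))
    (γ γ' : (FunctionRing.formal k g).carrier) (hγ : transpose T γ.1 = γ'.1) :
    transpose (T.lTensor (U k (DualLie k h))) (formalRight k g h γ) = formalRight k g h γ' := by
  apply DualAlg.ext_tmul
  intro x y
  rw [transpose_apply, LinearMap.lTensor_tmul, formalRight_apply, formalRight_apply, ← hγ,
    transpose_apply]

theorem transpose_lTensor_formalLeft {T : Module.End k (U k g)} (hT : IsCoderiv T)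
    (f : (FunctionRing.formal k (DualLie k h)).carrier) :
    transpose (T.lTensor (U k (DualLie k h))) (formalLeft k g h f) = 0 := by
  apply DualAlg.ext_tmul
  intro x y
  rw [transpose_apply, LinearMap.lTensor_tmul, formalLeft_apply, hT.counit, mul_zero]
  rfl

/-- The biderivation `∑ X_m ⊗ Y_m`. -/
def sumBider {B m : Type*} [CommRing B] [Algebra k B] [Fintype m] (X Y : m → Module.End k B) :
    B →ₗ[k] B →ₗ[k] B :=
  ∑ i, (LinearMap.mul k B).compl₁₂ (X i) (Y i)

section

variable {B m : Type*} [CommRing B] [Algebra k B] [Fintype m] {X Y : m → Module.End k B}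

theorem sumBider_apply (φ ψ : B) : sumBider X Y φ ψ = ∑ i, X i φ * Y i ψ := by
  simp only [sumBider, LinearMap.sum_apply, LinearMap.compl₁₂_apply, LinearMap.mul_apply']

theorem sumBider_mul_left (hX : ∀ i φ ψ, X i (φ * ψ) = X i φ * ψ + φ * X i ψ) (φ ψ χ : B) :
    sumBider X Y (φ * ψ) χ = sumBider X Y φ χ * ψ + φ * sumBider X Y ψ χ := by
  simp only [sumBider_apply, hX, Finset.sum_mul, Finset.mul_sum, ← Finset.sum_add_distrib]
  exact Finset.sum_congr rfl fun i _ => by ring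

theorem sumBider_mul_right (hY : ∀ i φ ψ, Y i (φ * ψ) = Y i φ * ψ + φ * Y i ψ) (φ ψ χ : B) :
    sumBider X Y φ (ψ * χ) = sumBider X Y φ ψ * χ + ψ * sumBider X Y φ χ := by
  simp only [sumBider_apply, hY, Finset.sum_mul, Finset.mul_sum, ← Finset.sum_add_distrib]
  exact Finset.sum_congr rfl fun i _ => by ring

theorem sumBider_eq_zero {ψ : B} (hX : ∀ i, X i ψ = 0) (hY : ∀ i, Y i ψ = 0) (φ : B) :
    sumBider X Y φ ψ = 0 ∧ sumBider X Y ψ φ = 0 := by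
  simp only [sumBider_apply, hX, hY, mul_zero, zero_mul, Finset.sum_const_zero, and_self]

end

/-- The pairing of dressing operators and translations that represents the Poisson bracket. -/
theorem formal_bracket_eq {a m : Type*} [LieRing a] [LieAlgebra k a] [LieBialgebra k a]
    [FiniteDimensional k a] [Fintype m] (e : Module.Basis m k a)
    (f f' : (FunctionRing.formal k a).carrier) : (FunctionRing.formal k a).bracket f f' =
      ∑ i, (⟨dualDress k a (e.coord i) f.1, trivial⟩ : (FunctionRing.formal k a).carrier) *
        (FunctionRing.formal k a).left (e i) f' := by
  apply Subtype.ext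
  change plBracket k a f.1 f'.1 = _
  rw [plBracket_eq_dress e, AddSubmonoidClass.coe_finsetSum]
  rfl

variable (k g h) in
/-- The calculus on the functions on the product of two formal groups. -/
def formalCalculus : ProductCalculus (formalLeft k g h) (formalRight k g h) where
  transH ξ := transpose ((leftT k _ ξ).rTensor (U k g))
  transH_mul ξ := (leftT_coderiv ξ).rTensor.transpose_mul
  transH_left ξ f := transpose_rTensor_formalLeft _ f _ rfl
  transH_right ξ γ := transpose_rTensor_formalRight (leftT_coderiv ξ) γ
  transG x := transpose ((leftT k g x).lTensor (U k (DualLie k h)))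
  transG_mul x := (leftT_coderiv x).lTensor.transpose_mul
  transG_left x f := transpose_lTensor_formalLeft (leftT_coderiv x) f
  transG_right x γ := transpose_lTensor_formalRight _ γ _ rfl
  -- A bilinear map on one factor need not extend to the completed tensor product, but its
  -- expression as a finite sum of products of derivations does, by extending each coderivation.
  brH := sumBider
    (fun i => transpose ((dressT k _ (0, (Module.finBasis k (DualLie k h)).coord i)).rTensor (U k g)))
    (fun i => transpose ((leftT k _ (Module.finBasis k (DualLie k h) i)).rTensor (U k g)))
  brH_mul_left := sumBider_mul_left fun i => (dressT_coderiv _).rTensor.transpose_mul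
  brH_mul_right := sumBider_mul_right fun i => (leftT_coderiv _).rTensor.transpose_mul
  brH_left f f' := by
    rw [sumBider_apply, formal_bracket_eq (Module.finBasis k (DualLie k h)), map_sum]
    refine Finset.sum_congr rfl fun i _ => ?_
    rw [map_mul]
    exact congrArg₂ (· * ·) (transpose_rTensor_formalLeft _ f _ rfl)
      (transpose_rTensor_formalLeft _ f' _ rfl)
  brH_right φ γ := sumBider_eq_zero (fun i => transpose_rTensor_formalRight (dressT_coderiv _) γ)
    (fun i => transpose_rTensor_formalRight (leftT_coderiv _) γ) φ
  brG := sumBider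
    (fun i => transpose ((dressT k g (0, (Module.finBasis k g).coord i)).lTensor
      (U k (DualLie k h))))
    (fun i => transpose ((leftT k g (Module.finBasis k g i)).lTensor (U k (DualLie k h))))
  brG_mul_left := sumBider_mul_left fun i => (dressT_coderiv _).lTensor.transpose_mul
  brG_mul_right := sumBider_mul_right fun i => (leftT_coderiv _).lTensor.transpose_mul
  brG_right γ γ' := by
    rw [sumBider_apply, formal_bracket_eq (Module.finBasis k g), map_sum]
    refine Finset.sum_congr rfl fun i _ => ?_
    rw [map_mul]
    exact congrArg₂ (· * ·) (transpose_lTensor_formalRight _ γ _ rfl)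
      (transpose_lTensor_formalRight _ γ' _ rfl)
  brG_left φ f := sumBider_eq_zero (fun i => transpose_lTensor_formalLeft (dressT_coderiv _) f)
    (fun i => transpose_lTensor_formalLeft (leftT_coderiv _) f) φ

theorem formalActH_apply (ι : h →ₗ⁅k⁆ g) (u : h) (φ : FormalFun k g h) : formalActH ι u φ =
    transpose ((dressT k (DualLie k h) (toDouble u)).rTensor (U k g)) φ +
      transpose ((leftT k g (ι u)).lTensor (U k (DualLie k h))) φ := by
  change transposeHom k _ _ (_ + _) φ = _
  rw [map_add]
  rfl

theorem formal_isQuasiPoisson {ι : h →ₗ⁅k⁆ g} {n : Type*} [Fintype n] {b : Module.Basis n k h}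
    {Z : g ⊗[k] (g ⊗[k] g)}
    {ρ : (g ⊗[k] g) ⊗[k] (FunctionRing.formal k (DualLie k h)).carrier}
    (hδ : ∀ u : h, cobr k g (ι u) =
      TensorProduct.map (ι : h →ₗ[k] g) (ι : h →ₗ[k] g) (cobr k h u))
    (hρ : IsPLDynamicalRMatrix (FunctionRing.formal k (DualLie k h))
      FunctionRing.formal_adjointExtends ι b Z ρ)
    {br : FormalFun k g h →ₗ[k] FormalFun k g h →ₗ[k] FormalFun k g h}
    (hb : IsDynamicalBracket (FunctionRing.formal k (DualLie k h)) (FunctionRing.formal k g)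
      (formalLeft k g h) (formalRight k g h) ι b ρ br) :
    IsQuasiPoisson Z (formalActH ι) (formalActG k g h) br := by
  refine hb.isQuasiPoisson derivDetermined_formal hδ hρ ?_ ?_ ?_ ?_ ?_ ?_
  · intro u φ ψ
    rw [formalActH_apply, formalActH_apply, formalActH_apply,
      (dressT_coderiv _).rTensor.transpose_mul, (leftT_coderiv _).lTensor.transpose_mul]
    ring
  · intro u f
    rw [formalActH_apply, transpose_lTensor_formalLeft (leftT_coderiv _), add_zero]
    exact transpose_rTensor_formalLeft _ f _ rfl
  · intro u γ
    rw [formalActH_apply, transpose_rTensor_formalRight (dressT_coderiv _), zero_add]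
    exact transpose_lTensor_formalRight _ γ _ rfl
  · intro x φ ψ
    exact (rightT_coderiv x).lTensor.transpose_mul φ ψ
  · intro x f
    exact transpose_lTensor_formalLeft (rightT_coderiv x) f
  · intro x γ
    exact transpose_lTensor_formalRight _ γ _ rfl

end Formal

end PLGroup

end

/-! ### The proposition for formal and for algebraic groups -/

theorem mainTheorem3 {k : Type*} [Field k] [CharZero k]
    {g : Type*} [LieRing g] [LieAlgebra k g] [FiniteDimensional k g] [PLGroup.LieBialgebra k g]
    {h : Type*} [LieRing h] [LieAlgebra k h] [FiniteDimensional k h] [PLGroup.LieBialgebra k h]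
    (ι : h →ₗ⁅k⁆ g) (hι : Function.Injective ι)
    (hδ : ∀ u : h, PLGroup.cobr k g (ι u) =
      TensorProduct.map (ι : h →ₗ[k] g) (ι : h →ₗ[k] g) (PLGroup.cobr k h u))
    {n : Type*} [Fintype n] (b : Module.Basis n k h)
    (Z : g ⊗[k] (g ⊗[k] g)) (hZ : PLGroup.IsInvariantTrivector k g Z) :
    -- formal groups: the completed tensor product of `k[[H^*]]` and `k[[G]]` is `k[[H^* × G]]`
    (∀ ρ : (g ⊗[k] g) ⊗[k] (PLGroup.FunctionRing.formal k (PLGroup.DualLie k h)).carrier,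
      PLGroup.IsBivector k g ρ →
      ∃! br : PLGroup.FormalFun k g h →ₗ[k] PLGroup.FormalFun k g h →ₗ[k] PLGroup.FormalFun k g h,
        PLGroup.IsDynamicalBracket (PLGroup.FunctionRing.formal k (PLGroup.DualLie k h))
          (PLGroup.FunctionRing.formal k g) (PLGroup.formalLeft k g h)
          (PLGroup.formalRight k g h) ι b ρ br) ∧
    (∀ ρ : (g ⊗[k] g) ⊗[k] (PLGroup.FunctionRing.formal k (PLGroup.DualLie k h)).carrier,
      PLGroup.IsPLDynamicalRMatrix (PLGroup.FunctionRing.formal k (PLGroup.DualLie k h))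
        PLGroup.FunctionRing.formal_adjointExtends ι b Z ρ →
      ∀ br, PLGroup.IsDynamicalBracket (PLGroup.FunctionRing.formal k (PLGroup.DualLie k h))
          (PLGroup.FunctionRing.formal k g) (PLGroup.formalLeft k g h)
          (PLGroup.formalRight k g h) ι b ρ br →
        PLGroup.IsQuasiPoisson Z (PLGroup.formalActH ι) (PLGroup.formalActG k g h) br) ∧
    -- algebraic groups
    (∀ (OH : PLGroup.HopfFunctionRing k (PLGroup.DualLie k h)) (OG : PLGroup.HopfFunctionRing k g)
      (ρ : (g ⊗[k] g) ⊗[k] OH.toFunctionRing.carrier),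
      PLGroup.IsBivector k g ρ →
      ∃! br : (OH.toFunctionRing.carrier ⊗[k] OG.toFunctionRing.carrier) →ₗ[k]
          (OH.toFunctionRing.carrier ⊗[k] OG.toFunctionRing.carrier) →ₗ[k]
          (OH.toFunctionRing.carrier ⊗[k] OG.toFunctionRing.carrier),
        PLGroup.IsDynamicalBracket OH.toFunctionRing OG.toFunctionRing
          Algebra.TensorProduct.includeLeft Algebra.TensorProduct.includeRight ι b ρ br) ∧
    (∀ (OH : PLGroup.HopfFunctionRing k (PLGroup.DualLie k h)) (OG : PLGroup.HopfFunctionRing k g)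
      (hOH : OH.toFunctionRing.AdjointExtends)
      (ρ : (g ⊗[k] g) ⊗[k] OH.toFunctionRing.carrier),
      PLGroup.IsPLDynamicalRMatrix OH.toFunctionRing hOH ι b Z ρ →
      ∀ br, PLGroup.IsDynamicalBracket OH.toFunctionRing OG.toFunctionRing
          Algebra.TensorProduct.includeLeft Algebra.TensorProduct.includeRight ι b ρ br →
        PLGroup.IsQuasiPoisson (B := OH.toFunctionRing.carrier ⊗[k] OG.toFunctionRing.carrier) Z
          (PLGroup.algActH OH.toFunctionRing hOH OG.toFunctionRing ι)
          (PLGroup.algActG OH.toFunctionRing OG.toFunctionRing) br) := by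
  refine ⟨fun ρ hρ => ?_, fun ρ hρ br hb => PLGroup.formal_isQuasiPoisson hδ hρ hb,
    fun OH OG ρ hρ => ?_, fun OH OG hOH ρ hρ br hb => PLGroup.alg_isQuasiPoisson hδ hρ hb⟩
  · obtain ⟨br, hb⟩ := PLGroup.exists_isDynamicalBracket (ι := ι) (b := b)
      PLGroup.derivDetermined_formal (PLGroup.formalCalculus k g h) hρ
    exact ⟨br, hb, fun br' hb' => hb'.eq PLGroup.derivDetermined_formal hb⟩
  · obtain ⟨br, hb⟩ := PLGroup.exists_isDynamicalBracket (ι := ι) (b := b)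
      PLGroup.derivDetermined_tensorProduct
      (PLGroup.algCalculus OH.toFunctionRing OG.toFunctionRing) hρ
    exact ⟨br, hb, fun br' hb' => hb'.eq PLGroup.derivDetermined_tensorProduct hb⟩
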